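/- A graph $G$ is $k$-linked if it has at least $2k$ vertices and, for every choice of $2k$ distinct vertices $s_1,\dots,s_k,t_1,\dots,t_k$ of $G$, there are $k$ pairwise vertex-disjoint paths $L_1,\dots,L_k$ in $G$ such that $L_i$ joins $s_i$ to $t_i$. An $m$-cube is a polytope (the convex hull of finitely many points in some $\mathbb{R}^n$) whose face lattice is isomorphic to that of $\operatorname{conv}\{-1,1\}^m\subset\mathbb{R}^m$. The graph of a polytope, or of a set of faces of a polytope, is formed by its vertices and edges. The link of a vertex $v$ in a polytope $P$ is the set of faces of $P$ that do not contain $v$ but lie in a facet of $P$ that contains $v$. \textbf{Proposition.} Let $d\ge 2$ with $d\ne 3$, let $Q_{d+1}$ be a $(d+1)$-cube, and let $v$ be a vertex of $Q_{d+1}$. Then the graph of the link of $v$ in $Q_{d+1}$ is $\lfloor (d+1)/2\rfloor$-linked. Moreover, there is exactly one vertex $v^{o}$ of $Q_{d+1}$ at distance $d+1$ from $v$ in the graph of $Q_{d+1}$ (the vertex opposite to $v$), and the graph of the link of $v$ is the graph obtained from the graph of $Q_{d+1}$ by deleting the vertices $v$ and $v^{o}$. -/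

import Mathlib

namespace CubeLink

/-- A graph `G` is `k`-linked if it has at least `2k` vertices and, for all `2k` distinct vertices
`s 1, …, s k, t 1, …, t k`, there are pairwise vertex-disjoint paths joining `s i` to `t i`. -/
def IsLinked {V : Type*} (G : SimpleGraph V) (k : ℕ) : Prop :=
  ((2 * k : ℕ) : ℕ∞) ≤ ENat.card V ∧
    ∀ s t : Fin k → V, Function.Injective (Sum.elim s t) →
      ∃ L : ∀ i, G.Path (s i) (t i),
        Pairwise fun i j => List.Disjoint (L i).1.support (L j).1.support

variable {n : ℕ}

/-- A polytope is the convex hull of a finite set of points. -/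
def IsPolytope (P : Set (Fin n → ℝ)) : Prop :=
  ∃ S : Set (Fin n → ℝ), S.Finite ∧ P = convexHull ℝ S

/-- The dimension of a convex set (`-1` for the empty set). -/
noncomputable def dim (F : Set (Fin n → ℝ)) : ℤ :=
  open Classical in if F.Nonempty then (Module.finrank ℝ (vectorSpan ℝ F) : ℤ) else -1

/-- The faces of a polytope: `∅`, and the sets of points of `P` at which a linear functional attains
its maximum over `P` (the zero functional gives `P` itself, the nonzero ones give the
intersections of `P` with its supporting hyperplanes). -/
def faces (P : Set (Fin n → ℝ)) : Set (Set (Fin n → ℝ)) :=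
  {F | IsExposed ℝ P F}

/-- A facet of `P` is a face of dimension `dim P - 1`. -/
def IsFacet (P F : Set (Fin n → ℝ)) : Prop :=
  F ∈ faces P ∧ dim F = dim P - 1

/-- The standard `m`-cube: the convex hull of the `2 ^ m` vectors `(±1, …, ±1)`. -/
def stdCube (m : ℕ) : Set (Fin m → ℝ) :=
  convexHull ℝ {x | ∀ i, x i = 1 ∨ x i = -1}

/-- An `m`-cube is any polytope combinatorially equivalent to the standard `m`-cube: the face
lattices, ordered by inclusion, are isomorphic. -/
def IsCube (m : ℕ) (P : Set (Fin n → ℝ)) : Prop :=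
  IsPolytope P ∧ Nonempty (faces P ≃o faces (stdCube m))

/-- The link of `v` in `P`: the faces of `P` that do not contain `v` but lie in a facet of `P` that
contains `v`. -/
def link (P : Set (Fin n → ℝ)) (v : Fin n → ℝ) : Set (Set (Fin n → ℝ)) :=
  {F | F ∈ faces P ∧ v ∉ F ∧ ∃ G, IsFacet P G ∧ v ∈ G ∧ F ⊆ G}

/-- The vertices of a set `C` of faces: the points `x` such that `{x}` is a member of `C`. -/
abbrev Vertex (C : Set (Set (Fin n → ℝ))) : Type :=
  {x : Fin n → ℝ // {x} ∈ C}

/-- The graph of a set `C` of faces: its vertices, two of them adjacent when they are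
the ends of an edge (a one-dimensional member of `C`). -/
def graph (C : Set (Set (Fin n → ℝ))) : SimpleGraph (Vertex C) where
  Adj x y := x ≠ y ∧ ∃ e ∈ C, dim e = 1 ∧ x.1 ∈ e ∧ y.1 ∈ e
  symm := ⟨fun _ _ h => ⟨h.1.symm, h.2.imp fun _ he => ⟨he.1, he.2.1, he.2.2.2, he.2.2.1⟩⟩⟩
  loopless := ⟨fun _ h => h.1 rfl⟩

end CubeLink

/-! Put m = d + 1. An isomorphism of face lattices labels the vertices of the polytope by `Fin m →
Bool`. In these labels edges are single flips, opposite vertices are complementary labels, and the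
graph of the link is the hypercube without an antipodal pair. What remains is combinatorial: join
⌊m/2⌋ pairs disjointly in the m-dimensional hypercube while avoiding two antipodal vertices.

A forbidden vertex is treated as a degenerate pair with equal ends, and the weight of a linkage
problem is its number of distinct terminals. The core is `cubeLinked`: in dimension n ≥ 4 every
problem of weight at most n + 1 is solvable. Cut the cube in a direction j and give each split pair
a crossing edge. Neither half receives more weight than the whole, but by induction a half can only
carry weight n, so each half must gain one. It gains if some index misses it entirely, or if a split
pair crosses straight from its terminal there, leaving one vertex in place of two. If a direction
offers no such gain, then either it contains two parallel edges between terminals, or all terminals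
lie in one half; in the latter case one pair is joined there (`connIn_or_connIn`) and the others are
routed through the empty half (`Linkage.of_up`). If every direction contained two terminal edges,
contracting the directions one after another would force at least n + 2 terminals. The base case,
two pairs and one forbidden vertex in the 4-cube, is `twoLinked_four`.

For odd m the problem has weight m + 1 and is covered (m = 3 needs only connectivity). For even m ≥
6 the weight is m + 2 and each half must gain two. Antipodality gives one for free, since each half
misses one of the forbidden vertices u, u'. A direction resisting the second gain has two parallel
terminal edges, or a special shape around u or u' (`Single`), or all proper pairs on one side; the
last is settled by `IsAntipodal.linkage_of_side`. Each of the other three kinds occurs at most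
twice, so m ≤ 6; for m = 6 three disjoint triples of terminals give nine terminals where only eight
exist.

On the polytope side, faces are hulls of their vertices, every nonempty proper face lies in a facet
(by rotating a supporting hyperplane), and a face containing two antipodal vertices is everything.
These facts identify the link. -/

namespace CubeLink

/-! ### Hypercube, subcubes and their vertex connectivity -/

section Hypercube

set_option linter.unusedSectionVars false

variable {ι : Type*} [DecidableEq ι]

/-- The neighbour of `x` in direction `j` in the hypercube. -/
def flipAt (j : ι) (x : ι → Bool) : ι → Bool := Function.update x j (!x j)

@[simp] theorem flipAt_same (j : ι) (x : ι → Bool) : flipAt j x j = !x j := by simp [flipAt]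

theorem flipAt_ne {i j : ι} (h : i ≠ j) (x : ι → Bool) : flipAt j x i = x i := by
  simp [flipAt, h]

@[simp] theorem flipAt_flipAt (j : ι) (x : ι → Bool) : flipAt j (flipAt j x) = x := by
  ext i
  by_cases h : i = j
  · subst h; simp
  · simp [flipAt_ne h]

theorem flipAt_injective (j : ι) : Function.Injective (flipAt j) :=
  Function.LeftInverse.injective (flipAt_flipAt j)

theorem flipAt_ne_self (j : ι) (x : ι → Bool) : flipAt j x ≠ x := by
  intro h
  have := congrFun h j
  simp at this

theorem flipAt_dir_injective (x : ι → Bool) : Function.Injective fun j => flipAt j x := by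
  intro i j h
  by_contra hij
  have := congrFun h i
  simp [flipAt_ne hij] at this

/-- Parity: the hypercube is bipartite, so a vertex two flips away from `x` is never a neighbour of
`x`. -/
theorem flipAt_flipAt_ne (r a b : ι) (x : ι → Bool) : flipAt r (flipAt a x) ≠ flipAt b x := by
  intro h
  by_cases hra : r = a
  · subst hra
    rw [flipAt_flipAt] at h
    exact flipAt_ne_self b x h.symm
  · have h1 := congrFun h r
    have h2 := congrFun h a
    rw [flipAt_same, flipAt_ne hra] at h1
    rw [flipAt_ne (Ne.symm hra), flipAt_same] at h2
    by_cases hrb : r = b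
    · subst hrb
      rw [flipAt_ne (Ne.symm hra)] at h2
      simp at h2
    · rw [flipAt_ne hrb] at h1
      simp at h1

theorem update_eq_or (j : ι) (b : Bool) (x : ι → Bool) :
    Function.update x j b = x ∨ Function.update x j b = flipAt j x := by
  by_cases h : x j = b
  · left; subst h; simp
  · right
    have : b = !x j := by cases b <;> simp_all
    subst this; rfl

theorem update_of_eq {j : ι} {b : Bool} {x : ι → Bool} (h : x j = b) :
    Function.update x j b = x := by subst h; simp

theorem update_of_ne {j : ι} {b : Bool} {x : ι → Bool} (h : x j ≠ b) :
    Function.update x j b = flipAt j x := by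
  have : b = !x j := by cases b <;> simp_all
  subst this; rfl

theorem flipAt_update (j : ι) (b : Bool) (x : ι → Bool) :
    flipAt j (Function.update x j b) = Function.update x j (!b) := by
  simp [flipAt]

/-- The face of the hypercube through `c` with set of free directions `J`. -/
def subcube (J : Finset ι) (c : ι → Bool) : Set (ι → Bool) := {x | ∀ i ∉ J, x i = c i}

theorem self_mem_subcube (J : Finset ι) (c : ι → Bool) : c ∈ subcube J c := fun _ _ => rfl

theorem subcube_eq {J : Finset ι} {c x : ι → Bool} (h : x ∈ subcube J c) :
    subcube J c = subcube J x := by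
  ext y
  exact ⟨fun hy i hi => (hy i hi).trans (h i hi).symm, fun hy i hi => (hy i hi).trans (h i hi)⟩

theorem flipAt_mem_subcube {J : Finset ι} {c x : ι → Bool} {j : ι} (hj : j ∈ J)
    (h : x ∈ subcube J c) : flipAt j x ∈ subcube J c := by
  intro i hi
  rw [flipAt_ne (ne_of_mem_of_not_mem hj hi).symm, h i hi]

theorem update_mem_subcube {J : Finset ι} {c x : ι → Bool} {j : ι} (hj : j ∈ J) (b : Bool)
    (h : x ∈ subcube J c) : Function.update x j b ∈ subcube J c := by
  intro i hi
  rw [Function.update_of_ne (ne_of_mem_of_not_mem hj hi).symm, h i hi]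

theorem mem_side {J : Finset ι} {c x : ι → Bool} {j : ι} {b : Bool} (hj : j ∈ J) :
    x ∈ subcube (J.erase j) (Function.update c j b) ↔ x ∈ subcube J c ∧ x j = b := by
  constructor
  · intro h
    refine ⟨fun i hi => ?_, ?_⟩
    · rw [h i (fun hh => hi (Finset.mem_of_mem_erase hh)),
        Function.update_of_ne (ne_of_mem_of_not_mem hj hi).symm]
    · rw [h j (Finset.notMem_erase j J), Function.update_self]
  · rintro ⟨h, hb⟩ i hi
    by_cases hij : i = j
    · subst hij; rw [Function.update_self, hb]
    · rw [Function.update_of_ne hij, h i (fun hh => hi (Finset.mem_erase.2 ⟨hij, hh⟩))]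

theorem mem_subcube_erase {J : Finset ι} {c x : ι → Bool} {j : ι} (hj : j ∈ J) :
    x ∈ subcube (J.erase j) c ↔ x ∈ subcube J c ∧ x j = c j := by
  simpa using mem_side (c := c) (x := x) (b := c j) hj

theorem mem_dir {J : Finset ι} {c x y : ι → Bool} {j : ι} (hx : x ∈ subcube J c)
    (hy : y ∈ subcube J c) (h : x j ≠ y j) : j ∈ J := by
  by_contra hj
  exact h ((hx j hj).trans (hy j hj).symm)

theorem exists_finset_subcube [Finite ι] (J : Finset ι) (c : ι → Bool) :
    ∃ Y : Finset (ι → Bool), (Y : Set (ι → Bool)) = subcube J c ∧ Y.card = 2 ^ J.card := by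
  have := Fintype.ofFinite ι
  refine ⟨Fintype.piFinset fun i => if i ∈ J then Finset.univ else {c i}, ?_, ?_⟩
  · ext x
    simp only [Finset.mem_coe, Fintype.mem_piFinset, subcube, Set.mem_ofPred_eq]
    refine forall_congr' fun i => ?_
    by_cases hi : i ∈ J <;> simp [hi]
  · rw [Fintype.card_piFinset]
    have : ∀ i, (if i ∈ J then (Finset.univ : Finset Bool) else {c i}).card
        = if i ∈ J then 2 else 1 := by
      intro i; split_ifs <;> simp
    rw [Finset.prod_congr rfl fun i _ => this i, Finset.prod_ite]
    simp

theorem exists_injOn_subcube [Finite ι] {κ : Type*} (J : Finset ι) (c : ι → Bool)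
    (Z : Finset (ι → Bool)) (P : Finset κ) (h : Z.card + P.card ≤ 2 ^ J.card) :
    ∃ x : κ → ι → Bool, (∀ i ∈ P, x i ∈ subcube J c ∧ x i ∉ Z) ∧ Set.InjOn x P := by
  classical
  obtain ⟨Y, hY, hc⟩ := exists_finset_subcube J c
  have h1 : P.card ≤ (Y \ Z).card := by
    have := Finset.le_card_sdiff Z Y
    omega
  obtain ⟨x, hx⟩ := Function.Embedding.nonempty_of_card_le
    (α := P) (β := (Y \ Z : Finset (ι → Bool))) (by simpa using h1)
  refine ⟨fun i => if hi : i ∈ P then (x ⟨i, hi⟩ : ι → Bool) else c, ?_, ?_⟩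
  · intro i hi
    have := (x ⟨i, hi⟩).2
    simp only [Finset.mem_sdiff] at this
    simp only [hi, dif_pos, ← hY]
    exact ⟨this.1, this.2⟩
  · intro i hi l hl hil
    simp only [Finset.mem_coe] at hi hl
    simp only [hi, hl, dif_pos] at hil
    simpa using hx (Subtype.ext hil)

/-- `x` and `y` are joined by a path of the hypercube inside `C`. -/
def ConnIn (C : Set (ι → Bool)) (x y : ι → Bool) : Prop :=
  x ∈ C ∧ Relation.ReflTransGen (fun a b => b ∈ C ∧ ∃ j, b = flipAt j a) x y

namespace ConnIn

variable {C D : Set (ι → Bool)} {x y z : ι → Bool}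

theorem refl (h : x ∈ C) : ConnIn C x x := ⟨h, .refl⟩

theorem left (h : ConnIn C x y) : x ∈ C := h.1

theorem right (h : ConnIn C x y) : y ∈ C := by
  obtain ⟨hx, h⟩ := h
  induction h with
  | refl => exact hx
  | tail _ h _ => exact h.1

theorem trans (h : ConnIn C x y) (h' : ConnIn C y z) : ConnIn C x z := ⟨h.1, h.2.trans h'.2⟩

theorem edge (j : ι) (hx : x ∈ C) (hy : flipAt j x ∈ C) : ConnIn C x (flipAt j x) :=
  ⟨hx, .single ⟨hy, j, rfl⟩⟩

theorem symm (h : ConnIn C x y) : ConnIn C y x := by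
  have hx := h.1
  obtain ⟨-, h⟩ := h
  induction h with
  | refl => exact .refl hx
  | @tail b c hb h ih =>
    obtain ⟨hc, j, rfl⟩ := h
    have := ConnIn.edge j (x := flipAt j b) hc (by rw [flipAt_flipAt]; exact ih.left)
    rw [flipAt_flipAt] at this
    exact this.trans ih

theorem mono (h : ConnIn C x y) (hCD : C ⊆ D) : ConnIn D x y :=
  ⟨hCD h.1, Relation.ReflTransGen.mono (fun _ _ h => ⟨hCD h.1, h.2⟩) _ _ h.2⟩

end ConnIn

theorem card_filter_side (Z : Finset (ι → Bool)) (j : ι) (b : Bool) :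
    (Z.filter fun x => x j = b).card + (Z.filter fun x => x j = !b).card = Z.card := by
  rw [← Finset.card_filter_add_card_filter_not (s := Z) fun x => x j = b]
  congr 2
  ext x
  cases b <;> simp

/-- Project `Z` along `j` onto the half containing `s`: the image is smaller than the half, and an
edge over a point outside the image misses `Z` at both ends. -/
theorem exists_crossing [Finite ι] (J : Finset ι) (s : ι → Bool) {j : ι} (hj : j ∈ J)
    (Z : Finset (ι → Bool)) (h : Z.card < 2 ^ (J.card - 1)) :
    ∃ x ∈ subcube (J.erase j) s, x ∉ Z ∧ flipAt j x ∉ Z := by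
  classical
  obtain ⟨x, hx, -⟩ := exists_injOn_subcube (J.erase j) s
    (Z.image fun z => Function.update z j (s j)) ({()} : Finset Unit) (by
      have := Finset.card_image_le (s := Z) (f := fun z => Function.update z j (s j))
      rw [Finset.card_erase_of_mem hj, Finset.card_singleton]
      omega)
  obtain ⟨hx1, hx2⟩ := hx () (by simp)
  have hxj : x () j = s j := hx1 j (Finset.notMem_erase j J)
  refine ⟨x (), hx1, fun hz => hx2 ?_, fun hz => hx2 ?_⟩
  · exact Finset.mem_image.2 ⟨_, hz, update_of_eq hxj⟩
  · exact Finset.mem_image.2 ⟨_, hz, by rw [flipAt, Function.update_idem, ← hxj]; simp⟩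

theorem subcube_erase_subset (J : Finset ι) (j : ι) (c : ι → Bool) :
    subcube (J.erase j) c ⊆ subcube J c := fun _ hx i hi =>
  hx i fun h => hi (Finset.mem_of_mem_erase h)

/-- A connecting path in a half of a subcube avoids a set if it avoids the part in that half. -/
theorem ConnIn.of_side {J : Finset ι} {j : ι} {c x y : ι → Bool} {b : Bool}
    {Z : Finset (ι → Bool)} (hb : c j = b)
    (h : ConnIn (subcube (J.erase j) c \ ↑(Z.filter fun x => x j = b)) x y) :
    ConnIn (subcube (J.erase j) c \ ↑Z) x y := by
  refine h.mono fun z hz => ⟨hz.1, fun hzZ => hz.2 ?_⟩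
  simp only [Finset.coe_filter, Set.mem_ofPred_eq]
  exact ⟨hzZ, (hz.1 j (Finset.notMem_erase j J)).trans hb⟩

/-- The `n`-dimensional cube is `n`-connected. -/
theorem connIn_subcube_diff [Finite ι] (n : ℕ) (J : Finset ι) (hJ : J.card = n)
    (Z : Finset (ι → Bool)) (hZ : Z.card ≤ n - 1) (s t : ι → Bool) (ht : t ∈ subcube J s)
    (hsZ : s ∉ Z) (htZ : t ∉ Z) : ConnIn (subcube J s \ ↑Z) s t := by
  classical
  induction n generalizing J Z s t with
  | zero =>
    have : t = s := by
      ext i; rw [ht i]; rw [Finset.card_eq_zero] at hJ; simp [hJ]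
    subst this
    exact .refl ⟨ht, htZ⟩
  | succ n ih =>
    by_cases hst : s = t
    · subst hst; exact .refl ⟨ht, htZ⟩
    obtain ⟨j, hj⟩ := Function.ne_iff.1 hst
    have hjJ : j ∈ J := mem_dir (self_mem_subcube J s) ht hj
    have hJ' : (J.erase j).card = n := by rw [Finset.card_erase_of_mem hjJ]; omega
    have htj : t j = !s j := by
      cases h : s j <;> cases h' : t j <;> simp_all
    have hcard := card_filter_side Z j (s j)
    have hA : subcube (J.erase j) s \ ↑Z ⊆ subcube J s \ ↑Z :=
      Set.sdiff_subset_sdiff_left (subcube_erase_subset _ _ _)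
    have hB : subcube (J.erase j) t \ ↑Z ⊆ subcube J s \ ↑Z := by
      rw [subcube_eq ht]
      exact Set.sdiff_subset_sdiff_left (subcube_erase_subset _ _ _)
    -- from a crossing edge avoiding `Z` to a path, when both halves are small
    have key : ∀ x ∈ subcube (J.erase j) s, x ∉ Z → flipAt j x ∉ Z →
        ((Z.filter fun y => y j = s j).card ≤ n - 1 ∨ x = s) →
        ((Z.filter fun y => y j = !s j).card ≤ n - 1 ∨ flipAt j x = t) →
        ConnIn (subcube J s \ ↑Z) s t := by
      intro x hx hxZ hxZ' h1 h2
      have hxj : x j = s j := hx j (Finset.notMem_erase j J)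
      have hxJ : x ∈ subcube J s := subcube_erase_subset _ _ _ hx
      have hx' : flipAt j x ∈ subcube (J.erase j) t := by
        rw [mem_subcube_erase hjJ, ← subcube_eq ht]
        exact ⟨flipAt_mem_subcube hjJ hxJ, by rw [flipAt_same, hxj, htj]⟩
      have c1 : ConnIn (subcube J s \ ↑Z) s x := by
        rcases h1 with h1 | rfl
        · exact ((ih _ hJ' _ h1 s x hx (by simp [hsZ]) (by simp [hxZ])).of_side rfl).mono hA
        · exact .refl ⟨hxJ, hxZ⟩
      have c2 : ConnIn (subcube J s \ ↑Z) (flipAt j x) t := by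
        rcases h2 with h2 | h2
        · exact (((ih _ hJ' _ h2 t _ hx' (by simp [htZ]) (by simp [hxZ'])).of_side htj).mono
            hB).symm
        · rw [h2]; exact .refl ⟨ht, htZ⟩
      exact (c1.trans (.edge j ⟨hxJ, hxZ⟩ ⟨flipAt_mem_subcube hjJ hxJ, hxZ'⟩)).trans c2
    -- As `Z` has at most `n` elements, a half holding more than `n - 1` of them holds all. The
    -- other half is then free, and one crosses directly at the terminal in the crowded half.
    by_cases h1 : (Z.filter fun y => y j = s j).card ≤ n - 1
    · by_cases h2 : (Z.filter fun y => y j = !s j).card ≤ n - 1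
      · obtain ⟨x, hx, hxZ, hxZ'⟩ := exists_crossing J s hjJ Z (by
          rw [hJ]; exact lt_of_le_of_lt hZ (Nat.lt_two_pow_self))
        exact key x hx hxZ hxZ' (.inl h1) (.inl h2)
      · have h0 : (Z.filter fun y => y j = s j) = ∅ := by
          rw [← Finset.card_eq_zero]; omega
        have : flipAt j t ∉ Z := fun h => by
          have : flipAt j t ∈ (Z.filter fun y => y j = s j) := by simp [h, htj]
          simp [h0] at this
        refine key (flipAt j t) ?_ this (by simpa using htZ) (.inl h1) (.inr (flipAt_flipAt _ _))
        rw [mem_subcube_erase hjJ]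
        exact ⟨flipAt_mem_subcube hjJ ht, by simp [htj]⟩
    · have h0 : (Z.filter fun y => y j = !s j) = ∅ := by
        rw [← Finset.card_eq_zero]; omega
      have : flipAt j s ∉ Z := fun h => by
        have : flipAt j s ∈ (Z.filter fun y => y j = !s j) := by simp [h]
        simp [h0] at this
      exact key s (self_mem_subcube _ _) hsZ this (.inr rfl) (.inl (by simp [h0]))

/-- Two vertices of the `n`-cube can only be separated by `n` vertices if these are the
neighbours of one of them. -/
theorem connIn_subcube_diff_of_free [Finite ι] (J : Finset ι) (hJ : 3 ≤ J.card)
    (Z : Finset (ι → Bool)) (hZ : Z.card ≤ J.card) (s t : ι → Bool) (ht : t ∈ subcube J s)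
    (hsZ : s ∉ Z) (htZ : t ∉ Z) (hs : ∃ i ∈ J, flipAt i s ∉ Z) (ht' : ∃ i ∈ J, flipAt i t ∉ Z) :
    ConnIn (subcube J s \ ↑Z) s t := by
  classical
  by_cases hst : s = t
  · subst hst; exact .refl ⟨ht, htZ⟩
  obtain ⟨j, hj⟩ := Function.ne_iff.1 hst
  -- the case where most of `Z` is on the side of `s`
  have main : ∀ s t : ι → Bool, t ∈ subcube J s → s ∉ Z → t ∉ Z → (∃ i ∈ J, flipAt i s ∉ Z) →
      s j ≠ t j → J.card - 1 ≤ (Z.filter fun y => y j = s j).card →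
      ConnIn (subcube J s \ ↑Z) s t := by
    intro s t ht hsZ htZ hs hj hcard
    have hjJ : j ∈ J := mem_dir (self_mem_subcube J s) ht hj
    have hJ' : (J.erase j).card = J.card - 1 := Finset.card_erase_of_mem hjJ
    have htj : t j = !s j := by cases h : s j <;> cases h' : t j <;> simp_all
    have hc := card_filter_side Z j (s j)
    have hB : subcube (J.erase j) t \ ↑Z ⊆ subcube J s \ ↑Z := by
      rw [subcube_eq ht]
      exact Set.sdiff_subset_sdiff_left (subcube_erase_subset _ _ _)
    have top : ∀ x ∈ subcube J s, x j = t j → x ∉ Z → ConnIn (subcube J s \ ↑Z) x t := by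
      intro x hx hxj hxZ
      refine (((connIn_subcube_diff _ _ hJ' (Z.filter fun y => y j = !s j) (by omega) t x ?_
        (by simp [htZ]) (by simp [hxZ])).of_side htj).mono hB).symm
      rw [mem_subcube_erase hjJ, ← subcube_eq ht]
      exact ⟨hx, hxj⟩
    have hsJ := self_mem_subcube J s
    by_cases hs' : flipAt j s ∈ Z
    -- At most one element of `Z` lies on the side of `t`, and here it is the vertex across from
    -- `s`. So a free neighbour of `s` in another direction `i` can cross.
    · obtain ⟨i, hi, hiZ⟩ := hs
      have hij : i ≠ j := fun h => hiZ (h ▸ hs')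
      have hiJ := flipAt_mem_subcube hi hsJ
      have hZ2 : flipAt j (flipAt i s) ∉ Z := by
        intro h
        have h1 : ({flipAt j s, flipAt j (flipAt i s)} : Finset (ι → Bool)) ⊆
            Z.filter fun y => y j = !s j := by
          intro y hy
          simp only [Finset.mem_insert, Finset.mem_singleton] at hy
          rcases hy with rfl | rfl
          · simp [hs']
          · simp [h, flipAt_ne hij.symm]
        have h2 := Finset.card_le_card h1
        rw [Finset.card_pair fun e => flipAt_ne_self i s (flipAt_injective j e).symm] at h2
        omega
      exact ((ConnIn.edge (C := subcube J s \ ↑Z) i ⟨hsJ, hsZ⟩ ⟨hiJ, hiZ⟩).trans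
        (.edge j ⟨hiJ, hiZ⟩ ⟨flipAt_mem_subcube hjJ hiJ, hZ2⟩)).trans
        (top _ (flipAt_mem_subcube hjJ hiJ) (by simp [flipAt_ne hij.symm, htj]) hZ2)
    · exact (ConnIn.edge (C := subcube J s \ ↑Z) j ⟨hsJ, hsZ⟩ ⟨flipAt_mem_subcube hjJ hsJ, hs'⟩).trans
        (top _ (flipAt_mem_subcube hjJ hsJ) (by simp [htj]) hs')
  have hjJ : j ∈ J := mem_dir (self_mem_subcube J s) ht hj
  have htj : t j = !s j := by cases h : s j <;> cases h' : t j <;> simp_all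
  by_cases h1 : J.card - 1 ≤ (Z.filter fun y => y j = s j).card
  · exact main s t ht hsZ htZ hs hj h1
  by_cases h2 : J.card - 1 ≤ (Z.filter fun y => y j = t j).card
  · rw [subcube_eq ht]
    exact (main t s (by rw [← subcube_eq ht]; exact self_mem_subcube _ _) htZ hsZ ht' hj.symm
      h2).symm
  have hJ' : (J.erase j).card = J.card - 1 := Finset.card_erase_of_mem hjJ
  -- Now each half holds at most |J| - 2 elements of `Z` and stays connected, so one free crossing
  -- edge suffices; it exists because |Z| ≤ |J| < 2 ^ (|J| - 1) for |J| ≥ 3.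
  obtain ⟨x, hx, hxZ, hxZ'⟩ := exists_crossing J s hjJ Z (by
    obtain ⟨k, hk⟩ : ∃ k, J.card = k + 3 := ⟨J.card - 3, by omega⟩
    have := Nat.lt_two_pow_self (n := k)
    rw [hk, show k + 3 - 1 = k + 2 by omega, pow_add]
    omega)
  have hxj : x j = s j := hx j (Finset.notMem_erase j J)
  have hxJ : x ∈ subcube J s := subcube_erase_subset _ _ _ hx
  have c1 := ((connIn_subcube_diff _ _ hJ' (Z.filter fun y => y j = s j) (by omega) s x hx
    (by simp [hsZ]) (by simp [hxZ])).of_side rfl).mono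
    (Set.sdiff_subset_sdiff_left (subcube_erase_subset J j s))
  have c2 := ((connIn_subcube_diff _ _ hJ' (Z.filter fun y => y j = t j) (by omega) t
    (flipAt j x) (by
      rw [mem_subcube_erase hjJ, ← subcube_eq ht]
      exact ⟨flipAt_mem_subcube hjJ hxJ, by rw [flipAt_same, hxj, htj]⟩)
    (by simp [htZ]) (by simp [hxZ'])).of_side rfl).mono
    (Set.sdiff_subset_sdiff_left (subcube_erase_subset J j t))
  rw [← subcube_eq ht] at c2
  exact (c1.trans (.edge j ⟨hxJ, hxZ⟩ ⟨flipAt_mem_subcube hjJ hxJ, hxZ'⟩)).trans c2.symm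

end Hypercube

end CubeLink

namespace CubeLink

/-! ### Weighted linkage problems: cutting along a direction, and counting terminal edges -/

section Linkage

set_option linter.unusedSectionVars false

variable {ι κ : Type*} [Fintype ι] [DecidableEq ι] [DecidableEq κ]

/-- Pairwise disjoint connected sets inside `U`, one joining `s i` to `t i` for each `i ∈ I`.
An index with `s i = t i` serves to forbid a vertex. -/
def Linkage (U : Set (ι → Bool)) (I : Finset κ) (s t : κ → ι → Bool) : Prop :=
  ∃ C : κ → Set (ι → Bool), (∀ i ∈ I, C i ⊆ U ∧ ConnIn (C i) (s i) (t i)) ∧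
    ∀ i ∈ I, ∀ l ∈ I, ∀ z, z ∈ C i → z ∈ C l → i = l

/-- The terminals of index `i`. -/
def block (s t : κ → ι → Bool) (i : κ) : Finset (ι → Bool) := {s i, t i}

/-- All terminals. -/
def terminals (I : Finset κ) (s t : κ → ι → Bool) : Finset (ι → Bool) := I.biUnion (block s t)

/-- The terminals of distinct indices are distinct vertices of `U`. -/
structure IsPairing (U : Set (ι → Bool)) (I : Finset κ) (s t : κ → ι → Bool) : Prop where
  mem : ∀ i ∈ I, ∀ z ∈ block s t i, z ∈ U
  eq : ∀ i ∈ I, ∀ l ∈ I, ∀ z, z ∈ block s t i → z ∈ block s t l → i = l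

variable {J : Finset ι} {c : ι → Bool} {j : ι} {b : Bool} {I : Finset κ} {s t x : κ → ι → Bool}
  {U : Set (ι → Bool)} {i l : κ} {z : ι → Bool}

theorem mem_block : z ∈ block s t i ↔ z = s i ∨ z = t i := by simp [block]

theorem left_mem_block : s i ∈ block s t i := by simp [block]

theorem right_mem_block : t i ∈ block s t i := by simp [block]

theorem mem_terminals : z ∈ terminals I s t ↔ ∃ i ∈ I, z ∈ block s t i := by simp [terminals]

theorem card_block_le : (block s t i).card ≤ 2 := Finset.card_le_two

theorem card_block_of_ne (h : s i ≠ t i) : (block s t i).card = 2 := Finset.card_pair h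

theorem card_block_pos : 1 ≤ (block s t i).card := Finset.card_pos.2 ⟨_, left_mem_block⟩

theorem IsPairing.card_terminals (h : IsPairing U I s t) :
    (terminals I s t).card = ∑ i ∈ I, (block s t i).card := by
  refine Finset.card_biUnion fun i hi l hl hil => ?_
  rw [Function.onFun, Finset.disjoint_left]
  exact fun z hz hz' => hil (h.eq i hi l hl z hz hz')

theorem IsPairing.card_index_le (h : IsPairing U I s t) : I.card ≤ (terminals I s t).card := by
  rw [h.card_terminals, Finset.card_eq_sum_ones]
  exact Finset.sum_le_sum fun i _ => card_block_pos

/-- The terminal `s i` if it lies on side `b`, else the crossing vertex `x i` moved there. -/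
def sideEnd (j : ι) (b : Bool) (x s : κ → ι → Bool) (i : κ) : ι → Bool :=
  if s i j = b then s i else Function.update (x i) j b

/-- The indices with a terminal on side `b`. -/
def sideIndex (I : Finset κ) (s t : κ → ι → Bool) (j : ι) (b : Bool) : Finset κ :=
  I.filter fun i => s i j = b ∨ t i j = b

theorem mem_sideIndex : i ∈ sideIndex I s t j b ↔ i ∈ I ∧ (s i j = b ∨ t i j = b) := by
  simp [sideIndex]

/-- Linkages in the two halves of a subcube combine to one in the subcube. -/
theorem Linkage.glue (hj : j ∈ J) (x : κ → ι → Bool)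
    (h : ∀ b, Linkage (subcube (J.erase j) (Function.update c j b)) (sideIndex I s t j b)
      (sideEnd j b x s) (sideEnd j b x t)) : Linkage (subcube J c) I s t := by
  choose D hD hdisj using h
  have hside : ∀ b i z, i ∈ sideIndex I s t j b → z ∈ D b i → z ∈ subcube J c ∧ z j = b :=
    fun b i z hi hz => (mem_side hj).1 ((hD b i hi).1 hz)
  have hsub : ∀ b i, i ∈ sideIndex I s t j b →
      D b i ⊆ {z | ∃ b, i ∈ sideIndex I s t j b ∧ z ∈ D b i} := fun b i hi z hz => ⟨b, hi, hz⟩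
  refine ⟨fun i => {z | ∃ b, i ∈ sideIndex I s t j b ∧ z ∈ D b i}, fun i hi => ⟨?_, ?_⟩, ?_⟩
  · rintro z ⟨b, hi, hz⟩
    exact (hside b i z hi hz).1
  · have h1 : i ∈ sideIndex I s t j (s i j) := mem_sideIndex.2 ⟨hi, .inl rfl⟩
    have c1 := (hD _ i h1).2.mono (hsub _ i h1)
    simp only [sideEnd, if_true] at c1
    by_cases hst : t i j = s i j
    · rwa [if_pos hst] at c1
    · rw [if_neg hst] at c1
      have h2 : i ∈ sideIndex I s t j (t i j) := mem_sideIndex.2 ⟨hi, .inr rfl⟩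
      have c2 := (hD _ i h2).2.mono (hsub _ i h2)
      simp only [sideEnd, if_true] at c2
      rw [if_neg (Ne.symm hst)] at c2
      -- The pieces of a split index stop at the two ends of its crossing edge, which joins them.
      refine c1.trans (.trans ?_ c2)
      have e : t i j = !(s i j) := by cases h : s i j <;> cases h' : t i j <;> simp_all
      have := ConnIn.edge j c1.right (by rw [flipAt_update, ← e]; exact c2.left)
      rwa [flipAt_update, ← e] at this
  · rintro i hi l hl z ⟨b, hb, hz⟩ ⟨b', hb', hz'⟩
    obtain rfl : b = b' := (hside b i z hb hz).2.symm.trans (hside b' l z hb' hz').2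
    exact hdisj b i hb l hb' z hz hz'

/-- `x` gives crossing edges in direction `j` for the split indices that interfere neither with
each other nor with terminals of other indices. -/
structure IsCrossing (J : Finset ι) (c : ι → Bool) (j : ι) (I : Finset κ) (s t x : κ → ι → Bool) :
    Prop where
  mem : ∀ i ∈ I, s i j ≠ t i j → x i ∈ subcube J c
  notMem : ∀ i ∈ I, s i j ≠ t i j → ∀ l ∈ I, l ≠ i → ∀ b, Function.update (x i) j b ∉ block s t l
  ne : ∀ i ∈ I, s i j ≠ t i j → ∀ l ∈ I, s l j ≠ t l j → i ≠ l → ∀ b,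
    Function.update (x i) j b ≠ Function.update (x l) j b

theorem mem_block_side (hi : i ∈ sideIndex I s t j b)
    (hz : z ∈ block (sideEnd j b x s) (sideEnd j b x t) i) :
    z ∈ block s t i ∧ z j = b ∨ s i j ≠ t i j ∧ z = Function.update (x i) j b := by
  rw [mem_sideIndex] at hi
  rw [mem_block] at hz
  simp only [sideEnd] at hz
  by_cases h1 : s i j = b <;> by_cases h2 : t i j = b
  · rw [if_pos h1, if_pos h2] at hz
    left
    refine ⟨mem_block.2 hz, ?_⟩
    rcases hz with rfl | rfl <;> assumption
  · rw [if_pos h1, if_neg h2] at hz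
    rcases hz with rfl | rfl
    · exact .inl ⟨left_mem_block, h1⟩
    · exact .inr ⟨fun h => h2 (h ▸ h1), rfl⟩
  · rw [if_neg h1, if_pos h2] at hz
    rcases hz with rfl | rfl
    · exact .inr ⟨fun h => h1 (h ▸ h2), rfl⟩
    · exact .inl ⟨right_mem_block, h2⟩
  · tauto

theorem IsCrossing.isPairing_side (hj : j ∈ J) (hP : IsPairing (subcube J c) I s t)
    (hx : IsCrossing J c j I s t x) (b : Bool) :
    IsPairing (subcube (J.erase j) (Function.update c j b)) (sideIndex I s t j b)
      (sideEnd j b x s) (sideEnd j b x t) := by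
  constructor
  · intro i hi z hz
    rw [mem_side hj]
    have hiI := (mem_sideIndex.1 hi).1
    rcases mem_block_side hi hz with ⟨h1, h2⟩ | ⟨h1, rfl⟩
    · exact ⟨hP.mem i hiI z h1, h2⟩
    · exact ⟨update_mem_subcube hj b (hx.mem i hiI h1), by simp⟩
  · intro i hi l hl z hz hz'
    have hiI := (mem_sideIndex.1 hi).1
    have hlI := (mem_sideIndex.1 hl).1
    by_contra hil
    rcases mem_block_side hi hz with ⟨h1, h2⟩ | ⟨h1, rfl⟩ <;>
    rcases mem_block_side hl hz' with ⟨h1', h2'⟩ | ⟨h1', h2'⟩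
    · exact hil (hP.eq i hiI l hlI z h1 h1')
    · subst h2'
      exact hx.notMem l hlI h1' i hiI hil b h1
    · exact hx.notMem i hiI h1 l hlI (Ne.symm hil) b h1'
    · exact hx.ne i hiI h1 l hlI h1' hil b h2'

/-- The terminal of the split index `i` on side `b`. -/
def endAt (j : ι) (b : Bool) (s t : κ → ι → Bool) (i : κ) : ι → Bool :=
  if s i j = b then s i else t i

theorem endAt_mem_block : endAt j b s t i ∈ block s t i := by
  rw [endAt]; split_ifs
  exacts [left_mem_block, right_mem_block]

theorem endAt_apply (h : s i j ≠ t i j) : endAt j b s t i j = b := by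
  rw [endAt]
  split_ifs with h1
  · exact h1
  · cases b <;> cases h2 : s i j <;> cases h3 : t i j <;> simp_all

/-- The split index `i` may cross directly from its terminal on side `b`. -/
def IsStraight (I : Finset κ) (s t : κ → ι → Bool) (j : ι) (b : Bool) (i : κ) : Prop :=
  i ∈ I ∧ s i j ≠ t i j ∧ ∀ l ∈ I, l ≠ i → flipAt j (endAt j b s t i) ∉ block s t l

/-- `Q b` names at most one split index to be sent straight across from its terminal on side `b`;
straightness keeps that edge off the other terminals. The remaining indices receive distinct edges
over points outside the projection of all terminals. One index may be prescribed on both sides only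
if its two ends are joined by the same edge, whence `hQ'`. -/
theorem exists_isCrossing (hj : j ∈ J) (hP : IsPairing (subcube J c) I s t)
    (hcard : 2 * (terminals I s t).card ≤ 2 ^ (J.card - 1)) (Q : Bool → Option κ)
    (hQ : ∀ b i, Q b = some i → IsStraight I s t j b i)
    (hQ' : ∀ i, Q true = some i → Q false = some i →
      flipAt j (endAt j true s t i) = endAt j false s t i) :
    ∃ x, IsCrossing J c j I s t x ∧
      ∀ b i, Q b = some i → Function.update (x i) j b = endAt j b s t i := by
  set Z := (terminals I s t).image fun z => Function.update z j (c j) with hZ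
  -- The projected terminals and the indices each number at most the weight, which explains the
  -- factor 2 in `hcard`.
  obtain ⟨g, hg, hginj⟩ := exists_injOn_subcube (J.erase j) c Z I (by
    have h1 : Z.card ≤ (terminals I s t).card := Finset.card_image_le
    have h2 := hP.card_index_le
    rw [Finset.card_erase_of_mem hj]
    omega)
  set x : κ → ι → Bool := fun i => if Q true = some i then endAt j true s t i else
    if Q false = some i then endAt j false s t i else g i with hx
  have hxQ : ∀ b i, Q b = some i → Function.update (x i) j b = endAt j b s t i := by
    intro b i hb
    have hst := (hQ b i hb).2.1
    cases b
    · by_cases h : Q true = some i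
      · simp only [hx, if_pos h]
        rw [← hQ' i h hb, update_of_ne]
        rw [endAt_apply hst]; simp
      · simp only [hx, if_neg h, if_pos hb]
        exact update_of_eq (endAt_apply hst)
    · simp only [hx, if_pos hb]
      exact update_of_eq (endAt_apply hst)
  have hcase : ∀ i, (∃ b, Q b = some i) ∨ x i = g i := by
    intro i
    by_cases h1 : Q true = some i
    · exact .inl ⟨_, h1⟩
    by_cases h2 : Q false = some i
    · exact .inl ⟨_, h2⟩
    · right; simp only [hx, if_neg h1, if_neg h2]
  have hxe : ∀ b i, Q b = some i → ∀ b', Function.update (x i) j b' = endAt j b s t i ∨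
      Function.update (x i) j b' = flipAt j (endAt j b s t i) := by
    intro b i hb b'
    have : Function.update (x i) j b' = Function.update (endAt j b s t i) j b' := by
      rw [← hxQ b i hb, Function.update_idem]
    rw [this]
    exact update_eq_or _ _ _
  have hgZ : ∀ i ∈ I, ∀ b, Function.update (g i) j b ∉ terminals I s t := by
    intro i hi b h
    refine (hg i hi).2 (Finset.mem_image.2 ⟨_, h, ?_⟩)
    rw [Function.update_idem]
    exact update_of_eq ((hg i hi).1 j (Finset.notMem_erase j J))
  have hnot : ∀ i ∈ I, s i j ≠ t i j → ∀ l ∈ I, l ≠ i → ∀ b,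
      Function.update (x i) j b ∉ block s t l := by
    intro i hi hst l hl hli b' hmem
    rcases hcase i with ⟨b, hb⟩ | h
    · rcases hxe b i hb b' with h | h
      · rw [h] at hmem
        exact hli (hP.eq l hl i hi _ hmem endAt_mem_block)
      · rw [h] at hmem
        exact (hQ b i hb).2.2 l hl hli hmem
    · rw [h] at hmem
      exact hgZ i hi b' (mem_terminals.2 ⟨l, hl, hmem⟩)
  refine ⟨x, ⟨?_, hnot, ?_⟩, hxQ⟩
  · intro i hi hst
    rcases hcase i with ⟨b, hb⟩ | h
    · rw [show x i = Function.update (x i) j (x i j) by simp]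
      have := hP.mem i hi _ (endAt_mem_block (j := j) (b := b))
      rcases hxe b i hb (x i j) with h | h <;> rw [h]
      · exact this
      · exact flipAt_mem_subcube hj this
    · rw [h]; exact subcube_erase_subset _ _ _ (hg i hi).1
  -- Crossings that meet on one side are the same edge. A prescribed edge contains a terminal of its
  -- own index, which no other crossing may touch; free edges are separated by injectivity of `g`.
  · intro i hi hst l hl hst' hil b heq
    have heq' : ∀ b', Function.update (x i) j b' = Function.update (x l) j b' := by
      intro b'
      have := congrArg (fun y => Function.update y j b') heq
      simpa using this
    rcases hcase i with ⟨b, hb⟩ | h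
    · apply hnot l hl hst' i hi hil b
      rw [← heq' b, hxQ b i hb]
      exact endAt_mem_block
    rcases hcase l with ⟨b, hb⟩ | h'
    · apply hnot i hi hst l hl (Ne.symm hil) b
      rw [heq' b, hxQ b l hb]
      exact endAt_mem_block
    · apply hil
      apply hginj hi hl
      have := heq' (c j)
      rw [h, h', update_of_eq ((hg i hi).1 j (Finset.notMem_erase j J)),
        update_of_eq ((hg l hl).1 j (Finset.notMem_erase j J))] at this
      exact this

/-- How much lighter index `i` is on side `b` than in the whole. -/
def gain (s t : κ → ι → Bool) (j : ι) (Q : Bool → Option κ) (b : Bool) (i : κ) : ℕ :=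
  if s i j ≠ b ∧ t i j ≠ b then (block s t i).card else if Q b = some i then 1 else 0

/-- The estimate holds index by index: an unsplit index on side `b` keeps its block, a split one
trades its far end for a crossing vertex, a straight one collapses to a single vertex, and an index
off side `b` disappears. -/
theorem IsCrossing.card_side_add_gain (hj : j ∈ J) (hP : IsPairing (subcube J c) I s t)
    (hx : IsCrossing J c j I s t x) (Q : Bool → Option κ)
    (hQ : ∀ b i, Q b = some i → s i j ≠ t i j)
    (hxQ : ∀ b i, Q b = some i → Function.update (x i) j b = endAt j b s t i) (b : Bool) :
    (terminals (sideIndex I s t j b) (sideEnd j b x s) (sideEnd j b x t)).card +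
      ∑ i ∈ I, gain s t j Q b i ≤ (terminals I s t).card := by
  rw [(hx.isPairing_side hj hP b).card_terminals, hP.card_terminals, sideIndex,
    Finset.sum_filter, ← Finset.sum_add_distrib]
  refine Finset.sum_le_sum fun i hi => ?_
  simp only [gain]
  by_cases h : s i j = b ∨ t i j = b
  · rw [if_pos h, if_neg (by tauto)]
    by_cases hst : s i j = t i j
    · rw [if_neg fun hq => hQ b i hq hst]
      have h1 : s i j = b := by rcases h with h | h <;> simp_all
      have h2 : t i j = b := by rw [← hst, h1]
      simp [block, sideEnd, h1, h2]
    · rw [card_block_of_ne (s := s) (t := t) fun h => hst (congrFun h j)]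
      split_ifs with hq
      · have := hxQ b i hq
        have : block (sideEnd j b x s) (sideEnd j b x t) i = {endAt j b s t i} := by
          simp only [block, sideEnd, endAt] at this ⊢
          rw [this]
          by_cases h1 : s i j = b
          · have h2 : t i j ≠ b := fun h2 => hst (h1.trans h2.symm)
            simp [h1, h2]
          · simp [h1]
        rw [this]
        simp
      · exact card_block_le
  · rw [if_neg h, if_pos (by tauto)]
    simp

/-- All weighted linkage problems of weight at most `w` in the faces with directions `J` are
solvable. -/
def CubeLinked (κ : Type*) [DecidableEq κ] (J : Finset ι) (w : ℕ) : Prop :=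
  ∀ (c : ι → Bool) (I : Finset κ) (s t : κ → ι → Bool), IsPairing (subcube J c) I s t →
    (terminals I s t).card ≤ w → Linkage (subcube J c) I s t

/-- The gains bring each half down to weight `J.card`, which is one more than the dimension of the
half and so within reach of the induction hypothesis. -/
theorem Linkage.of_straight (hj : j ∈ J) (hP : IsPairing (subcube J c) I s t)
    (hcard : 2 * (terminals I s t).card ≤ 2 ^ (J.card - 1))
    (ih : CubeLinked κ (J.erase j) J.card) (Q : Bool → Option κ)
    (hQ : ∀ b i, Q b = some i → IsStraight I s t j b i)
    (hQ' : ∀ i, Q true = some i → Q false = some i →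
      flipAt j (endAt j true s t i) = endAt j false s t i)
    (hgain : ∀ b, (terminals I s t).card ≤ J.card + ∑ i ∈ I, gain s t j Q b i) :
    Linkage (subcube J c) I s t := by
  obtain ⟨x, hx, hxQ⟩ := exists_isCrossing hj hP hcard Q hQ hQ'
  refine Linkage.glue hj x fun b => ih _ _ _ _ (hx.isPairing_side hj hP b) ?_
  have h1 := hx.card_side_add_gain hj hP Q (fun b i h => (hQ b i h).2.1) hxQ b
  have h2 := hgain b
  omega

/-- Either straight crossings can be chosen on each side where `R` fails, or there is a reason. -/
theorem exists_straight_choice (I : Finset κ) (s t : κ → ι → Bool) (j : ι) (R : Bool → Prop) :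
    (∃ Q : Bool → Option κ, (∀ b i, Q b = some i → IsStraight I s t j b i) ∧
      (∀ i, Q true = some i → Q false = some i →
        flipAt j (endAt j true s t i) = endAt j false s t i) ∧
      ∀ b, R b ∨ ∃ i, Q b = some i) ∨
    (∃ b, ¬ R b ∧ ∀ i, ¬ IsStraight I s t j b i) ∨
    ((∀ b, ¬ R b) ∧ ∃ i₀, ∀ b i, IsStraight I s t j b i → i = i₀) := by
  classical
  by_cases h0 : ∃ b, ¬ R b ∧ ∀ i, ¬ IsStraight I s t j b i
  · exact .inr (.inl h0)
  push Not at h0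
  by_cases hR : ∃ b, R b
  · obtain ⟨b, hb⟩ := hR
    left
    by_cases hb' : R (!b)
    · refine ⟨fun _ => none, by simp, by simp, fun a => .inl ?_⟩
      cases a <;> cases b <;> simp_all
    · obtain ⟨i, hi⟩ := h0 _ hb'
      refine ⟨fun a => if a = b then none else some i, ?_, ?_, ?_⟩
      · intro a i' h
        by_cases hab : a = b
        · simp [hab] at h
        · simp only [if_neg hab] at h
          obtain rfl := Option.some.inj h
          have : a = !b := by cases a <;> cases b <;> simp_all
          rwa [this]
      · intro i' h1 h2
        cases b <;> simp at h1 h2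
      · intro a
        by_cases hab : a = b
        · exact .inl (hab ▸ hb)
        · exact .inr ⟨i, if_neg hab⟩
  · push Not at hR
    obtain ⟨i, hi⟩ := h0 true (hR _)
    obtain ⟨l, hl⟩ := h0 false (hR _)
    -- If no compatible choice exists, any straight index for one side equals any straight index for
    -- the other, so a single index accounts for all of them.
    by_cases hex : ∃ i l, IsStraight I s t j true i ∧ IsStraight I s t j false l ∧
        (i = l → flipAt j (endAt j true s t i) = endAt j false s t i)
    · obtain ⟨i, l, hi, hl, hil⟩ := hex
      left
      refine ⟨fun a => if a then some i else some l, ?_, ?_, ?_⟩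
      · intro a i' h
        cases a
        · obtain rfl : l = i' := by simpa using h
          exact hl
        · obtain rfl : i = i' := by simpa using h
          exact hi
      · intro i' h1 h2
        obtain rfl : i = i' := by simpa using h1
        obtain rfl : l = i := by simpa using h2
        exact hil rfl
      · intro a; right; cases a <;> simp
    · push Not at hex
      right; right
      refine ⟨hR, l, fun b i' hi' => ?_⟩
      cases b
      · exact (hex i i' hi hi').1.symm.trans (hex i l hi hl).1
      · exact (hex i' l hi' hl).1

/-- Linking all pairs but one through the other half of the cube. -/
theorem Linkage.of_up (hj : j ∈ J) (hP : IsPairing (subcube J c) I s t)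
    (ih : CubeLinked κ (J.erase j) J.card) (hcard : (terminals I s t).card ≤ J.card + 2)
    (i₀ : κ) (hi₀ : i₀ ∈ I) (hne : s i₀ ≠ t i₀)
    (hconn : ConnIn (subcube (J.erase j) (s i₀) \ ↑(terminals I s t \ block s t i₀)) (s i₀) (t i₀))
    (hup : ∀ i ∈ I, i ≠ i₀ → s i = t i ∨
      ∀ z ∈ block s t i, z j = s i₀ j ∧ flipAt j z ∉ terminals I s t) :
    Linkage (subcube J c) I s t := by
  set b := s i₀ j with hb
  -- The problem in the far half consists of the proper pairs other than `i₀`, moved there, and the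
  -- forbidden vertices already there; forbidden vertices on the side of `i₀` need no path.
  set I' := (I.erase i₀).filter fun i => s i ≠ t i ∨ s i j ≠ b with hI'
  set s' : κ → ι → Bool := fun i => Function.update (s i) j (!b) with hs'
  set t' : κ → ι → Bool := fun i => Function.update (t i) j (!b) with ht'
  have hmem' : ∀ i, i ∈ I' ↔ (i ∈ I ∧ i ≠ i₀) ∧ (s i ≠ t i ∨ s i j ≠ b) := by
    intro i; simp [hI', and_comm]
  have hs₀ : s i₀ ∈ subcube J c := hP.mem _ hi₀ _ left_mem_block
  have hA : ∀ z ∈ subcube (J.erase j) (s i₀), z ∈ subcube J c ∧ z j = b := by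
    intro z hz
    rw [mem_subcube_erase hj, ← subcube_eq hs₀] at hz
    exact hz
  have hblock : ∀ i ∈ I', ∀ z ∈ block s' t' i, (z ∈ block s t i ∧ s i = t i) ∨
      (z ∉ terminals I s t ∧ flipAt j z ∈ block s t i ∧ s i ≠ t i) := by
    intro i hi z hz
    rw [hmem'] at hi
    obtain ⟨y, hy, rfl⟩ : ∃ y ∈ block s t i, z = Function.update y j (!b) := by
      rcases mem_block.1 hz with rfl | rfl
      · exact ⟨_, left_mem_block, rfl⟩
      · exact ⟨_, right_mem_block, rfl⟩
    by_cases hd : s i = t i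
    · left
      have hy' : y = s i := by rcases mem_block.1 hy with h | h <;> simp [h, hd]
      have : y j = !b := by
        rw [hy']
        have := hi.2.resolve_left (not_not.2 hd)
        cases h1 : s i j <;> cases h2 : b <;> simp_all
      rw [update_of_eq this]
      exact ⟨hy, hd⟩
    · right
      have := ((hup i hi.1.1 hi.1.2).resolve_left hd) y hy
      have hyj : y j ≠ !b := by rw [this.1]; simp
      rw [update_of_ne hyj, flipAt_flipAt]
      exact ⟨this.2, hy, hd⟩
  have hP' : IsPairing (subcube (J.erase j) (Function.update c j (!b))) I' s' t' := by
    constructor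
    · intro i hi z hz
      rw [mem_side hj]
      have hi' := ((hmem' i).1 hi).1.1
      rcases mem_block.1 hz with rfl | rfl
      · exact ⟨update_mem_subcube hj _ (hP.mem i hi' _ left_mem_block), by simp [hs']⟩
      · exact ⟨update_mem_subcube hj _ (hP.mem i hi' _ right_mem_block), by simp [ht']⟩
    · intro i hi l hl z hz hz'
      have hi' := ((hmem' i).1 hi).1.1
      have hl' := ((hmem' l).1 hl).1.1
      rcases hblock i hi z hz with ⟨h1, -⟩ | ⟨h1, h2, -⟩ <;>
      rcases hblock l hl z hz' with ⟨h3, -⟩ | ⟨h3, h4, -⟩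
      · exact hP.eq i hi' l hl' z h1 h3
      · exact absurd (mem_terminals.2 ⟨i, hi', h1⟩) h3
      · exact absurd (mem_terminals.2 ⟨l, hl', h3⟩) h1
      · exact hP.eq i hi' l hl' _ h2 h4
  -- Leaving out the two terminals of `i₀` lowers the weight from |J| + 2 to |J|.
  obtain ⟨D, hD, hdisj⟩ := ih _ I' s' t' hP' (by
    have h1 : terminals I' s' t' ⊆ (terminals I s t \ block s t i₀).image
        fun z => Function.update z j (!b) := by
      intro z hz
      obtain ⟨i, hi, hz⟩ := mem_terminals.1 hz
      rw [hmem'] at hi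
      have : ∀ y ∈ block s t i, y ∈ terminals I s t \ block s t i₀ := fun y hy =>
        Finset.mem_sdiff.2 ⟨mem_terminals.2 ⟨i, hi.1.1, hy⟩,
          fun h => hi.1.2 (hP.eq i hi.1.1 i₀ hi₀ y hy h)⟩
      rw [Finset.mem_image]
      rcases mem_block.1 hz with rfl | rfl
      · exact ⟨_, this _ left_mem_block, rfl⟩
      · exact ⟨_, this _ right_mem_block, rfl⟩
    have h2 := (Finset.card_le_card h1).trans Finset.card_image_le
    have h3 : block s t i₀ ⊆ terminals I s t := fun z hz => mem_terminals.2 ⟨i₀, hi₀, hz⟩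
    rw [Finset.card_sdiff_of_subset h3, card_block_of_ne hne] at h2
    omega)
  have hDside : ∀ i ∈ I', ∀ z ∈ D i, z ∈ subcube J c ∧ z j = !b :=
    fun i hi z hz => (mem_side hj).1 ((hD i hi).1 hz)
  -- a component in the upper half only meets terminals of its own index
  have hDblock : ∀ i ∈ I', ∀ l ∈ I, l ≠ i₀ → ∀ z ∈ D i, z ∈ block s t l → i = l := by
    intro i hi l hl hl₀ z hz hz'
    have hzj := (hDside i hi z hz).2
    rcases hup l hl hl₀ with h | h
    · have hzl : z = s l := by rcases mem_block.1 hz' with h' | h' <;> simp [h', h]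
      have hl' : l ∈ I' := (hmem' l).2 ⟨⟨hl, hl₀⟩, .inr (by rw [← hzl, hzj]; simp)⟩
      have : s' l = z := by
        rw [hzl]; exact update_of_eq (by rw [← hzl, hzj])
      exact hdisj i hi l hl' z hz (this ▸ (hD l hl').2.left)
    · have := (h z hz').1
      rw [hzj] at this
      simp at this
  set C₀ := subcube (J.erase j) (s i₀) \ ↑(terminals I s t \ block s t i₀) with hC₀
  have hC₀block : ∀ l ∈ I, ∀ z ∈ C₀, z ∈ block s t l → l = i₀ := by
    intro l hl z hz hz'
    by_contra hli
    refine hz.2 (Finset.mem_coe.2 (Finset.mem_sdiff.2 ⟨mem_terminals.2 ⟨l, hl, hz'⟩, fun h => ?_⟩))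
    exact hli (hP.eq l hl i₀ hi₀ z hz' h)
  refine ⟨fun i => {z | i = i₀ ∧ z ∈ C₀ ∨ (i ∈ I' ∧ z ∈ D i) ∨ z ∈ block s t i},
    fun i hi => ⟨?_, ?_⟩, ?_⟩
  · rintro z (⟨-, h⟩ | ⟨h1, h2⟩ | h)
    · exact (hA z h.1).1
    · exact (hDside i h1 z h2).1
    · exact hP.mem i hi z h
  · by_cases h₀ : i = i₀
    · subst h₀
      exact hconn.mono fun z hz => .inl ⟨rfl, hz⟩
    · by_cases hd : s i = t i
      · rw [← hd]
        exact .refl (.inr (.inr left_mem_block))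
      · have hiI : i ∈ I' := (hmem' i).2 ⟨⟨hi, h₀⟩, .inl hd⟩
        have hz := (hup i hi h₀).resolve_left hd
        have c := (hD i hiI).2.mono
          (D := {z | i = i₀ ∧ z ∈ C₀ ∨ (i ∈ I' ∧ z ∈ D i) ∨ z ∈ block s t i})
          fun z hz => .inr (.inl ⟨hiI, hz⟩)
        have e1 : s' i = flipAt j (s i) :=
          update_of_ne (by rw [(hz _ left_mem_block).1]; simp)
        have e2 : t' i = flipAt j (t i) :=
          update_of_ne (by rw [(hz _ right_mem_block).1]; simp)
        rw [e1, e2] at c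
        refine ((ConnIn.edge j ?_ c.left).trans c).trans (ConnIn.edge j ?_ c.right).symm
        · exact .inr (.inr left_mem_block)
        · exact .inr (.inr right_mem_block)
  · rintro i hi l hl z (⟨h1, h2⟩ | ⟨h1, h2⟩ | h) (⟨h1', h2'⟩ | ⟨h1', h2'⟩ | h')
    · exact h1.trans h1'.symm
    · have e1 := (hA z h2.1).2
      rw [(hDside l h1' z h2').2] at e1
      simp at e1
    · exact h1.trans (hC₀block l hl z h2 h').symm
    · have e1 := (hA z h2'.1).2
      rw [(hDside i h1 z h2).2] at e1
      simp at e1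
    · exact hdisj i h1 l h1' z h2 h2'
    · by_cases hl₀ : l = i₀
      · exfalso
        subst hl₀
        have e1 := (hDside i h1 z h2).2
        have e2 : z j = b := (hA z (by
          rcases mem_block.1 h' with rfl | rfl
          · exact self_mem_subcube _ _
          · exact hconn.right.1)).2
        rw [e1] at e2
        simp at e2
      · exact hDblock i h1 l hl hl₀ z h2 h'
    · exact (hC₀block i hi z h2' h).trans h1'.symm
    · by_cases hi₀' : i = i₀
      · exfalso
        subst hi₀'
        have e1 := (hDside l h1' z h2').2
        have e2 : z j = b := (hA z (by
          rcases mem_block.1 h with rfl | rfl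
          · exact self_mem_subcube _ _
          · exact hconn.right.1)).2
        rw [e1] at e2
        simp at e2
      · exact (hDblock l h1' i hi hi₀' z h2' h).symm
    · exact hP.eq i hi l hl z h h'

/-- Of two pairs in a subcube one can be joined avoiding all other terminals. -/
theorem connIn_or_connIn (J : Finset ι) (hJ : 3 ≤ J.card) (X : Finset (ι → Bool))
    (hX : X.card ≤ J.card + 2) (s₁ t₁ s₂ t₂ : ι → Bool) (h1 : s₁ ∈ X) (h2 : t₁ ∈ X) (h3 : s₂ ∈ X)
    (h4 : t₂ ∈ X) (hst₁ : s₁ ≠ t₁) (hst₂ : s₂ ≠ t₂) (hd : ∀ z ∈ ({s₂, t₂} : Finset (ι → Bool)),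
      z ∉ ({s₁, t₁} : Finset (ι → Bool)))
    (m1 : t₁ ∈ subcube J s₁) (m2 : t₂ ∈ subcube J s₂) :
    ConnIn (subcube J s₁ \ ↑(X \ {s₁, t₁})) s₁ t₁ ∨ ConnIn (subcube J s₂ \ ↑(X \ {s₂, t₂})) s₂ t₂ := by
  have hc1 : (X \ {s₁, t₁}).card ≤ J.card := by
    rw [Finset.card_sdiff_of_subset (by intro z; simp; rintro (rfl | rfl) <;> assumption),
      Finset.card_pair hst₁]
    omega
  have hc2 : (X \ {s₂, t₂}).card ≤ J.card := by
    rw [Finset.card_sdiff_of_subset (by intro z; simp; rintro (rfl | rfl) <;> assumption),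
      Finset.card_pair hst₂]
    omega
  by_cases hf : ∀ e ∈ ({s₁, t₁} : Finset (ι → Bool)), ∃ i ∈ J, flipAt i e ∉ X \ {s₁, t₁}
  · left
    exact connIn_subcube_diff_of_free J hJ _ hc1 s₁ t₁ m1 (by simp) (by simp) (hf _ (by simp))
      (hf _ (by simp))
  · push Not at hf
    obtain ⟨e, -, hall⟩ := hf
    -- If the first pair is blocked at an end `e`, counting shows that the terminals outside this
    -- pair are exactly the neighbours of `e`.
    have himg : J.image (fun i => flipAt i e) = X \ {s₁, t₁} := by
      refine Finset.eq_of_subset_of_card_le ?_ ?_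
      · intro z hz
        obtain ⟨i, hi, rfl⟩ := Finset.mem_image.1 hz
        exact hall i hi
      · rwa [Finset.card_image_of_injective _ (flipAt_dir_injective e)]
    have hfree : ∀ z ∈ ({s₂, t₂} : Finset (ι → Bool)), ∃ i ∈ J, flipAt i z ∉ X \ {s₂, t₂} := by
      intro z hz
      by_contra hcon
      push Not at hcon
      have hz' : z ∈ X \ {s₁, t₁} := by
        refine Finset.mem_sdiff.2 ⟨?_, hd z hz⟩
        simp only [Finset.mem_insert, Finset.mem_singleton] at hz
        rcases hz with rfl | rfl <;> assumption
      rw [← himg] at hz'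
      obtain ⟨a, ha, rfl⟩ := Finset.mem_image.1 hz'
      -- If an end of the second pair were blocked too, its neighbours would be terminals. That end
      -- is a neighbour of `e`, so by parity they are not neighbours of `e`, leaving only the two
      -- vertices of the first pair for at least three neighbours.
      have : J.image (fun i => flipAt i (flipAt a e)) ⊆ {s₁, t₁} := by
        intro y hy
        obtain ⟨i, hi, rfl⟩ := Finset.mem_image.1 hy
        by_contra hy'
        have : flipAt i (flipAt a e) ∈ X \ {s₁, t₁} :=
          Finset.mem_sdiff.2 ⟨(Finset.mem_sdiff.1 (hcon i hi)).1, hy'⟩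
        rw [← himg] at this
        obtain ⟨r, -, hr⟩ := Finset.mem_image.1 this
        exact flipAt_flipAt_ne i a r e hr.symm
      have := Finset.card_le_card this
      rw [Finset.card_image_of_injective _ (flipAt_dir_injective _), Finset.card_pair hst₁] at this
      omega
    right
    exact connIn_subcube_diff_of_free J hJ _ hc2 s₂ t₂ m2 (by simp) (by simp) (hfree _ (by simp))
      (hfree _ (by simp))

/-- Two distinct edges of direction `j` inside `X`. -/
def TwoEdges (j : ι) (X : Finset (ι → Bool)) : Prop :=
  ∃ x ∈ X, ∃ y ∈ X, x ≠ y ∧ x j = y j ∧ flipAt j x ∈ X ∧ flipAt j y ∈ X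

/-- Contracting direction `j` identifies each `x ∈ W` with its partner across; as `W` lies on one
side, the partners are outside `W`, so `X \ W` already has the full image. -/
theorem card_image_update_add (X W : Finset (ι → Bool)) (j : ι) (b : Bool)
    (hW : ∀ x ∈ W, x ∈ X ∧ x j = b ∧ flipAt j x ∈ X) :
    (X.image fun x => Function.update x j false).card + W.card ≤ X.card := by
  have h1 : (X.image fun x => Function.update x j false) ⊆
      (X \ W).image fun x => Function.update x j false := by
    intro y hy
    obtain ⟨x, hx, rfl⟩ := Finset.mem_image.1 hy
    rw [Finset.mem_image]
    by_cases hxW : x ∈ W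
    · refine ⟨flipAt j x, Finset.mem_sdiff.2 ⟨(hW x hxW).2.2, fun h => ?_⟩, by simp [flipAt]⟩
      have h1 := (hW x hxW).2.1
      have h2 := (hW _ h).2.1
      rw [flipAt_same, h1] at h2
      simp at h2
    · exact ⟨x, Finset.mem_sdiff.2 ⟨hx, hxW⟩, rfl⟩
  have h2 := (Finset.card_le_card h1).trans Finset.card_image_le
  have hWX : W ⊆ X := fun x hx => (hW x hx).1
  rw [Finset.card_sdiff_of_subset hWX] at h2
  have := Finset.card_le_card hWX
  omega

theorem flipAt_update_comm {i j : ι} (h : i ≠ j) (b : Bool) (x : ι → Bool) :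
    flipAt i (Function.update x j b) = Function.update (flipAt i x) j b := by
  rw [flipAt, flipAt, Function.update_comm h, Function.update_of_ne h]

theorem edge_image_update {X : Finset (ι → Bool)} {i j : ι} (h : i ≠ j)
    (hX : ∃ x ∈ X, flipAt i x ∈ X) :
    ∃ x ∈ X.image (fun x => Function.update x j false),
      flipAt i x ∈ X.image (fun x => Function.update x j false) := by
  obtain ⟨x, hx, hx'⟩ := hX
  exact ⟨_, Finset.mem_image_of_mem _ hx, by
    rw [flipAt_update_comm h]; exact Finset.mem_image_of_mem _ hx'⟩

/-- Contract the directions one at a time. Each contraction loses at least one vertex and preserves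
edges of the other directions, and at least one vertex survives. -/
theorem card_lt_of_edges (J : Finset ι) (X : Finset (ι → Bool)) (hX : X.Nonempty)
    (h : ∀ j ∈ J, ∃ x ∈ X, flipAt j x ∈ X) : J.card + 1 ≤ X.card := by
  induction J using Finset.induction_on generalizing X with
  | empty => simpa using hX
  | @insert j J hj ih =>
    obtain ⟨x, hx, hx'⟩ := h j (by simp)
    have h1 := card_image_update_add X {x} j (x j) (by simp [hx, hx'])
    have h2 := ih (X.image fun x => Function.update x j false) (hX.image _) fun i hi =>
      edge_image_update (ne_of_mem_of_not_mem hi hj) (h i (by simp [hi]))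
    rw [Finset.card_insert_of_notMem hj]
    simp at h1
    omega

theorem TwoEdges.card_image {X : Finset (ι → Bool)} {j : ι} (h : TwoEdges j X) :
    (X.image fun x => Function.update x j false).card + 2 ≤ X.card := by
  obtain ⟨x, hx, y, hy, hxy, hj, hx', hy'⟩ := h
  have := card_image_update_add X {x, y} j (x j) (by simp [hx, hx', hy, hy', hj])
  rwa [Finset.card_pair hxy] at this

/-- Contracting `j` first costs two vertices; the remaining directions cost one each. -/
theorem TwoEdges.card {X : Finset (ι → Bool)} {J : Finset ι} {j : ι} (hj : j ∈ J)
    (h : TwoEdges j X) (hX : ∀ i ∈ J, ∃ x ∈ X, flipAt i x ∈ X) : J.card + 2 ≤ X.card := by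
  have h1 := h.card_image
  obtain ⟨x, hx, -⟩ := h
  have h2 := card_lt_of_edges (J.erase j) (X.image fun x => Function.update x j false)
    ⟨_, Finset.mem_image_of_mem _ hx⟩ fun i hi =>
    edge_image_update (Finset.ne_of_mem_erase hi) (hX i (Finset.mem_of_mem_erase hi))
  rw [Finset.card_erase_of_mem hj] at h2
  omega

/-- In a tight configuration, two edges of direction `k` span a square with any direction that
also has two edges. -/
theorem TwoEdges.eq_flipAt {X : Finset (ι → Bool)} {J : Finset ι} {a k : ι} (ha : a ∈ J)
    (hk : k ∈ J) (hak : a ≠ k) (h : TwoEdges a X) (hX : ∀ i ∈ J, ∃ x ∈ X, flipAt i x ∈ X)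
    (hcard : X.card ≤ J.card + 2) {z w : ι → Bool} (hz : z ∈ X) (hw : w ∈ X) (hzw : z ≠ w)
    (hkk : z k = w k) (hz' : flipAt k z ∈ X) (hw' : flipAt k w ∈ X) : w = flipAt a z := by
  -- Contracting `a` loses two vertices. Unless the `k`-edges are opposite sides of a square with
  -- direction `a`, they stay distinct, so contracting `k` loses two more, for a total of at least
  -- |J| + 3.
  by_contra hne
  set Y := X.image fun x => Function.update x a false with hY
  have h1 : Y.card + 2 ≤ X.card := h.card_image
  have hYe : ∀ i ∈ J.erase a, ∃ x ∈ Y, flipAt i x ∈ Y := fun i hi =>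
    edge_image_update (Finset.ne_of_mem_erase hi) (hX i (Finset.mem_of_mem_erase hi))
  have h2 : TwoEdges k Y := by
    refine ⟨_, Finset.mem_image_of_mem _ hz, _, Finset.mem_image_of_mem _ hw, ?_, ?_, ?_, ?_⟩
    · intro he
      by_cases haz : z a = w a
      · apply hzw
        have := congrArg (fun y => Function.update y a (z a)) he
        simp only [Function.update_idem] at this
        rwa [update_of_eq rfl, update_of_eq haz.symm] at this
      · apply hne
        have := congrArg (fun y => Function.update y a (w a)) he
        simp only [Function.update_idem] at this
        rw [update_of_ne haz, update_of_eq rfl] at this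
        exact this.symm
    · rw [Function.update_of_ne hak.symm, Function.update_of_ne hak.symm, hkk]
    · rw [flipAt_update_comm hak.symm]; exact Finset.mem_image_of_mem _ hz'
    · rw [flipAt_update_comm hak.symm]; exact Finset.mem_image_of_mem _ hw'
  have h3 := h2.card (Finset.mem_erase.2 ⟨hak.symm, hk⟩) hYe
  rw [Finset.card_erase_of_mem ha] at h3
  have := Finset.card_pos.2 ⟨a, ha⟩
  omega

end Linkage

end CubeLink

namespace CubeLink

/-! ### Two pairs and one forbidden vertex in the 4-cube -/

section Odd

set_option linter.unusedSectionVars false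

variable {ι κ : Type*} [Fintype ι] [DecidableEq ι] [DecidableEq κ]

/-- Disjoint connected subsets of `U` joining `s₁` to `t₁` and `s₂` to `t₂`. -/
def TwoLinked (U : Set (ι → Bool)) (s₁ t₁ s₂ t₂ : ι → Bool) : Prop :=
  ∃ C₁ C₂ : Set (ι → Bool), C₁ ⊆ U ∧ C₂ ⊆ U ∧ (∀ w ∈ C₁, w ∉ C₂) ∧ ConnIn C₁ s₁ t₁ ∧ ConnIn C₂ s₂ t₂

/-- The half of a subcube on side `b` of direction `j`. -/
def side (J : Finset ι) (c : ι → Bool) (j : ι) (b : Bool) : Set (ι → Bool) :=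
  {w | w ∈ subcube J c ∧ w j = b}

variable {U : Set (ι → Bool)} {s₁ t₁ s₂ t₂ c z : ι → Bool} {J : Finset ι} {j : ι} {b : Bool}

theorem TwoLinked.swap (h : TwoLinked U s₁ t₁ s₂ t₂) : TwoLinked U s₂ t₂ s₁ t₁ := by
  obtain ⟨C₁, C₂, h1, h2, h3, h4, h5⟩ := h
  exact ⟨C₂, C₁, h2, h1, fun w h h' => h3 w h' h, h5, h4⟩

theorem TwoLinked.symm (h : TwoLinked U s₁ t₁ s₂ t₂) : TwoLinked U t₁ s₁ s₂ t₂ := by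
  obtain ⟨C₁, C₂, h1, h2, h3, h4, h5⟩ := h
  exact ⟨C₁, C₂, h1, h2, h3, h4.symm, h5⟩

/-- Pieces on different sides are disjoint automatically, so disjointness is needed only within each
half. -/
theorem TwoLinked.of_sides {A₁ A₂ B₁ B₂ : Set (ι → Bool)}
    (hA₁ : ∀ w ∈ A₁, w ∈ side J c j b ∧ w ≠ z) (hA₂ : ∀ w ∈ A₂, w ∈ side J c j b ∧ w ≠ z)
    (hB₁ : ∀ w ∈ B₁, w ∈ side J c j (!b) ∧ w ≠ z) (hB₂ : ∀ w ∈ B₂, w ∈ side J c j (!b) ∧ w ≠ z)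
    (hA : ∀ w ∈ A₁, w ∉ A₂) (hB : ∀ w ∈ B₁, w ∉ B₂)
    (h₁ : ConnIn (A₁ ∪ B₁) s₁ t₁) (h₂ : ConnIn (A₂ ∪ B₂) s₂ t₂) :
    TwoLinked (subcube J c \ {z}) s₁ t₁ s₂ t₂ := by
  refine ⟨_, _, ?_, ?_, ?_, h₁, h₂⟩
  · rintro w (h | h)
    exacts [⟨(hA₁ w h).1.1, (hA₁ w h).2⟩, ⟨(hB₁ w h).1.1, (hB₁ w h).2⟩]
  · rintro w (h | h)
    exacts [⟨(hA₂ w h).1.1, (hA₂ w h).2⟩, ⟨(hB₂ w h).1.1, (hB₂ w h).2⟩]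
  · rintro w (h | h) (h' | h')
    · exact hA w h h'
    · have := (hA₁ w h).1.2.symm.trans (hB₂ w h').1.2
      simp at this
    · have := (hA₂ w h').1.2.symm.trans (hB₁ w h).1.2
      simp at this
    · exact hB w h h'

theorem flipAt_mem_side (hj : j ∈ J) {w : ι → Bool} (hw : w ∈ side J c j b) :
    flipAt j w ∈ side J c j (!b) :=
  ⟨flipAt_mem_subcube hj hw.1, by rw [flipAt_same, hw.2]⟩

theorem flipAt_mem_side' (hj : j ∈ J) {w : ι → Bool} (hw : w ∈ side J c j (!b)) :
    flipAt j w ∈ side J c j b :=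
  ⟨flipAt_mem_subcube hj hw.1, by rw [flipAt_same, hw.2, Bool.not_not]⟩

theorem side_eq (hj : j ∈ J) {x : ι → Bool} (hx : x ∈ side J c j b) :
    side J c j b = subcube (J.erase j) x := by
  ext w
  rw [mem_subcube_erase hj, ← subcube_eq hx.1, hx.2]
  rfl

theorem ne_of_side {x y : ι → Bool} (hx : x ∈ side J c j b) (hy : y ∈ side J c j (!b)) :
    x ≠ y := by
  rintro rfl
  have := hx.2.symm.trans hy.2
  simp at this

/-- A half of the 4-cube is a 3-cube, which stays connected after removal of two vertices. When one
vertex is to be avoided, `p = q`. -/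
theorem connIn_side (hJ : J.card = 4) (hj : j ∈ J) (p q : ι → Bool) {x y : ι → Bool}
    (hx : x ∈ side J c j b) (hy : y ∈ side J c j b) (hxp : x ≠ p) (hxq : x ≠ q) (hyp : y ≠ p)
    (hyq : y ≠ q) : ConnIn {w | w ∈ side J c j b ∧ w ≠ p ∧ w ≠ q} x y := by
  have h1 : (J.erase j).card = 3 := by rw [Finset.card_erase_of_mem hj, hJ]
  have h2 := hy
  rw [side_eq hj hx] at h2 ⊢
  refine (connIn_subcube_diff 3 (J.erase j) h1 {p, q} Finset.card_le_two x y h2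
    (by simp [hxp, hxq]) (by simp [hyp, hyq])).mono ?_
  rintro w ⟨h, h'⟩
  simp only [Finset.coe_insert, Finset.coe_singleton, Set.mem_insert_iff,
    Set.mem_singleton_iff, not_or] at h'
  exact ⟨h, h'⟩

/-- Both pairs are split and cross straight from different sides. -/
theorem twoLinked_split_split (hJ : J.card = 4) (hj : j ∈ J) (hs₁ : s₁ ∈ side J c j b)
    (hs₂ : s₂ ∈ side J c j b) (ht₁ : t₁ ∈ side J c j (!b)) (ht₂ : t₂ ∈ side J c j (!b))
    (hss : s₁ ≠ s₂) (htt : t₁ ≠ t₂) (hs₁z : s₁ ≠ z) (hs₂z : s₂ ≠ z) (ht₁z : t₁ ≠ z) (ht₂z : t₂ ≠ z)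
    (h1 : flipAt j s₁ ≠ t₂) (h2 : flipAt j s₁ ≠ z) (h3 : flipAt j t₂ ≠ z) :
    TwoLinked (subcube J c \ {z}) s₁ t₁ s₂ t₂ := by
  have h1' : flipAt j t₂ ≠ s₁ := fun h => h1 (by rw [← h, flipAt_flipAt])
  refine TwoLinked.of_sides (j := j) (b := b) (A₁ := {s₁})
    (A₂ := {w | w ∈ side J c j b ∧ w ≠ s₁ ∧ w ≠ z})
    (B₁ := {w | w ∈ side J c j (!b) ∧ w ≠ t₂ ∧ w ≠ z}) (B₂ := {t₂}) ?_ ?_ ?_ ?_ ?_ ?_ ?_ ?_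
  · rintro w rfl; exact ⟨hs₁, hs₁z⟩
  · exact fun w h => ⟨h.1, h.2.2⟩
  · exact fun w h => ⟨h.1, h.2.2⟩
  · rintro w rfl; exact ⟨ht₂, ht₂z⟩
  · rintro w rfl h; exact h.2.1 rfl
  · exact fun w h h' => h.2.1 h'
  · have := (connIn_side hJ hj t₂ z (flipAt_mem_side hj hs₁) ht₁ h1 h2 htt ht₁z).mono
      (Set.subset_union_right (s := {s₁}))
    exact (ConnIn.edge j (.inl rfl) this.left).trans this
  · have := (connIn_side hJ hj s₁ z hs₂ (flipAt_mem_side' hj ht₂) hss.symm hs₂z h1' h3).mono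
      (Set.subset_union_left (t := {t₂}))
    exact this.trans (ConnIn.edge j (.inr rfl) this.right).symm

/-- The first pair is split and the second is on one side. -/
theorem twoLinked_split_left (hJ : J.card = 4) (hj : j ∈ J) (hs₁ : s₁ ∈ side J c j b)
    (hs₂ : s₂ ∈ side J c j b) (ht₁ : t₁ ∈ side J c j (!b)) (ht₂ : t₂ ∈ side J c j b)
    (hs₁s₂ : s₁ ≠ s₂) (hs₁t₂ : s₁ ≠ t₂) (hs₁z : s₁ ≠ z) (hs₂z : s₂ ≠ z) (ht₁z : t₁ ≠ z)
    (ht₂z : t₂ ≠ z) : TwoLinked (subcube J c \ {z}) s₁ t₁ s₂ t₂ := by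
  by_cases h1 : flipAt j s₁ = z
  · have hz : z ∈ side J c j (!b) := h1 ▸ flipAt_mem_side hj hs₁
    by_cases h2 : flipAt j t₁ = s₂ ∨ flipAt j t₁ = t₂
    -- As `s₁` cannot cross straight, the first path steps aside before crossing: three directions
    -- in the half, only two vertices to avoid. The second pair goes around this edge in the same
    -- half.
    · obtain ⟨r, hr, hrx⟩ : ∃ r ∈ J.erase j, flipAt r s₁ ∉ ({s₂, t₂} : Finset (ι → Bool)) := by
        by_contra hcon
        push Not at hcon
        have := Finset.card_le_card_of_injOn (s := J.erase j) (t := {s₂, t₂})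
          (fun r => flipAt r s₁) (fun r hr => hcon r hr) ((flipAt_dir_injective s₁).injOn)
        rw [Finset.card_erase_of_mem hj, hJ] at this
        have h3 : ({s₂, t₂} : Finset (ι → Bool)).card ≤ 2 := Finset.card_le_two
        omega
      have hrj := Finset.ne_of_mem_erase hr
      have hx : flipAt r s₁ ∈ side J c j b :=
        ⟨flipAt_mem_subcube (Finset.mem_of_mem_erase hr) hs₁.1, by
          rw [flipAt_ne hrj.symm, hs₁.2]⟩
      simp only [Finset.mem_insert, Finset.mem_singleton, not_or] at hrx
      refine TwoLinked.of_sides (j := j) (b := b) (A₁ := {s₁, flipAt r s₁})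
        (A₂ := {w | w ∈ side J c j b ∧ w ≠ s₁ ∧ w ≠ flipAt r s₁})
        (B₁ := {w | w ∈ side J c j (!b) ∧ w ≠ z ∧ w ≠ z}) (B₂ := ∅) ?_ ?_ ?_ ?_ ?_ ?_ ?_ ?_
      · rintro w (rfl | rfl)
        exacts [⟨hs₁, hs₁z⟩, ⟨hx, ne_of_side hx hz⟩]
      · exact fun w h => ⟨h.1, ne_of_side h.1 hz⟩
      · exact fun w h => ⟨h.1, h.2.2⟩
      · simp
      · rintro w (rfl | rfl) h
        exacts [h.2.1 rfl, h.2.2 rfl]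
      · simp
      · have hxz : flipAt j (flipAt r s₁) ≠ z := by
          rw [← h1]
          exact fun h => flipAt_ne_self r s₁ (flipAt_injective j h)
        have := (connIn_side hJ hj z z (flipAt_mem_side hj hx) ht₁ hxz hxz ht₁z ht₁z).mono
          (Set.subset_union_right (s := {s₁, flipAt r s₁}))
        refine ((ConnIn.edge r (.inl (.inl rfl)) (.inl (.inr rfl))).trans
          (ConnIn.edge j (.inl (.inr rfl)) this.left)).trans this
      · exact (connIn_side hJ hj s₁ (flipAt r s₁) hs₂ ht₂ hs₁s₂.symm (Ne.symm hrx.1)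
          hs₁t₂.symm (Ne.symm hrx.2)).mono Set.subset_union_left
    -- Here the first pair runs in the half of `s₁` and crosses only at `t₁`, while the second goes
    -- through the other half; `z` is across from `s₁` and hence not in the way of its crossings.
    · push Not at h2
      have e : ∀ w, w ≠ s₁ → flipAt j w ≠ z := fun w hw h => hw (flipAt_injective j (h.trans h1.symm))
      have e' : ∀ w, flipAt j t₁ ≠ w → flipAt j w ≠ t₁ := fun w hw h => hw (by
        rw [← h, flipAt_flipAt])
      refine TwoLinked.of_sides (j := j) (b := b)
        (A₁ := {w | w ∈ side J c j b ∧ w ≠ s₂ ∧ w ≠ t₂}) (A₂ := {s₂, t₂}) (B₁ := {t₁})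
        (B₂ := {w | w ∈ side J c j (!b) ∧ w ≠ t₁ ∧ w ≠ z}) ?_ ?_ ?_ ?_ ?_ ?_ ?_ ?_
      · exact fun w h => ⟨h.1, ne_of_side h.1 hz⟩
      · rintro w (rfl | rfl)
        exacts [⟨hs₂, hs₂z⟩, ⟨ht₂, ht₂z⟩]
      · rintro w rfl; exact ⟨ht₁, ht₁z⟩
      · exact fun w h => ⟨h.1, h.2.2⟩
      · rintro w h (rfl | rfl)
        exacts [h.2.1 rfl, h.2.2 rfl]
      · rintro w rfl h; exact h.2.1 rfl
      · have := (connIn_side hJ hj s₂ t₂ hs₁ (flipAt_mem_side' hj ht₁) hs₁s₂ hs₁t₂ h2.1 h2.2).mono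
          (Set.subset_union_left (t := {t₁}))
        exact this.trans (ConnIn.edge j (.inr rfl) this.right).symm
      · have := (connIn_side hJ hj t₁ z (flipAt_mem_side hj hs₂) (flipAt_mem_side hj ht₂)
          (e' _ h2.1) (e _ hs₁s₂.symm) (e' _ h2.2) (e _ hs₁t₂.symm)).mono
          (Set.subset_union_right (s := {s₂, t₂}))
        exact ((ConnIn.edge j (.inl (.inl rfl)) this.left).trans this).trans
          (ConnIn.edge j (.inl (.inr rfl)) this.right).symm
  · refine TwoLinked.of_sides (j := j) (b := b) (A₁ := {s₁})
      (A₂ := {w | w ∈ side J c j b ∧ w ≠ s₁ ∧ w ≠ z})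
      (B₁ := {w | w ∈ side J c j (!b) ∧ w ≠ z ∧ w ≠ z}) (B₂ := ∅) ?_ ?_ ?_ ?_ ?_ ?_ ?_ ?_
    · rintro w rfl; exact ⟨hs₁, hs₁z⟩
    · exact fun w h => ⟨h.1, h.2.2⟩
    · exact fun w h => ⟨h.1, h.2.2⟩
    · simp
    · rintro w rfl h; exact h.2.1 rfl
    · simp
    · have := (connIn_side hJ hj z z (flipAt_mem_side hj hs₁) ht₁ h1 h1 ht₁z ht₁z).mono
        (Set.subset_union_right (s := {s₁}))
      exact (ConnIn.edge j (.inl rfl) this.left).trans this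
    · exact (connIn_side hJ hj s₁ z hs₂ ht₂ hs₁s₂.symm hs₂z hs₁t₂.symm ht₂z).mono
        Set.subset_union_left

/-- The first pair is linked through the other side. -/
theorem twoLinked_up (hJ : J.card = 4) (hj : j ∈ J) (hs₁ : s₁ ∈ side J c j b)
    (ht₁ : t₁ ∈ side J c j b) (hs₁z : s₁ ≠ z) (ht₁z : t₁ ≠ z) (h1 : flipAt j s₁ ≠ z)
    (h2 : flipAt j t₁ ≠ z)
    (h : ConnIn {w | w ∈ side J c j b ∧ w ≠ z ∧ w ≠ s₁ ∧ w ≠ t₁} s₂ t₂) :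
    TwoLinked (subcube J c \ {z}) s₁ t₁ s₂ t₂ := by
  refine TwoLinked.of_sides (j := j) (b := b) (A₁ := {s₁, t₁})
    (B₁ := {w | w ∈ side J c j (!b) ∧ w ≠ z ∧ w ≠ z}) (B₂ := ∅) ?_ ?_ ?_ ?_ ?_ ?_ ?_
    (h.mono Set.subset_union_left)
  · rintro w (rfl | rfl)
    exacts [⟨hs₁, hs₁z⟩, ⟨ht₁, ht₁z⟩]
  · exact fun w h => ⟨h.1, h.2.1⟩
  · exact fun w h => ⟨h.1, h.2.1⟩
  · simp
  · rintro w (rfl | rfl) h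
    exacts [h.2.2.1 rfl, h.2.2.2 rfl]
  · simp
  · have := (connIn_side hJ hj z z (flipAt_mem_side hj hs₁) (flipAt_mem_side hj ht₁) h1 h1 h2
      h2).mono (Set.subset_union_right (s := {s₁, t₁}))
    exact ((ConnIn.edge j (.inl (.inl rfl)) this.left).trans this).trans
      (ConnIn.edge j (.inl (.inr rfl)) this.right).symm

theorem mem_side_not {x : ι → Bool} (hw : z ∈ subcube J c) (h : x j ≠ z j) :
    z ∈ side J c j (!x j) := ⟨hw, by cases h1 : x j <;> cases h2 : z j <;> simp_all⟩

/-- The `4`-cube minus a vertex is `2`-linked. -/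
theorem twoLinked_four (hJ : J.card = 4) (ms₁ : s₁ ∈ subcube J c) (mt₁ : t₁ ∈ subcube J c)
    (ms₂ : s₂ ∈ subcube J c) (mt₂ : t₂ ∈ subcube J c) (mz : z ∈ subcube J c)
    (h1 : s₁ ≠ t₁) (h2 : s₁ ≠ s₂) (h3 : s₁ ≠ t₂) (h4 : t₁ ≠ s₂) (h5 : t₁ ≠ t₂) (h6 : s₂ ≠ t₂)
    (z1 : s₁ ≠ z) (z2 : t₁ ≠ z) (z3 : s₂ ≠ z) (z4 : t₂ ≠ z) :
    TwoLinked (subcube J c \ {z}) s₁ t₁ s₂ t₂ := by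
  by_cases hsplit : ∀ j ∈ J, s₁ j ≠ t₁ j ∧ s₂ j ≠ t₂ j
  -- Both pairs are antipodal in the subcube. Of the four neighbours of `s₁` at most three are `s₂`,
  -- `t₂` or `z`.
  · obtain ⟨j, hj, hjx⟩ : ∃ j ∈ J, flipAt j s₁ ∉ ({s₂, t₂, z} : Finset (ι → Bool)) := by
      by_contra hcon
      push Not at hcon
      have := Finset.card_le_card_of_injOn (s := J) (t := {s₂, t₂, z})
        (fun r => flipAt r s₁) (fun r hr => hcon r hr) ((flipAt_dir_injective s₁).injOn)
      have h3 : ({s₂, t₂, z} : Finset (ι → Bool)).card ≤ 3 := Finset.card_le_three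
      omega
    simp only [Finset.mem_insert, Finset.mem_singleton, not_or] at hjx
    -- up to the names in the second pair, `s₂` is on the side of `s₁`
    have main : ∀ s₂ t₂ : ι → Bool, s₂ ∈ subcube J c → t₂ ∈ subcube J c → s₁ ≠ s₂ → t₁ ≠ s₂ →
        t₁ ≠ t₂ → s₂ ≠ t₂ → s₂ ≠ z → t₂ ≠ z → (∀ i ∈ J, s₂ i ≠ t₂ i) → flipAt j s₁ ≠ t₂ →
        s₂ j = s₁ j → TwoLinked (subcube J c \ {z}) s₁ t₁ s₂ t₂ := by
      intro s₂ t₂ ms₂ mt₂ h2 h4 h5 h6 z3 z4 hs hne hside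
      have a1 : s₁ ∈ side J c j (s₁ j) := ⟨ms₁, rfl⟩
      have a2 : s₂ ∈ side J c j (s₁ j) := ⟨ms₂, hside⟩
      have a3 : t₁ ∈ side J c j (!s₁ j) := mem_side_not mt₁ (hsplit j hj).1
      have a4 : t₂ ∈ side J c j (!s₁ j) := mem_side_not mt₂ (hside ▸ hs j hj)
      -- When `z` is across from `t₂`, the pairs exchange roles; by antipodality, `t₁` across from
      -- `s₂` would put `t₂` across from `s₁`.
      by_cases hz : flipAt j t₂ = z
      · refine (twoLinked_split_split hJ hj a2 a1 a4 a3 h2.symm h5.symm z3 z1 z4 z2 ?_ ?_ ?_).swap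
        · intro h
          apply hne
          ext i
          by_cases hi : i ∈ J
          · have e1 := congrFun h i
            have e2 := (hsplit i hi).1
            have e3 := hs i hi
            by_cases hij : i = j
            · subst hij
              rw [flipAt_same] at e1 ⊢
              rw [hside] at e3
              cases h : s₁ i <;> cases h' : t₂ i <;> simp_all
            · rw [flipAt_ne hij] at e1 ⊢
              rw [e1] at e3
              cases h : s₁ i <;> cases h' : t₂ i <;> simp_all
          · rw [flipAt_mem_subcube hj ms₁ i hi, mt₂ i hi]
        · exact fun h => h6 (flipAt_injective j (h.trans hz.symm))
        · exact fun h => h5 (flipAt_injective j (h.trans hz.symm))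
      · exact twoLinked_split_split hJ hj a1 a2 a3 a4 h2 h5 z1 z3 z2 z4 hne hjx.2.2 hz
    by_cases hside : s₂ j = s₁ j
    · exact main s₂ t₂ ms₂ mt₂ h2 h4 h5 h6 z3 z4 (fun i hi => (hsplit i hi).2) hjx.2.1 hside
    · have : t₂ j = s₁ j := by
        have := (hsplit j hj).2
        cases h : s₁ j <;> cases h' : t₂ j <;> simp_all
      exact (main t₂ s₂ mt₂ ms₂ h3 h5 h4 h6.symm z4 z3 (fun i hi => (hsplit i hi).2.symm) hjx.1
        this).swap.symm.swap
  push Not at hsplit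
  obtain ⟨j, hj, hjs⟩ := hsplit
  -- a direction splitting exactly one pair
  have one : ∀ s₁ t₁ s₂ t₂ : ι → Bool, s₁ ∈ subcube J c → t₁ ∈ subcube J c → s₂ ∈ subcube J c →
      t₂ ∈ subcube J c → s₁ ≠ s₂ → s₁ ≠ t₂ → t₁ ≠ s₂ → t₁ ≠ t₂ → s₁ ≠ z → t₁ ≠ z → s₂ ≠ z →
      t₂ ≠ z → s₁ j ≠ t₁ j → s₂ j = t₂ j → TwoLinked (subcube J c \ {z}) s₁ t₁ s₂ t₂ := by
    intro s₁ t₁ s₂ t₂ ms₁ mt₁ ms₂ mt₂ h2 h3 h4 h5 z1 z2 z3 z4 hs hs'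
    by_cases h : s₂ j = s₁ j
    · exact twoLinked_split_left hJ hj ⟨ms₁, rfl⟩ ⟨ms₂, h⟩ (mem_side_not mt₁ hs)
        ⟨mt₂, hs' ▸ h⟩ h2 h3 z1 z3 z2 z4
    · have h' : s₂ j = t₁ j := by cases h' : s₁ j <;> cases h'' : t₁ j <;> simp_all
      exact (twoLinked_split_left hJ hj ⟨mt₁, rfl⟩ ⟨ms₂, h'⟩ (mem_side_not ms₁ hs.symm)
        ⟨mt₂, hs' ▸ h'⟩ h4 h5 z2 z3 z1 z4).symm
  by_cases hs₁ : s₁ j = t₁ j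
  swap
  · exact one s₁ t₁ s₂ t₂ ms₁ mt₁ ms₂ mt₂ h2 h3 h4 h5 z1 z2 z3 z4 hs₁ (hjs hs₁)
  by_cases hs₂ : s₂ j = t₂ j
  swap
  · exact (one s₂ t₂ s₁ t₁ ms₂ mt₂ ms₁ mt₁ h2.symm h4.symm h3.symm h5.symm z3 z4 z1 z2 hs₂
      hs₁).swap
  by_cases h12 : s₂ j = s₁ j
  swap
  · refine TwoLinked.of_sides (j := j) (b := s₁ j)
      (A₁ := {w | w ∈ side J c j (s₁ j) ∧ w ≠ z ∧ w ≠ z}) (A₂ := ∅) (B₁ := ∅)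
      (B₂ := {w | w ∈ side J c j (!s₁ j) ∧ w ≠ z ∧ w ≠ z}) ?_ ?_ ?_ ?_ ?_ ?_ ?_ ?_
    · exact fun w h => ⟨h.1, h.2.1⟩
    · simp
    · simp
    · exact fun w h => ⟨h.1, h.2.1⟩
    · simp
    · simp
    · exact (connIn_side hJ hj z z ⟨ms₁, rfl⟩ ⟨mt₁, hs₁.symm⟩ z1 z1 z2 z2).mono
        Set.subset_union_left
    · exact (connIn_side hJ hj z z (mem_side_not ms₂ (Ne.symm h12))
        (mem_side_not mt₂ (hs₂ ▸ Ne.symm h12)) z3 z3 z4 z4).mono Set.subset_union_right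
  have a1 : s₁ ∈ side J c j (s₁ j) := ⟨ms₁, rfl⟩
  have a2 : t₁ ∈ side J c j (s₁ j) := ⟨mt₁, hs₁.symm⟩
  have a3 : s₂ ∈ side J c j (s₁ j) := ⟨ms₂, h12⟩
  have a4 : t₂ ∈ side J c j (s₁ j) := ⟨mt₂, hs₂ ▸ h12⟩
  by_cases hz : z j = s₁ j
  · have a5 : z ∈ side J c j (s₁ j) := ⟨mz, hz⟩
    have up : ∀ w ∈ side J c j (s₁ j), flipAt j w ≠ z := fun w hw =>
      (ne_of_side a5 (flipAt_mem_side hj hw)).symm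
    rcases connIn_or_connIn (J.erase j) (by rw [Finset.card_erase_of_mem hj, hJ])
      {s₁, t₁, s₂, t₂, z} (by rw [Finset.card_erase_of_mem hj, hJ]; exact Finset.card_le_five)
      s₁ t₁ s₂ t₂ (by simp) (by simp) (by simp) (by simp) h1 h6
      (by simp [h2.symm, h3.symm, h4.symm, h5.symm])
      (side_eq hj a1 ▸ a2) (side_eq hj a3 ▸ a4) with h | h
    · rw [← side_eq hj a1] at h
      refine (twoLinked_up hJ hj a3 a4 z3 z4 (up _ a3) (up _ a4) (h.mono ?_)).swap
      rintro w ⟨hw, hw'⟩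
      refine ⟨hw, ?_, ?_, ?_⟩ <;> rintro rfl <;> apply hw' <;>
        simp [z1.symm, z2.symm, h2.symm, h3.symm, h4.symm, h5.symm]
    · rw [← side_eq hj a3] at h
      refine twoLinked_up hJ hj a1 a2 z1 z2 (up _ a1) (up _ a2) (h.mono ?_)
      rintro w ⟨hw, hw'⟩
      refine ⟨hw, ?_, ?_, ?_⟩ <;> rintro rfl <;> apply hw' <;>
        simp [z3.symm, z4.symm, h2, h3, h4, h5]
  · have a5 := mem_side_not mz (Ne.symm hz)
    by_cases hup : flipAt j s₁ ≠ z ∧ flipAt j t₁ ≠ z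
    · refine twoLinked_up hJ hj a1 a2 z1 z2 hup.1 hup.2 ((connIn_side hJ hj s₁ t₁ a3 a4 h2.symm
        h4.symm h3.symm h5.symm).mono ?_)
      exact fun w hw => ⟨hw.1, ne_of_side hw.1 a5, hw.2.1, hw.2.2⟩
    -- Only one vertex is across from `z`, and it belongs to the first pair; so the second pair can
    -- use the other half.
    · have hz' : ∃ w, (w = s₁ ∨ w = t₁) ∧ flipAt j w = z := by
        by_cases h : flipAt j s₁ = z
        · exact ⟨_, .inl rfl, h⟩
        · exact ⟨_, .inr rfl, by tauto⟩
      obtain ⟨w, hw, rfl⟩ := hz'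
      have e : ∀ y, y ≠ w → flipAt j y ≠ flipAt j w := fun y h h' => h (flipAt_injective j h')
      refine (twoLinked_up hJ hj a3 a4 z3 z4 (e _ ?_) (e _ ?_)
        ((connIn_side hJ hj s₂ t₂ a1 a2 h2 h3 h4 h5).mono ?_)).swap
      · rcases hw with rfl | rfl
        exacts [h2.symm, h4.symm]
      · rcases hw with rfl | rfl
        exacts [h3.symm, h5.symm]
      · exact fun w hw => ⟨hw.1, ne_of_side hw.1 a5, hw.2.1, hw.2.2⟩

end Odd

end CubeLink

namespace CubeLink

/-! ### Weight n + 1 in dimension n ≥ 4 -/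

section Weighted

set_option linter.unusedSectionVars false

variable {ι κ : Type*} [Fintype ι] [DecidableEq ι] [DecidableEq κ] {J : Finset ι} {c : ι → Bool}
  {I : Finset κ} {s t : κ → ι → Bool} {j : ι} {U : Set (ι → Bool)}

/-- One pair can always be linked. -/
theorem Linkage.of_le_one (hP : IsPairing (subcube J c) I s t)
    (hcard : (terminals I s t).card ≤ J.card + 1)
    (h : ∀ i ∈ I, ∀ l ∈ I, s i ≠ t i → s l ≠ t l → i = l) : Linkage (subcube J c) I s t := by
  refine ⟨fun i => if s i = t i then {s i} else subcube J c \ ↑(terminals I s t \ block s t i),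
    fun i hi => ?_, fun i hi l hl z hz hz' => ?_⟩
  · dsimp only
    have m1 := hP.mem i hi _ left_mem_block
    by_cases hd : s i = t i
    · rw [if_pos hd]
      refine ⟨by rintro _ rfl; exact m1, hd ▸ .refl rfl⟩
    · rw [if_neg hd]
      refine ⟨Set.sdiff_subset, ?_⟩
      rw [subcube_eq m1]
      refine connIn_subcube_diff _ J rfl _ ?_ _ _ (subcube_eq m1 ▸ hP.mem i hi _ right_mem_block)
        (by simp [left_mem_block]) (by simp [right_mem_block])
      have : block s t i ⊆ terminals I s t := fun z hz => mem_terminals.2 ⟨i, hi, hz⟩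
      rw [Finset.card_sdiff_of_subset this, card_block_of_ne hd]
      omega
  · have key : ∀ i ∈ I, ∀ l ∈ I, s l = t l → z = s l →
        z ∈ subcube J c \ ↑(terminals I s t \ block s t i) → i = l := by
      intro i hi l hl hd hzl hz
      by_contra hil
      refine hz.2 (Finset.mem_coe.2 (Finset.mem_sdiff.2
        ⟨mem_terminals.2 ⟨l, hl, hzl ▸ left_mem_block⟩, fun h => hil ?_⟩))
      exact hP.eq i hi l hl z h (hzl ▸ left_mem_block)
    dsimp only at hz hz'
    by_cases hd : s i = t i <;> by_cases hd' : s l = t l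
    · rw [if_pos hd] at hz
      rw [if_pos hd'] at hz'
      exact hP.eq i hi l hl z (hz ▸ left_mem_block) (hz' ▸ left_mem_block)
    · rw [if_pos hd] at hz
      rw [if_neg hd'] at hz'
      exact (key l hl i hi hd hz hz').symm
    · rw [if_neg hd] at hz
      rw [if_pos hd'] at hz'
      exact key i hi l hl hd' hz' hz
    · exact h i hi l hl hd hd'

theorem IsPairing.ne_of_ne (hP : IsPairing U I s t) {i l : κ} (hi : i ∈ I) (hl : l ∈ I)
    (hil : i ≠ l) {y z : ι → Bool} (hy : y ∈ block s t i) (hz : z ∈ block s t l) : y ≠ z := by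
  rintro rfl
  exact hil (hP.eq i hi l hl _ hy hz)

/-- Two proper pairs already use weight 4, so at most one further terminal remains. It serves as the
forbidden vertex of `twoLinked_four`; if there is none, any other vertex does. -/
theorem cubeLinked_four (hJ : J.card = 4) : CubeLinked κ J 5 := by
  intro c I s t hP hcard
  by_cases h : ∀ i ∈ I, ∀ l ∈ I, s i ≠ t i → s l ≠ t l → i = l
  · exact .of_le_one hP (by omega) h
  push Not at h
  obtain ⟨p, hp, q, hq, hdp, hdq, hpq⟩ := h
  -- the forbidden vertex
  have hsub : block s t p ∪ block s t q ⊆ terminals I s t := by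
    intro z hz
    rcases Finset.mem_union.1 hz with hz | hz
    exacts [mem_terminals.2 ⟨p, hp, hz⟩, mem_terminals.2 ⟨q, hq, hz⟩]
  have hdisj : Disjoint (block s t p) (block s t q) :=
    Finset.disjoint_left.2 fun z hz hz' => hpq (hP.eq p hp q hq z hz hz')
  have hc4 : (block s t p ∪ block s t q).card = 4 := by
    rw [Finset.card_union_of_disjoint hdisj, card_block_of_ne hdp, card_block_of_ne hdq]
  have hrest : (terminals I s t \ (block s t p ∪ block s t q)).card ≤ 1 := by
    rw [Finset.card_sdiff_of_subset hsub]; omega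
  obtain ⟨z, hz, hzp, hall⟩ : ∃ z ∈ subcube J c, z ∉ block s t p ∪ block s t q ∧
      ∀ y ∈ terminals I s t \ (block s t p ∪ block s t q), y = z := by
    rcases (terminals I s t \ (block s t p ∪ block s t q)).eq_empty_or_nonempty with h | ⟨z, hz⟩
    · obtain ⟨x, hx, -⟩ := exists_injOn_subcube J c (block s t p ∪ block s t q)
        ({()} : Finset Unit) (by rw [hc4, hJ]; simp)
      exact ⟨x (), (hx () (by simp)).1, (hx () (by simp)).2, by simp [h]⟩
    · refine ⟨z, ?_, (Finset.mem_sdiff.1 hz).2, fun y hy => Finset.card_le_one.1 hrest y hy z hz⟩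
      obtain ⟨i, hi, hzi⟩ := mem_terminals.1 (Finset.mem_sdiff.1 hz).1
      exact hP.mem i hi z hzi
  have hne : ∀ y ∈ block s t p ∪ block s t q, y ≠ z := fun y hy h => hzp (h ▸ hy)
  obtain ⟨C₁, C₂, m1, m2, hd, c1, c2⟩ := twoLinked_four hJ (hP.mem p hp _ left_mem_block)
    (hP.mem p hp _ right_mem_block) (hP.mem q hq _ left_mem_block)
    (hP.mem q hq _ right_mem_block) hz hdp
    (hP.ne_of_ne hp hq hpq left_mem_block left_mem_block)
    (hP.ne_of_ne hp hq hpq left_mem_block right_mem_block)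
    (hP.ne_of_ne hp hq hpq right_mem_block left_mem_block)
    (hP.ne_of_ne hp hq hpq right_mem_block right_mem_block) hdq
    (hne _ (by simp [left_mem_block])) (hne _ (by simp [right_mem_block]))
    (hne _ (by simp [left_mem_block])) (hne _ (by simp [right_mem_block]))
  have hother : ∀ i ∈ I, i ≠ p → i ≠ q → s i = z ∧ t i = z := by
    intro i hi hip hiq
    have : ∀ y ∈ block s t i, y = z := fun y hy => hall y (by
      refine Finset.mem_sdiff.2 ⟨mem_terminals.2 ⟨i, hi, hy⟩, fun h => ?_⟩
      rcases Finset.mem_union.1 h with h | h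
      · exact hip (hP.eq i hi p hp y hy h)
      · exact hiq (hP.eq i hi q hq y hy h))
    exact ⟨this _ left_mem_block, this _ right_mem_block⟩
  refine ⟨fun i => if i = p then C₁ else if i = q then C₂ else {z}, fun i hi => ?_, ?_⟩
  · dsimp only
    by_cases hip : i = p
    · subst hip
      rw [if_pos rfl]
      exact ⟨fun w hw => (m1 hw).1, c1⟩
    by_cases hiq : i = q
    · subst hiq
      rw [if_neg hip, if_pos rfl]
      exact ⟨fun w hw => (m2 hw).1, c2⟩
    · rw [if_neg hip, if_neg hiq, (hother i hi hip hiq).1, (hother i hi hip hiq).2]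
      exact ⟨by rintro _ rfl; exact hz, .refl rfl⟩
  · intro i hi l hl w hw hw'
    dsimp only at hw hw'
    by_contra hil
    split_ifs at hw hw' with h1 h2 h3 h4 h5 h6
    · exact hil (h1.trans h2.symm)
    · exact hd w hw hw'
    · exact (m1 hw).2 hw'
    · exact hd w hw' hw
    · exact hil (h4.trans h6.symm)
    · exact (m2 hw).2 hw'
    · exact (m1 hw').2 hw
    · exact (m2 hw').2 hw
    · exact hil (hP.eq i hi l hl z (by rw [← (hother i hi h1 h4).1]; exact left_mem_block)
        (by rw [← (hother l hl (by assumption) (by assumption)).1]; exact left_mem_block))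

theorem IsStraight.not {b : Bool} {i : κ} (h : ¬ IsStraight I s t j b i) (hi : i ∈ I)
    (hst : s i j ≠ t i j) : ∃ l ∈ I, l ≠ i ∧ flipAt j (endAt j b s t i) ∈ block s t l := by
  by_contra hcon
  push Not at hcon
  exact h ⟨hi, hst, hcon⟩

/-- Two split indices that cannot cross straight give two parallel edges between terminals. -/
theorem twoEdges_of_not_isStraight (hP : IsPairing U I s t) {b : Bool} {i l : κ} (hi : i ∈ I)
    (hl : l ∈ I) (hil : i ≠ l) (hsi : s i j ≠ t i j) (hsl : s l j ≠ t l j)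
    (h : ¬ IsStraight I s t j b i) (h' : ¬ IsStraight I s t j b l) :
    TwoEdges j (terminals I s t) := by
  obtain ⟨p, hp, -, hp'⟩ := IsStraight.not h hi hsi
  obtain ⟨q, hq, -, hq'⟩ := IsStraight.not h' hl hsl
  exact ⟨endAt j b s t i, mem_terminals.2 ⟨i, hi, endAt_mem_block⟩, endAt j b s t l,
    mem_terminals.2 ⟨l, hl, endAt_mem_block⟩,
    hP.ne_of_ne hi hl hil endAt_mem_block endAt_mem_block,
    by rw [endAt_apply hsi, endAt_apply hsl], mem_terminals.2 ⟨p, hp, hp'⟩,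
    mem_terminals.2 ⟨q, hq, hq'⟩⟩

/-- All terminals on one side of a direction. -/
theorem Linkage.of_one_side (hj : j ∈ J) (hJ : 5 ≤ J.card) (hP : IsPairing (subcube J c) I s t)
    (ih : CubeLinked κ (J.erase j) J.card) (hcard : (terminals I s t).card ≤ J.card + 1) {p q : κ}
    (hp : p ∈ I) (hq : q ∈ I) (hpq : p ≠ q) (hdp : s p ≠ t p) (hdq : s q ≠ t q) (b : Bool)
    (hb : ∀ z ∈ terminals I s t, z j = b) : Linkage (subcube J c) I s t := by
  have hT : ∀ i ∈ I, ∀ z ∈ block s t i, z ∈ terminals I s t := fun i hi z hz =>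
    mem_terminals.2 ⟨i, hi, hz⟩
  have hcard' : (J.erase j).card = J.card - 1 := Finset.card_erase_of_mem hj
  have up : ∀ i₀ ∈ I, s i₀ ≠ t i₀ →
      ConnIn (subcube (J.erase j) (s i₀) \ ↑(terminals I s t \ block s t i₀)) (s i₀) (t i₀) →
      Linkage (subcube J c) I s t := by
    intro i₀ hi₀ hd hconn
    refine Linkage.of_up hj hP ih (by omega) i₀ hi₀ hd hconn fun i hi _ => .inr fun z hz => ?_
    rw [hb z (hT i hi z hz), hb _ (hT i₀ hi₀ _ left_mem_block)]
    refine ⟨rfl, fun h => ?_⟩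
    have h1 := hb _ h
    rw [flipAt_same, hb z (hT i hi z hz)] at h1
    simp at h1
  have mem : ∀ i ∈ I, t i ∈ subcube (J.erase j) (s i) := by
    intro i hi
    rw [mem_subcube_erase hj, ← subcube_eq (hP.mem i hi _ left_mem_block)]
    exact ⟨hP.mem i hi _ right_mem_block, by
      rw [hb _ (hT i hi _ left_mem_block), hb _ (hT i hi _ right_mem_block)]⟩
  rcases connIn_or_connIn (J.erase j) (by omega) (terminals I s t) (by omega) (s p) (t p) (s q)
    (t q) (hT p hp _ left_mem_block) (hT p hp _ right_mem_block) (hT q hq _ left_mem_block)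
    (hT q hq _ right_mem_block) hdp hdq (fun z hz hz' => hpq (hP.eq p hp q hq z hz' hz))
    (mem p hp) (mem q hq) with h | h
  · exact up p hp hdp h
  · exact up q hq hdq h

/-- In a counterexample the weight is exactly |J| + 1, and each direction must contain two parallel
edges between terminals, since otherwise a cut there succeeds. Contraction then forces |J| + 2
terminals. -/
theorem cubeLinked_step (hJ : 5 ≤ J.card)
    (ih : ∀ j ∈ J, CubeLinked κ (J.erase j) J.card) : CubeLinked κ J (J.card + 1) := by
  intro c I s t hP hcard
  by_cases h : ∀ i ∈ I, ∀ l ∈ I, s i ≠ t i → s l ≠ t l → i = l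
  · exact .of_le_one hP hcard h
  push Not at h
  obtain ⟨p, hp, q, hq, hdp, hdq, hpq⟩ := h
  have hpow : 2 * (terminals I s t).card ≤ 2 ^ (J.card - 1) := by
    obtain ⟨k, hk⟩ : ∃ k, J.card = k + 5 := ⟨J.card - 5, by omega⟩
    have := Nat.lt_two_pow_self (n := k)
    rw [hk] at hcard
    rw [hk, show k + 5 - 1 = k + 4 by omega, pow_add]
    omega
  by_cases hlt : (terminals I s t).card ≤ J.card
  · obtain ⟨j, hj⟩ : J.Nonempty := Finset.card_pos.1 (by omega)
    exact Linkage.of_straight hj hP hpow (ih j hj) (fun _ => none) (by simp) (by simp)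
      fun b => hlt.trans (Nat.le_add_right _ _)
  by_contra hL
  have htwo : ∀ j ∈ J, TwoEdges j (terminals I s t) := by
    intro j hj
    by_contra hT
    rcases exists_straight_choice I s t j (fun b => ∃ i ∈ I, s i j ≠ b ∧ t i j ≠ b) with
      ⟨Q, hQ, hQ', hR⟩ | ⟨b, hb, hs⟩ | ⟨hb, i₀, hi₀⟩
    · refine hL (Linkage.of_straight hj hP hpow (ih j hj) Q hQ hQ' fun b => ?_)
      have : 1 ≤ ∑ i ∈ I, gain s t j Q b i := by
        obtain ⟨i, hi, hg⟩ : ∃ i ∈ I, 1 ≤ gain s t j Q b i := by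
          rcases hR b with ⟨i, hi, h⟩ | ⟨i, h⟩
          · exact ⟨i, hi, by rw [gain, if_pos h]; exact card_block_pos⟩
          · refine ⟨i, (hQ b i h).1, ?_⟩
            rw [gain]
            split_ifs
            exacts [card_block_pos, le_rfl]
        exact hg.trans (Finset.single_le_sum (f := gain s t j Q b) (fun _ _ => Nat.zero_le _) hi)
      omega
    -- No index misses side `b`. The terminal blocking a split index is off side `b`, hence belongs
    -- to another split index, blocked in turn: two parallel edges. Without split indices,
    -- everything lies on side `b`.
    · push Not at hb
      by_cases hsp : ∃ i ∈ I, s i j ≠ t i j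
      · obtain ⟨i, hi, hsi⟩ := hsp
        obtain ⟨l, hl, hli, hl'⟩ := IsStraight.not (hs i) hi hsi
        refine hT (twoEdges_of_not_isStraight hP hi hl (Ne.symm hli) hsi (fun hsl => ?_) (hs i)
          (hs l))
        have h1 : flipAt j (endAt j b s t i) j = !b := by rw [flipAt_same, endAt_apply hsi]
        have h2 : s l j = b := by
          by_contra h
          exact h (hsl.trans (hb l hl h))
        have h3 : t l j = b := hsl ▸ h2
        rcases mem_block.1 hl' with h | h <;> rw [h] at h1 <;> simp_all
      · push Not at hsp
        refine hL (Linkage.of_one_side hj hJ hP (ih j hj) hcard hp hq hpq hdp hdq b ?_)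
        intro z hz
        obtain ⟨i, hi, hzi⟩ := mem_terminals.1 hz
        have h1 := hsp i hi
        have h2 : s i j = b := by
          by_contra h
          exact h (h1.trans (hb i hi h))
        rcases mem_block.1 hzi with rfl | rfl
        exacts [h2, h1 ▸ h2]
    -- Every index is split and only `i₀` may be straight. The weight is at least 6, so there are at
    -- least three indices, two of them blocked.
    · have hsplit : ∀ i ∈ I, s i j ≠ t i j := by
        intro i hi h
        apply hb (!s i j)
        exact ⟨i, hi, by simp, by simp [h]⟩
      have hI : 2 < I.card := by
        have := hP.card_terminals
        have h2 : ∑ i ∈ I, (block s t i).card ≤ ∑ i ∈ I, 2 :=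
          Finset.sum_le_sum fun i _ => card_block_le
        rw [Finset.sum_const, smul_eq_mul] at h2
        omega
      obtain ⟨i, hi, l, hl, hil⟩ := (Finset.one_lt_card (s := I.erase i₀)).1 (by
        have := Finset.pred_card_le_card_erase (s := I) (a := i₀)
        omega)
      rw [Finset.mem_erase] at hi hl
      exact hT (twoEdges_of_not_isStraight hP hi.2 hl.2 hil (hsplit i hi.2) (hsplit l hl.2)
        (fun h => hi.1 (hi₀ true i h)) (fun h => hl.1 (hi₀ true l h)))
  obtain ⟨j, hj⟩ : J.Nonempty := Finset.card_pos.1 (by omega)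
  have := (htwo j hj).card hj fun i hi => by
    obtain ⟨x, hx, -, -, -, -, hx', -⟩ := htwo i hi
    exact ⟨x, hx, hx'⟩
  omega

/-- In a cube of dimension at least `4`, all linkage problems whose terminals and forbidden
vertices number at most the dimension plus one are solvable. -/
theorem cubeLinked (hJ : 4 ≤ J.card) : CubeLinked κ J (J.card + 1) := by
  obtain ⟨k, hk⟩ : ∃ k, J.card = k + 4 := ⟨J.card - 4, by omega⟩
  induction k generalizing J with
  | zero =>
    rw [hk]
    exact cubeLinked_four (by omega)
  | succ k ih =>
    refine cubeLinked_step (by omega) fun j hj => ?_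
    have h1 : (J.erase j).card = J.card - 1 := Finset.card_erase_of_mem hj
    have h2 := ih (J := J.erase j) (by omega) (by omega)
    rwa [h1, Nat.sub_add_cancel (by omega)] at h2

end Weighted

end CubeLink

namespace CubeLink

/-! ### Weight n + 2 with two antipodal forbidden vertices, n ≥ 6 -/

section Antipodal

set_option linter.unusedSectionVars false

variable {ι κ : Type*} [Fintype ι] [DecidableEq ι] [DecidableEq κ] {J : Finset ι} {c : ι → Bool}
  {I : Finset κ} {s t : κ → ι → Bool} {j : ι} {U : Set (ι → Bool)}

/-- The vertex `u` has its neighbour in direction `j` in `X`, and on its side of this direction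
there is at most one further element of `X`. -/
def Single (j : ι) (u : ι → Bool) (X : Finset (ι → Bool)) : Prop :=
  flipAt j u ∈ X ∧ ∃ y, ∀ z ∈ X, z j = u j → z = u ∨ z = y

/-- A pairing in the full cube with two antipodal forbidden vertices, all other indices being
proper pairs. -/
structure IsAntipodal (I : Finset κ) (s t : κ → ι → Bool) (p q : κ) : Prop where
  pairing : IsPairing Set.univ I s t
  left_mem : p ∈ I
  right_mem : q ∈ I
  left_eq : s p = t p
  right_eq : s q = t q
  opp : ∀ i, s q i = !s p i
  ne : ∀ i ∈ I, i ≠ p → i ≠ q → s i ≠ t i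
  card : (terminals I s t).card = Fintype.card ι + 2

variable {p q : κ}

theorem IsAntipodal.symm (h : IsAntipodal I s t p q) : IsAntipodal I s t q p where
  pairing := h.pairing
  left_mem := h.right_mem
  right_mem := h.left_mem
  left_eq := h.right_eq
  right_eq := h.left_eq
  opp i := by rw [h.opp, Bool.not_not]
  ne i hi h1 h2 := h.ne i hi h2 h1
  card := h.card

theorem subcube_univ (c : ι → Bool) : subcube Finset.univ c = Set.univ := by
  ext x; simp [subcube]

theorem mem_subcube_univ_erase {x y : ι → Bool} :
    y ∈ subcube (Finset.univ.erase j) x ↔ y j = x j := by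
  simp [subcube]

namespace IsAntipodal

/-- The two forbidden vertices weigh one each and the other indices at most two. The bound supplies
enough proper pairs in the arguments below. -/
theorem card_index (h : IsAntipodal I s t p q) : Fintype.card ι + 2 ≤ 2 * (I.card - 1) := by
  have hpq : p ≠ q := by
    rintro rfl
    obtain ⟨i⟩ : Nonempty ι := by
      by_contra hcon
      rw [not_nonempty_iff] at hcon
      have h1 := h.card
      have h2 := Finset.card_le_univ (terminals I s t)
      simp at h1 h2
      omega
    have := h.opp i
    simp at this
  have h1 := h.pairing.card_terminals
  rw [h.card, ← Finset.add_sum_erase _ _ h.left_mem,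
    ← Finset.add_sum_erase _ _ (Finset.mem_erase.2 ⟨hpq.symm, h.right_mem⟩)] at h1
  have h2 : ∑ i ∈ (I.erase p).erase q, (block s t i).card ≤ ∑ i ∈ (I.erase p).erase q, 2 :=
    Finset.sum_le_sum fun i _ => card_block_le
  rw [Finset.sum_const, smul_eq_mul, Finset.card_erase_of_mem
    (Finset.mem_erase.2 ⟨hpq.symm, h.right_mem⟩), Finset.card_erase_of_mem h.left_mem] at h2
  have h3 : (block s t p).card = 1 := by simp [block, h.left_eq]
  have h4 : (block s t q).card = 1 := by simp [block, h.right_eq]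
  have h5 : 1 < I.card := Finset.one_lt_card.2 ⟨p, h.left_mem, q, h.right_mem, hpq⟩
  omega

theorem mem_eq (h : IsAntipodal I s t p q) {i : κ} (hi : i ∈ I) (hd : s i = t i) :
    i = p ∨ i = q := by
  by_contra hcon
  push Not at hcon
  exact h.ne i hi hcon.1 hcon.2 hd

/-- Every direction separates antipodal vertices; hence each half misses one of them, a gain of one
that needs no choice. -/
theorem exists_index (h : IsAntipodal I s t p q) (j : ι) (b : Bool) :
    ∃ d ∈ I, (d = p ∨ d = q) ∧ s d = t d ∧ s d j = b := by
  by_cases hb : s p j = b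
  · exact ⟨p, h.left_mem, .inl rfl, h.left_eq, hb⟩
  · exact ⟨q, h.right_mem, .inr rfl, h.right_eq, by
      rw [h.opp]; cases h1 : s p j <;> cases h2 : b <;> simp_all⟩

/-- What a direction looks like that cannot be used to split a linkage problem. -/
theorem direction_cases (h : IsAntipodal I s t p q) (hn : 6 ≤ Fintype.card ι)
    (hL : ¬ Linkage Set.univ I s t) (j : ι) : TwoEdges j (terminals I s t) ∨
      Single j (s p) (terminals I s t) ∨ Single j (s q) (terminals I s t) ∨
      ∃ b, ∀ i ∈ I, s i ≠ t i → s i j = b ∧ t i j = b := by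
  by_contra hcon
  push Not at hcon
  obtain ⟨hT, hS, hS', hside⟩ := hcon
  have hP := h.pairing
  have hindex := h.card_index
  rcases exists_straight_choice I s t j
    (fun b => ∃ i ∈ I, s i ≠ t i ∧ s i j ≠ b ∧ t i j ≠ b) with
    ⟨Q, hQ, hQ', hR⟩ | ⟨b, hb, hs⟩ | ⟨hb, i₀, hi₀⟩
  · have hc := h.card
    rw [← subcube_univ (s p)] at hL hP
    refine hL (Linkage.of_straight (Finset.mem_univ j) hP ?_ ?_ Q hQ hQ' fun b => ?_)
    · rw [hc, Finset.card_univ]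
      obtain ⟨k, hk⟩ : ∃ k, Fintype.card ι = k + 6 := ⟨Fintype.card ι - 6, by omega⟩
      have := Nat.lt_two_pow_self (n := k)
      rw [hk, show k + 6 - 1 = k + 5 by omega, pow_add]
      omega
    · have h1 : (Finset.univ.erase j).card = Fintype.card ι - 1 :=
        Finset.card_erase_of_mem (Finset.mem_univ j)
      have h2 := cubeLinked (κ := κ) (J := Finset.univ.erase j) (by omega)
      rwa [h1, Nat.sub_add_cancel (by omega)] at h2
    -- Two units are needed on side `b`: a proper pair off that side gives both, while a straight
    -- crossing gives one and the forbidden vertex off that side the other.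
    · have : 2 ≤ ∑ i ∈ I, gain s t j Q b i := by
        rcases hR b with ⟨i, hi, hd, hg⟩ | ⟨i, hi⟩
        · have : gain s t j Q b i = 2 := by rw [gain, if_pos hg, card_block_of_ne hd]
          rw [← this]
          exact Finset.single_le_sum (f := gain s t j Q b) (fun _ _ => Nat.zero_le _) hi
        · obtain ⟨d, hd, -, hdeq, hdj⟩ := h.exists_index j (!b)
          have hstr := hQ b i hi
          have hdi : d ≠ i := by
            rintro rfl
            exact hstr.2.1 (congrFun hdeq j)
          have g1 : 1 ≤ gain s t j Q b d := by
            rw [gain, if_pos ⟨by simp [hdj], by simp [← hdeq, hdj]⟩]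
            exact card_block_pos
          have g2 : 1 ≤ gain s t j Q b i := by
            rw [gain]
            split_ifs
            exacts [card_block_pos, le_rfl]
          have : ∑ i ∈ {d, i}, gain s t j Q b i ≤ ∑ i ∈ I, gain s t j Q b i :=
            Finset.sum_le_sum_of_subset (by
              intro l hl
              simp only [Finset.mem_insert, Finset.mem_singleton] at hl
              rcases hl with rfl | rfl
              exacts [hd, hstr.1])
          rw [Finset.sum_pair hdi] at this
          omega
      rw [hc, Finset.card_univ]
      omega
  · push Not at hb
    obtain ⟨i, hi, hd, hnot⟩ := hside b
    have hsi : s i j ≠ t i j := by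
      intro he
      by_cases hib : s i j = b
      · exact hnot hib (he ▸ hib)
      · exact hib (he.trans (hb i hi hd hib))
    obtain ⟨l, hl, hli, hl'⟩ := IsStraight.not (hs i) hi hsi
    -- A second split index would be blocked too and give parallel edges. Unsplit proper pairs lie
    -- on side `b`, so the blocking vertex is a forbidden one, and off side `b` only it and the far
    -- end of `i` remain: the shape `Single`.
    have honly : ∀ l ∈ I, l ≠ i → s l j = t l j := by
      intro l hl hli
      by_contra hsl
      exact hT (twoEdges_of_not_isStraight hP hi hl (Ne.symm hli) hsi hsl (hs i) (hs l))
    have hlj : flipAt j (endAt j b s t i) j = !b := by rw [flipAt_same, endAt_apply hsi]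
    have hldeg : s l = t l := by
      by_contra hd'
      have h1 := honly l hl hli
      have h2 : s l j = b := by
        by_contra h
        exact h (h1.trans (hb l hl hd' h))
      rcases mem_block.1 hl' with h | h <;> rw [h] at hlj <;> simp_all
    have hls : flipAt j (endAt j b s t i) = s l := by
      rcases mem_block.1 hl' with h | h
      exacts [h, h.trans hldeg.symm]
    have hsingle : Single j (s l) (terminals I s t) := by
      refine ⟨?_, endAt j (!b) s t i, ?_⟩
      · rw [← hls, flipAt_flipAt]
        exact mem_terminals.2 ⟨i, hi, endAt_mem_block⟩
      · intro z hz hzj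
        rw [← hls, hlj] at hzj
        obtain ⟨m, hm, hzm⟩ := mem_terminals.1 hz
        by_cases hmi : m = i
        · subst hmi
          right
          rw [endAt]
          rcases mem_block.1 hzm with rfl | rfl
          · rw [if_pos hzj]
          · rw [if_neg fun h => hsi (h.trans hzj.symm)]
        · have hmd : s m = t m := by
            by_contra hd'
            have h1 := honly m hm hmi
            have h2 : s m j = b := by
              by_contra h
              exact h (h1.trans (hb m hm hd' h))
            have h3 : t m j = b := h1 ▸ h2
            rcases mem_block.1 hzm with h | h <;> rw [h] at hzj <;> simp [h2, h3] at hzj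
          have hzs : z = s m := by
            rcases mem_block.1 hzm with h | h
            exacts [h, h.trans hmd.symm]
          left
          have e1 : s m j = s l j := by rw [← hzs, hzj, ← hls, hlj]
          rw [hzs]
          rcases h.mem_eq hm hmd with rfl | rfl <;> rcases h.mem_eq hl hldeg with rfl | rfl
          · rfl
          · rw [h.opp] at e1; simp at e1
          · rw [h.opp] at e1; simp at e1
          · rfl
    rcases h.mem_eq hl hldeg with rfl | rfl
    exacts [hS hsingle, hS' hsingle]
  · have hsplit : ∀ i ∈ I, s i ≠ t i → s i j ≠ t i j := by
      intro i hi hd h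
      exact hb (!s i j) ⟨i, hi, hd, by simp, by simp [h]⟩
    obtain ⟨i, hi, l, hl, hil⟩ := (Finset.one_lt_card (s := ((I.erase p).erase q).erase i₀)).1 (by
      have h1 := Finset.pred_card_le_card_erase (s := I) (a := p)
      have h2 := Finset.pred_card_le_card_erase (s := I.erase p) (a := q)
      have h3 := Finset.pred_card_le_card_erase (s := (I.erase p).erase q) (a := i₀)
      omega)
    simp only [Finset.mem_erase] at hi hl
    exact hT (twoEdges_of_not_isStraight hP hi.2.2.2 hl.2.2.2 hil
      (hsplit i hi.2.2.2 (h.ne i hi.2.2.2 hi.2.2.1 hi.2.1))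
      (hsplit l hl.2.2.2 (h.ne l hl.2.2.2 hl.2.2.1 hl.2.1))
      (fun h => hi.1 (hi₀ true i h)) (fun h => hl.1 (hi₀ true l h)))

theorem exists_dir (hn : 6 ≤ Fintype.card ι) (a b c d : ι) :
    ∃ m : ι, m ≠ a ∧ m ≠ b ∧ m ≠ c ∧ m ≠ d := by
  by_contra hcon
  push Not at hcon
  have h1 : (Finset.univ : Finset ι) ⊆ {a, b, c, d} := by
    intro m _
    simp only [Finset.mem_insert, Finset.mem_singleton]
    by_contra h
    push Not at h
    exact h.2.2.2 (hcon m h.1 h.2.1 h.2.2.1)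
  have h2 := Finset.card_le_card h1
  have h3 : ({a, b, c, d} : Finset ι).card ≤ 4 := Finset.card_le_four
  rw [Finset.card_univ] at h2
  omega

/-- There is a linkage if a direction has all proper pairs on the side of `s p`. -/
theorem linkage_of_side (h : IsAntipodal I s t p q) (hn : 6 ≤ Fintype.card ι) (j : ι)
    (hb : ∀ i ∈ I, s i ≠ t i → s i j = s p j ∧ t i j = s p j) : Linkage Set.univ I s t := by
  by_contra hL
  have hP := h.pairing
  have hindex := h.card_index
  set X := terminals I s t with hX
  set u := s p with hu
  set u' := s q with hu'
  have hT : ∀ i ∈ I, ∀ z ∈ block s t i, z ∈ X := fun i hi z hz => mem_terminals.2 ⟨i, hi, hz⟩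
  have huX : u ∈ X := hT p h.left_mem _ left_mem_block
  have hu'X : u' ∈ X := hT q h.right_mem _ left_mem_block
  have hXside : ∀ z ∈ X, z ≠ u' → z j = u j := by
    intro z hz hzu
    obtain ⟨i, hi, hzi⟩ := mem_terminals.1 hz
    by_cases hd : s i = t i
    · have hzs : z = s i := by
        rcases mem_block.1 hzi with h | h
        exacts [h, h.trans hd.symm]
      rcases h.mem_eq hi hd with rfl | rfl
      · rw [hzs]
      · exact absurd hzs hzu
    · rcases mem_block.1 hzi with rfl | rfl
      exacts [(hb i hi hd).1, (hb i hi hd).2]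
  have hu'j : u' j ≠ u j := by rw [hu', hu, h.opp]; simp
  have hcardX : (X.erase u').card = Fintype.card ι + 1 := by
    rw [Finset.card_erase_of_mem hu'X, h.card]; rfl
  have hcardJ : (Finset.univ.erase j).card = Fintype.card ι - 1 :=
    Finset.card_erase_of_mem (Finset.mem_univ j)
  have hflip : ∀ z ∈ X, z ≠ u' → flipAt j z ∈ X → z = flipAt j u' := by
    intro z hz hzu hzX
    by_cases he : flipAt j z = u'
    · rw [← he, flipAt_flipAt]
    · have h1 := hXside _ hzX he
      rw [flipAt_same, hXside z hz hzu] at h1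
      simp at h1
  -- it suffices to join one pair, on its side
  have up : ∀ i₀ ∈ I, s i₀ ≠ t i₀ → (∀ i ∈ I, i ≠ i₀ → flipAt j u' ∉ block s t i) →
      ConnIn (subcube (Finset.univ.erase j) (s i₀) \ ↑(X.erase u' \ block s t i₀)) (s i₀) (t i₀) →
      False := by
    intro i₀ hi₀ hd hfl hconn
    rw [← subcube_univ u] at hL hP
    refine hL (Linkage.of_up (Finset.mem_univ j) hP ?_ ?_ i₀ hi₀ hd (hconn.mono ?_) ?_)
    · have h2 := cubeLinked (κ := κ) (J := Finset.univ.erase j) (by omega)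
      rwa [hcardJ, Nat.sub_add_cancel (by omega)] at h2
    · rw [h.card, Finset.card_univ]
    · rintro z ⟨hz, hz'⟩
      refine ⟨hz, fun hzX => hz' ?_⟩
      rw [Finset.mem_coe, Finset.mem_sdiff] at hzX ⊢
      refine ⟨Finset.mem_erase.2 ⟨?_, hzX.1⟩, hzX.2⟩
      rintro rfl
      rw [mem_subcube_univ_erase, (hb i₀ hi₀ hd).1] at hz
      exact hu'j hz
    · intro i hi hii₀
      by_cases hdi : s i = t i
      · exact .inl hdi
      · right
        intro z hz
        have hzj : z j = u j := by
          rcases mem_block.1 hz with rfl | rfl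
          exacts [(hb i hi hdi).1, (hb i hi hdi).2]
        refine ⟨hzj.trans (hb i₀ hi₀ hd).1.symm, fun hzX => hfl i hi hii₀ ?_⟩
        rw [← hflip z (hT i hi z hz) (fun h => hu'j (h ▸ hzj)) hzX]
        exact hz
  have notu' : ∀ i ∈ I, s i ≠ t i → ∀ z ∈ block s t i, z ∈ X.erase u' := by
    intro i hi hd z hz
    refine Finset.mem_erase.2 ⟨?_, hT i hi z hz⟩
    rintro rfl
    have := hP.eq i hi q h.right_mem _ hz left_mem_block
    subst this
    exact hd h.right_eq
  have hmem : ∀ i ∈ I, s i ≠ t i → t i ∈ subcube (Finset.univ.erase j) (s i) := by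
    intro i hi hd
    rw [mem_subcube_univ_erase, (hb i hi hd).1, (hb i hi hd).2]
  by_cases hw : flipAt j u' ∈ X
  swap
  -- No terminal on the side of `s p` has a terminal across, so one of any two proper pairs can be
  -- joined in this half while the others go through the opposite one.
  · obtain ⟨a, ha, b, hb', hab⟩ := (Finset.one_lt_card (s := (I.erase p).erase q)).1 (by
      have h1 := Finset.pred_card_le_card_erase (s := I) (a := p)
      have h2 := Finset.pred_card_le_card_erase (s := I.erase p) (a := q)
      omega)
    simp only [Finset.mem_erase] at ha hb'
    have hda := h.ne a ha.2.2 ha.2.1 ha.1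
    have hdb := h.ne b hb'.2.2 hb'.2.1 hb'.1
    rcases connIn_or_connIn (Finset.univ.erase j) (by omega) (X.erase u') (by omega) (s a) (t a)
      (s b) (t b) (notu' a ha.2.2 hda _ left_mem_block) (notu' a ha.2.2 hda _ right_mem_block)
      (notu' b hb'.2.2 hdb _ left_mem_block) (notu' b hb'.2.2 hdb _ right_mem_block) hda hdb
      (fun z hz hz' => hab (hP.eq a ha.2.2 b hb'.2.2 z hz' hz))
      (hmem a ha.2.2 hda) (hmem b hb'.2.2 hdb) with hc | hc
    · exact up a ha.2.2 hda (fun i hi _ hf => hw (hT i hi _ hf)) hc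
    · exact up b hb'.2.2 hdb (fun i hi _ hf => hw (hT i hi _ hf)) hc
  -- the neighbour `w₀` of `u'` is a terminal
  set w₀ := flipAt j u' with hw₀
  have hw₀i : ∀ i, i ≠ j → w₀ i = !u i := fun i hij => by rw [hw₀, flipAt_ne hij, hu', h.opp]
  obtain ⟨i₀, hi₀, hwi₀⟩ := mem_terminals.1 hw
  have hd₀ : s i₀ ≠ t i₀ := by
    intro hd
    have hws : w₀ = s i₀ := by
      rcases mem_block.1 hwi₀ with h | h
      exacts [h, h.trans hd.symm]
    rcases h.mem_eq hi₀ hd with rfl | rfl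
    · obtain ⟨m, hm, -⟩ := exists_dir hn j j j j
      have := hw₀i m hm
      rw [hws] at this
      simp [← hu] at this
    · exact flipAt_ne_self j u' hws
  -- Only `w₀` is blocked by the terminal `u'` across, so its pair is the one to join in the half.
  -- Failure means that one of its ends `e` has all its neighbours there occupied by other
  -- terminals.
  have hfree : ∃ e ∈ block s t i₀, ∀ r ∈ Finset.univ.erase j,
      flipAt r e ∈ X.erase u' \ block s t i₀ := by
    by_contra hcon
    push Not at hcon
    refine up i₀ hi₀ hd₀ (fun i hi hii hf => hii (hP.eq i hi i₀ hi₀ _ hf hwi₀)) ?_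
    refine connIn_subcube_diff_of_free _ (by omega) _ ?_ _ _ (hmem i₀ hi₀ hd₀)
      (by simp [left_mem_block]) (by simp [right_mem_block]) (hcon _ left_mem_block)
      (hcon _ right_mem_block)
    rw [Finset.card_sdiff_of_subset (notu' i₀ hi₀ hd₀), card_block_of_ne hd₀]
    omega
  obtain ⟨e, he, hall⟩ := hfree
  -- Both sides have n - 1 elements, so the terminals besides `u'`, `e` and `w₀` are exactly the
  -- neighbours of `e` in this half, `u` among them.
  have himg : (Finset.univ.erase j).image (fun i => flipAt i e) = X.erase u' \ block s t i₀ := by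
    refine Finset.eq_of_subset_of_card_le ?_ ?_
    · intro z hz
      obtain ⟨i, hi, rfl⟩ := Finset.mem_image.1 hz
      exact hall i hi
    · rw [Finset.card_image_of_injective _ (flipAt_dir_injective e),
        Finset.card_sdiff_of_subset (notu' i₀ hi₀ hd₀), card_block_of_ne hd₀]
      omega
  have hnbr : ∀ z ∈ X, z ≠ u' → z ∉ block s t i₀ → ∃ r, r ≠ j ∧ z = flipAt r e := by
    intro z hz hzu hzb
    have : z ∈ (Finset.univ.erase j).image (fun i => flipAt i e) := by
      rw [himg]; exact Finset.mem_sdiff.2 ⟨Finset.mem_erase.2 ⟨hzu, hz⟩, hzb⟩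
    obtain ⟨r, hr, rfl⟩ := Finset.mem_image.1 this
    exact ⟨r, Finset.ne_of_mem_erase hr, rfl⟩
  have hub : u ∉ block s t i₀ := fun hub => by
    have := hP.eq i₀ hi₀ p h.left_mem u hub left_mem_block
    subst this
    exact hd₀ h.left_eq
  obtain ⟨r₀, hr₀, hur₀⟩ := hnbr u huX (fun h => hu'j (h ▸ rfl)) hub
  have heu : ∀ i, i ≠ r₀ → e i = u i := fun i hi => by rw [hur₀, flipAt_ne hi]
  have hew : e ≠ w₀ := by
    intro hew
    obtain ⟨m, h1, h2, -⟩ := exists_dir hn j r₀ r₀ r₀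
    have := hw₀i m h1
    rw [← hew, heu m h2] at this
    simp at this
  have hblk : ∀ z ∈ block s t i₀, z = e ∨ z = w₀ := by
    intro z hz
    rw [mem_block] at hz he hwi₀
    rcases he with he | he <;> rcases hwi₀ with hw' | hw'
    · exact absurd (he.trans hw'.symm) hew
    · rw [he, hw']; exact hz
    · rw [he, hw']; exact hz.symm
    · exact absurd (he.trans hw'.symm) hew
  -- a direction in which `e` is adjacent to another terminal
  obtain ⟨a, ha⟩ : (((I.erase p).erase q).erase i₀).Nonempty := by
    rw [← Finset.card_pos]
    have h1 := Finset.pred_card_le_card_erase (s := I) (a := p)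
    have h2 := Finset.pred_card_le_card_erase (s := I.erase p) (a := q)
    have h3 := Finset.pred_card_le_card_erase (s := (I.erase p).erase q) (a := i₀)
    omega
  simp only [Finset.mem_erase] at ha
  have hda := h.ne a ha.2.2.2 ha.2.2.1 ha.2.1
  have hanbr : ∀ z ∈ block s t a, ∃ r, r ≠ j ∧ z = flipAt r e := fun z hz =>
    hnbr z (hT a ha.2.2.2 z hz) (Finset.ne_of_mem_erase (notu' a ha.2.2.2 hda z hz))
      fun h' => ha.1 (hP.eq a ha.2.2.2 i₀ hi₀ z hz h')
  obtain ⟨i, hij, hi⟩ := hanbr _ left_mem_block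
  obtain ⟨i', hij', hi'⟩ := hanbr _ right_mem_block
  have hii' : i ≠ i' := fun h' => hda (by rw [hi, hi', h'])
  have hir₀ : i ≠ r₀ := by
    intro h'
    have : s a = s p := by rw [hi, h', ← hur₀]
    exact ha.2.2.1 (hP.eq a ha.2.2.2 p h.left_mem (s a) left_mem_block
      (this ▸ left_mem_block))
  have hwe : ∀ r, r ≠ j → w₀ ≠ flipAt r e := by
    intro r hr h'
    have := hall r (Finset.mem_erase.2 ⟨hr, Finset.mem_univ r⟩)
    rw [← h'] at this
    exact (Finset.mem_sdiff.1 this).2 hwi₀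
  -- The terminal set is now so rigid that the direction `i`, leading from `e` to an end of another
  -- pair, fits none of the possible shapes.
  rcases h.direction_cases hn hL i with h2 | h2 | h2 | ⟨b, h2⟩
  · -- the only edge in direction `i` is at `e`
    have key : ∀ x ∈ X, flipAt i x ∈ X → x i ≠ e i → x = flipAt i e := by
      intro x hx hx' hxi
      by_cases h1 : x = u'
      · subst h1
        have : flipAt i u' j = u j := hXside _ hx' (flipAt_ne_self i u')
        rw [flipAt_ne hij.symm] at this
        exact absurd this hu'j
      by_cases hxb : x ∈ block s t i₀
      · rcases hblk x hxb with rfl | h1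
        · exact absurd rfl hxi
        exfalso
        rw [h1] at hx'
        have h3 : flipAt i w₀ ≠ u' := by
          rw [hw₀]
          intro h'
          have := congrFun h' i
          rw [flipAt_same, flipAt_ne hij] at this
          simp at this
        by_cases h4 : flipAt i w₀ ∈ block s t i₀
        · rcases hblk _ h4 with h5 | h5
          · exact hwe i hij (by rw [← h5, flipAt_flipAt])
          · exact flipAt_ne_self i w₀ h5
        · obtain ⟨r, hr, h5⟩ := hnbr _ hx' h3 h4
          obtain ⟨m, m1, m2, m3, m4⟩ := exists_dir hn j i r r₀
          have := congrFun h5 m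
          rw [flipAt_ne m2, flipAt_ne m3, hw₀i m m1, heu m m4] at this
          simp at this
      · obtain ⟨r, hr, rfl⟩ := hnbr x hx h1 hxb
        by_cases hri : i = r
        · rw [hri]
        · exact absurd (flipAt_ne hri e) hxi
    obtain ⟨x, hx, y, hy, hxy, hxyi, hx', hy'⟩ := h2
    by_cases hxe : x i = e i
    · have k1 := key (flipAt i x) hx' (by rwa [flipAt_flipAt]) (by simp [hxe])
      have k2 := key (flipAt i y) hy' (by rwa [flipAt_flipAt]) (by simp [← hxyi, hxe])
      exact hxy (flipAt_injective i (k1.trans k2.symm))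
    · exact hxy ((key x hx hx' hxe).trans (key y hy hy' (hxyi ▸ hxe)).symm)
  -- On the side of `u` lie both `e` and a further neighbour of `e`: one terminal too many.
  · obtain ⟨-, y, hy⟩ := h2
    obtain ⟨m, m1, m2, m3, -⟩ := exists_dir hn i j r₀ r₀
    have eX : e ∈ X := hT i₀ hi₀ e he
    have mX : flipAt m e ∈ X := Finset.mem_of_mem_erase (Finset.mem_sdiff.1
      (hall m (Finset.mem_erase.2 ⟨m2, Finset.mem_univ m⟩))).1
    have h3 : e = y := (hy e eX (heu i hir₀)).resolve_left fun h' => hub (by rw [hu, ← h']; exact he)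
    have h4 : flipAt m e = y := by
      refine (hy _ mX (by rw [flipAt_ne m1.symm, heu i hir₀])).resolve_left fun h' => m3 ?_
      exact flipAt_dir_injective e (h'.trans hur₀)
    exact flipAt_ne_self m e (h4.trans h3.symm)
  -- On the side of `u'` lie both `w₀` and `flipAt i e`: again one too many.
  · obtain ⟨-, y, hy⟩ := h2
    have haX : flipAt i e ∈ X := hi ▸ hT a ha.2.2.2 _ left_mem_block
    have hau' : flipAt i e ≠ u' := by
      rw [← hi]
      exact Finset.ne_of_mem_erase (notu' a ha.2.2.2 hda _ left_mem_block)
    have h3 : w₀ = y := (hy w₀ hw (by rw [hw₀, flipAt_ne hij])).resolve_left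
      (flipAt_ne_self j u')
    have h4 : flipAt i e = y := (hy _ haX (by
      rw [flipAt_same, heu i hir₀, h.opp])).resolve_left hau'
    exact hwe i hij (h3.trans h4.symm)
  -- Direction `i` splits the pair `a`, whose ends are neighbours of `e` in different directions.
  · obtain ⟨h3, h4⟩ := h2 a ha.2.2.2 hda
    rw [hi, flipAt_same] at h3
    rw [hi', flipAt_ne hii'] at h4
    rw [h4] at h3
    simp at h3

/-- For one such direction, the neighbours of `u` in all the others are terminals on its side, where
only one besides `u` is allowed. -/
theorem card_single_le {X : Finset (ι → Bool)} {u : ι → Bool} (F : Finset ι)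
    (hF : ∀ j ∈ F, Single j u X) : F.card ≤ 2 := by
  by_contra hcon
  obtain ⟨a, ha, b, hb, c, hc, hab, hac, hbc⟩ := Finset.two_lt_card.1 (not_le.1 hcon)
  obtain ⟨-, y, hy⟩ := hF a ha
  have h1 := (hy _ (hF b hb).1 (flipAt_ne hab u)).resolve_left (flipAt_ne_self b u)
  have h2 := (hy _ (hF c hc).1 (flipAt_ne hac u)).resolve_left (flipAt_ne_self c u)
  exact hbc (flipAt_dir_injective u (h1.trans h2.symm))

/-- In a cube of dimension `2k ≥ 6` all linkage problems with `k` pairs and two antipodal forbidden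
vertices are solvable. -/
theorem linkage (h : IsAntipodal I s t p q) (hn : 6 ≤ Fintype.card ι) :
    Linkage Set.univ I s t := by
  classical
  by_contra hL
  set X := terminals I s t with hX
  set u := s p with hu
  set u' := s q with hu'
  have hcard : X.card = Fintype.card ι + 2 := h.card
  have hdir : ∀ j, TwoEdges j X ∨ Single j u X ∨ Single j u' X := by
    intro j
    rcases h.direction_cases hn hL j with h1 | h1 | h1 | ⟨b, hb⟩
    · exact .inl h1
    · exact .inr (.inl h1)
    · exact .inr (.inr h1)
    · exfalso
      by_cases hbp : s p j = b
      · subst hbp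
        exact hL (h.linkage_of_side hn j hb)
      · have : s q j = b := by
          rw [h.opp]; cases h1 : s p j <;> cases h2 : b <;> simp_all
        subst this
        exact hL (h.symm.linkage_of_side hn j hb)
  have huX : u ∈ X := mem_terminals.2 ⟨p, h.left_mem, left_mem_block⟩
  have hu'X : u' ∈ X := mem_terminals.2 ⟨q, h.right_mem, left_mem_block⟩
  have hopp : ∀ i, u' i ≠ u i := fun i => by rw [hu', hu, h.opp]; simp
  have hedge : ∀ i ∈ (Finset.univ : Finset ι), ∃ x ∈ X, flipAt i x ∈ X := by
    intro i _
    rcases hdir i with ⟨x, hx, -, -, -, -, hx', -⟩ | h1 | h1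
    · exact ⟨x, hx, hx'⟩
    · exact ⟨u, huX, h1.1⟩
    · exact ⟨u', hu'X, h1.1⟩
  set F := Finset.univ.filter fun j => TwoEdges j X with hF
  set G := Finset.univ.filter fun j => Single j u X with hG
  set G' := Finset.univ.filter fun j => Single j u' X with hG'
  have mF : ∀ j, j ∈ F ↔ TwoEdges j X := fun j => by simp [hF]
  have mG : ∀ j, j ∈ G ↔ Single j u X := fun j => by simp [hG]
  have mG' : ∀ j, j ∈ G' ↔ Single j u' X := fun j => by simp [hG']
  have square : ∀ a k, a ≠ k → TwoEdges a X → ∀ z ∈ X, ∀ w ∈ X, z ≠ w → z k = w k →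
      flipAt k z ∈ X → flipAt k w ∈ X → w = flipAt a z := fun a k hak ha z hz w hw hzw hk hz' hw' =>
    TwoEdges.eq_flipAt (Finset.mem_univ a) (Finset.mem_univ k) hak ha hedge
      (by rw [Finset.card_univ, hcard]) hz hw hzw hk hz' hw'
  -- By `square`, the offset between two edges of one direction is every other direction in `F`, so
  -- there is at most one other.
  have cF : F.card ≤ 2 := by
    by_contra hcon
    obtain ⟨a, ha, b, hb, c, hc, hab, hac, hbc⟩ := Finset.two_lt_card.1 (not_le.1 hcon)
    rw [mF] at ha hb hc
    obtain ⟨z, hz, w, hw, hzw, hk, hz', hw'⟩ := hb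
    have h1 := square a b hab ha z hz w hw hzw hk hz' hw'
    have h2 := square c b hbc.symm hc z hz w hw hzw hk hz' hw'
    exact hac (flipAt_dir_injective z (h1.symm.trans h2))
  have cG : G.card ≤ 2 := card_single_le G fun j hj => (mG j).1 hj
  have cG' : G'.card ≤ 2 := card_single_le G' fun j hj => (mG' j).1 hj
  have hcover : (Finset.univ : Finset ι) ⊆ F ∪ (G ∪ G') := by
    intro j _
    simp only [Finset.mem_union, mF, mG, mG']
    exact hdir j
  have h1 := Finset.card_le_card hcover
  rw [Finset.card_univ] at h1
  have h2 := Finset.card_union_add_card_inter F (G ∪ G')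
  have h3 := Finset.card_union_add_card_inter G G'
  -- Since the three sets cover at least six directions and have at most two elements each, all
  -- bounds are equalities and the sets are disjoint.
  have e1 : F ∩ (G ∪ G') = ∅ := by rw [← Finset.card_eq_zero]; omega
  have e2 : F.card = 2 := by omega
  have e3 : G.card = 2 := by omega
  have e4 : G'.card = 2 := by omega
  have e5 : Fintype.card ι = 6 := by omega
  obtain ⟨a, k, hak, hFak⟩ := Finset.card_eq_two.1 e2
  obtain ⟨d, d', hdd, hGd⟩ := Finset.card_eq_two.1 e3
  obtain ⟨f, f', hff, hGf⟩ := Finset.card_eq_two.1 e4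
  have hFG : ∀ i ∈ F, ∀ l ∈ G ∪ G', l ≠ i := by
    rintro i hi l hl rfl
    have : l ∈ F ∩ (G ∪ G') := Finset.mem_inter.2 ⟨hi, hl⟩
    rw [e1] at this
    simp at this
  have haF : a ∈ F := by simp [hFak]
  have hkF : k ∈ F := by simp [hFak]
  obtain ⟨z, hz, w, hw, hzw, hk, hz', hw'⟩ := (mF k).1 hkF
  obtain rfl := square a k hak ((mF a).1 haF) z hz w hw hzw hk hz' hw'
  -- the square lies opposite to `u` in the directions of `G`, to `u'` in those of `G'`
  have hopposite : ∀ v j, j ≠ a → j ≠ k → Single j v X → z j ≠ v j := by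
    rintro v j hja hjk ⟨-, y, hy⟩ hzj
    have c1 := hy z hz hzj
    have c2 := hy _ hw (by rw [flipAt_ne hja, hzj])
    have c3 := hy _ hz' (by rw [flipAt_ne hjk, hzj])
    have n1 := flipAt_ne_self a z
    have n2 := flipAt_ne_self k z
    have n3 : flipAt a z ≠ flipAt k z := fun h' => hak (flipAt_dir_injective z h')
    rcases c1 with c1 | c1 <;> rcases c2 with c2 | c2 <;> rcases c3 with c3 | c3 <;>
      first
      | exact n1 (c2.trans c1.symm)
      | exact n2 (c3.trans c1.symm)
      | exact n3 (c2.trans c3.symm)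
  -- In both directions `d`, `d'` the square is opposite to `v`, whereas each point of the triple at
  -- `v` agrees with `v` in at least one of them. Agreement in direction `a` will separate the
  -- triples at `u` and `u'`.
  have hsq : ∀ v d d', d ≠ d' → (∀ l ∈ ({d, d'} : Finset ι), Single l v X ∧ l ≠ a ∧ l ≠ k) →
      ∀ x ∈ ({v, flipAt d v, flipAt d' v} : Finset (ι → Bool)),
      x ∈ X ∧ x a = v a ∧ x ∉ ({z, flipAt a z, flipAt k z} : Finset (ι → Bool)) ∨ v ∉ X := by
    intro v d d' hdd hl x hx
    by_cases hv : v ∈ X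
    swap
    · exact .inr hv
    left
    obtain ⟨s1, s2, s3⟩ := hl d (by simp)
    obtain ⟨s1', s2', s3'⟩ := hl d' (by simp)
    have o := hopposite v d s2 s3 s1
    have o' := hopposite v d' s2' s3' s1'
    have hzz : ∀ y ∈ ({z, flipAt a z, flipAt k z} : Finset (ι → Bool)), y d = z d ∧ y d' = z d' := by
      intro y hy
      simp only [Finset.mem_insert, Finset.mem_singleton] at hy
      rcases hy with rfl | rfl | rfl
      · exact ⟨rfl, rfl⟩
      · exact ⟨flipAt_ne s2 z, flipAt_ne s2' z⟩
      · exact ⟨flipAt_ne s3 z, flipAt_ne s3' z⟩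
    simp only [Finset.mem_insert, Finset.mem_singleton] at hx
    rcases hx with rfl | rfl | rfl
    · exact ⟨hv, rfl, fun hy => o (hzz _ hy).1.symm⟩
    · exact ⟨s1.1, flipAt_ne s2.symm v, fun hy => o' ((hzz _ hy).2.symm.trans
        (flipAt_ne hdd.symm v))⟩
    · exact ⟨s1'.1, flipAt_ne s2'.symm v, fun hy => o ((hzz _ hy).1.symm.trans
        (flipAt_ne hdd v))⟩
  have hthree : ∀ (v : ι → Bool) (d d' : ι), d ≠ d' →
      ({v, flipAt d v, flipAt d' v} : Finset (ι → Bool)).card = 3 := fun v d d' hdd =>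
    Finset.card_eq_three.2 ⟨_, _, _, (flipAt_ne_self d v).symm, (flipAt_ne_self d' v).symm,
      fun h' => hdd (flipAt_dir_injective v h'), rfl⟩
  have q1 := hsq u d d' hdd fun l hl => by
    rw [← hGd] at hl
    have := Finset.mem_union_left G' hl
    exact ⟨(mG l).1 hl, hFG a haF l this, hFG k hkF l this⟩
  have q2 := hsq u' f f' hff fun l hl => by
    rw [← hGf] at hl
    have := Finset.mem_union_right G hl
    exact ⟨(mG' l).1 hl, hFG a haF l this, hFG k hkF l this⟩
  have q1' := fun x hx => (q1 x hx).resolve_right (not_not.2 huX)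
  have q2' := fun x hx => (q2 x hx).resolve_right (not_not.2 hu'X)
  have d1 : Disjoint ({u, flipAt d u, flipAt d' u} : Finset (ι → Bool))
      {u', flipAt f u', flipAt f' u'} := Finset.disjoint_left.2 fun x hx hx' =>
    hopp a ((q2' x hx').2.1.symm.trans (q1' x hx).2.1)
  have d2 : Disjoint (({u, flipAt d u, flipAt d' u} : Finset (ι → Bool)) ∪
      {u', flipAt f u', flipAt f' u'}) {z, flipAt a z, flipAt k z} :=
    Finset.disjoint_left.2 fun x hx hx' => by
      rcases Finset.mem_union.1 hx with hx | hx
      exacts [(q1' x hx).2.2 hx', (q2' x hx).2.2 hx']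
  have hsub : (({u, flipAt d u, flipAt d' u} : Finset (ι → Bool)) ∪
      {u', flipAt f u', flipAt f' u'}) ∪ {z, flipAt a z, flipAt k z} ⊆ X := by
    intro x hx
    rcases Finset.mem_union.1 hx with hx | hx
    · rcases Finset.mem_union.1 hx with hx | hx
      exacts [(q1' x hx).1, (q2' x hx).1]
    · simp only [Finset.mem_insert, Finset.mem_singleton] at hx
      rcases hx with rfl | rfl | rfl
      exacts [hz, hw, hz']
  -- Three disjoint triples make nine terminals, but in dimension 6 there are only eight.
  have := Finset.card_le_card hsub
  rw [Finset.card_union_of_disjoint d2, Finset.card_union_of_disjoint d1, hthree u d d' hdd,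
    hthree u' f f' hff, hthree z a k hak] at this
  omega

end IsAntipodal

end Antipodal

end CubeLink

namespace CubeLink

set_option linter.unusedSectionVars false

/-! ### From linkages to paths, and distances in the hypercube -/

section CubeGraph

/-- Linkedness is invariant under isomorphism. -/
theorem IsLinked.of_iso {V W : Type*} {G : SimpleGraph V} {H : SimpleGraph W} (e : G ≃g H) {k : ℕ}
    (h : IsLinked G k) : IsLinked H k := by
  refine ⟨h.1.trans (ENat.card_congr e.toEquiv).le, fun s t hst => ?_⟩
  obtain ⟨s, rfl⟩ : ∃ s', s = fun i => e (s' i) := ⟨fun i => e.symm (s i), by simp⟩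
  obtain ⟨t, rfl⟩ : ∃ t', t = fun i => e (t' i) := ⟨fun i => e.symm (t i), by simp⟩
  obtain ⟨L, hL⟩ := h.2 s t (by
    refine Function.Injective.of_comp (f := e) ?_
    convert hst using 1
    ext i
    cases i <;> rfl)
  refine ⟨fun i => (L i).map e.toHom e.injective, fun i l hil z hz hz' => ?_⟩
  simp only [SimpleGraph.Path.map_coe, SimpleGraph.Walk.support_map, List.mem_map] at hz hz'
  obtain ⟨x, hx, rfl⟩ := hz
  obtain ⟨y, hy, hxy⟩ := hz'
  obtain rfl : y = x := e.injective hxy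
  exact hL hil hx hy

variable {ι : Type*} [Fintype ι] [DecidableEq ι]

/-- The graph of the hypercube. -/
def cubeGraph (ι : Type*) [DecidableEq ι] : SimpleGraph (ι → Bool) where
  Adj x y := ∃ j, y = flipAt j x
  symm := ⟨fun x y ⟨j, h⟩ => ⟨j, by rw [h, flipAt_flipAt]⟩⟩
  loopless := ⟨fun x ⟨j, h⟩ => flipAt_ne_self j x h.symm⟩

theorem exists_walk_of_connIn {S C : Set (ι → Bool)} (hCS : C ⊆ S) {x y : ι → Bool}
    (h : ConnIn C x y) (hx : x ∈ S) (hy : y ∈ S) :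
    ∃ p : ((cubeGraph ι).induce S).Walk ⟨x, hx⟩ ⟨y, hy⟩, ∀ z ∈ p.support, z.1 ∈ C := by
  obtain ⟨hxC, h⟩ := h
  induction h with
  | refl => exact ⟨.nil, by simpa using hxC⟩
  | @tail b c hb hbc ih =>
    obtain ⟨hcC, j, rfl⟩ := hbc
    have hbC : b ∈ C := ConnIn.right ⟨hxC, hb⟩
    obtain ⟨p, hp⟩ := ih (hCS hbC)
    refine ⟨p.concat (show ((cubeGraph ι).induce S).Adj ⟨b, hCS hbC⟩ ⟨_, hy⟩ from ⟨j, rfl⟩), ?_⟩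
    intro z hz
    rw [SimpleGraph.Walk.support_concat] at hz
    simp only [List.mem_append, List.mem_singleton] at hz
    rcases hz with hz | rfl
    exacts [hp z hz, hcC]

/-- A cube of dimension `m ≥ 3`, `m ≠ 4`, is `⌊m/2⌋`-linked even after deleting two antipodal
vertices. -/
theorem isLinked_cubeGraph_induce (m : ℕ) (hm : 3 ≤ m) (hm4 : m ≠ 4) (hι : Fintype.card ι = m)
    (v w : ι → Bool) (hvw : ∀ i, w i = !v i) :
    IsLinked ((cubeGraph ι).induce {u | u ≠ v ∧ u ≠ w}) (m / 2) := by
  classical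
  have hne : v ≠ w := by
    intro h
    obtain ⟨i⟩ : Nonempty ι := by rw [← Fintype.card_pos_iff]; omega
    have := hvw i
    rw [← h] at this
    simp at this
  constructor
  · rw [ENat.card_eq_coe_fintype_card, Nat.cast_le]
    have h1 : Fintype.card ↥{u : ι → Bool | u ≠ v ∧ u ≠ w} =
        (Finset.univ \ {v, w} : Finset (ι → Bool)).card := by
      rw [Fintype.card_subtype]
      congr 1
      ext u
      simp
    have h2 := Finset.card_sdiff_of_subset (Finset.subset_univ ({v, w} : Finset (ι → Bool)))
    rw [Finset.card_pair hne, Finset.card_univ, Fintype.card_fun, hι, Fintype.card_bool] at h2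
    rw [h1, h2]
    obtain ⟨k, rfl⟩ : ∃ k, m = k + 3 := ⟨m - 3, by omega⟩
    have := Nat.lt_two_pow_self (n := k)
    rw [pow_add]
    omega
  · intro s t hst
    -- The deleted vertices become degenerate indices, so the sets found for the pairs automatically
    -- avoid them.
    set S : Fin (m / 2) ⊕ Bool → ι → Bool :=
      Sum.elim (fun i => (s i).1) fun b => if b then v else w with hS
    set T : Fin (m / 2) ⊕ Bool → ι → Bool :=
      Sum.elim (fun i => (t i).1) fun b => if b then v else w with hT
    have hb : ∀ b, ∀ z ∈ block S T (.inr b), z = if b then v else w := by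
      intro b z hz
      rcases mem_block.1 hz with rfl | rfl <;> rfl
    have hl : ∀ i, ∀ z ∈ block S T (.inl i), (z ≠ v ∧ z ≠ w) ∧ ∃ x : Fin (m / 2) ⊕ Fin (m / 2),
        (x = .inl i ∨ x = .inr i) ∧ z = (Sum.elim s t x).1 := by
      intro i z hz
      rcases mem_block.1 hz with rfl | rfl
      exacts [⟨(s i).2, .inl i, .inl rfl, rfl⟩, ⟨(t i).2, .inr i, .inr rfl, rfl⟩]
    have hP : IsPairing Set.univ Finset.univ S T := by
      refine ⟨fun _ _ _ _ => trivial, ?_⟩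
      rintro (i | b) - (l | b') - z hz hz'
      · obtain ⟨-, x, hx, hzx⟩ := hl i z hz
        obtain ⟨-, y, hy, hzy⟩ := hl l z hz'
        obtain rfl : x = y := hst (Subtype.ext (hzx.symm.trans hzy))
        rcases hx with rfl | rfl <;> rcases hy with hy | hy <;> cases hy <;> rfl
      · have h1 := (hl i z hz).1
        have h2 := hb b' z hz'
        cases b'
        exacts [absurd h2 h1.2, absurd h2 h1.1]
      · have h1 := (hl l z hz').1
        have h2 := hb b z hz
        cases b
        exacts [absurd h2 h1.2, absurd h2 h1.1]
      · have h1 := hb b z hz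
        have h2 := hb b' z hz'
        cases b <;> cases b'
        exacts [rfl, absurd (h2.symm.trans h1) hne, absurd (h1.symm.trans h2) hne, rfl]
    have hST : ∀ i, S (.inl i) ≠ T (.inl i) := by
      intro i h
      have := hst (a₁ := .inl i) (a₂ := .inr i) (Subtype.ext h)
      simp at this
    have hcard : (terminals Finset.univ S T).card = 2 * (m / 2) + 2 := by
      rw [hP.card_terminals, Fintype.sum_sum_type]
      have h1 : ∀ i, (block S T (.inl i)).card = 2 := fun i => card_block_of_ne (hST i)
      have h2 : ∀ b, (block S T (.inr b)).card = 1 := fun b => by simp [block, hS, hT]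
      simp [h1, h2, mul_comm]
    have hlink : Linkage Set.univ Finset.univ S T := by
      -- The weight is m + 2 for even m, where m ≥ 6 because 4 is excluded, and m + 1 for odd m; m =
      -- 3 has a single pair.
      rcases Nat.even_or_odd' m with ⟨r, hr | hr⟩
      · refine IsAntipodal.linkage (p := .inr true) (q := .inr false)
          ⟨hP, Finset.mem_univ _, Finset.mem_univ _, rfl, rfl, hvw, ?_, ?_⟩ (by omega)
        · rintro (i | b) - h1 h2
          · exact hST i
          · cases b <;> simp at h1 h2
        · omega
      · rw [← subcube_univ v] at hP ⊢
        by_cases h3 : m = 3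
        · refine .of_le_one hP (by rw [hcard, Finset.card_univ]; omega) ?_
          rintro (i | b) - (l | b') - h1 h2
          · congr 1
            ext
            omega
          · exact absurd rfl h2
          · exact absurd rfl h1
          · exact absurd rfl h1
        · exact cubeLinked (by rw [Finset.card_univ]; omega) _ _ _ _ hP (by
            rw [hcard, Finset.card_univ]; omega)
    obtain ⟨C, hC, hdisj⟩ := hlink
    have hsub : ∀ i, C (.inl i) ⊆ {u | u ≠ v ∧ u ≠ w} := by
      intro i z hz
      refine ⟨?_, ?_⟩ <;> rintro rfl
      · simpa using hdisj (.inl i) (by simp) (.inr true) (by simp) _ hz (hC _ (by simp)).2.left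
      · simpa using hdisj (.inl i) (by simp) (.inr false) (by simp) _ hz (hC _ (by simp)).2.left
    choose p hp using fun i => exists_walk_of_connIn (hsub i) (hC (.inl i) (by simp)).2 (s i).2
      (t i).2
    refine ⟨fun i => (p i).toPath, fun i l hil z hz hz' => hil ?_⟩
    have := hdisj (.inl i) (by simp) (.inl l) (by simp) z.1
      (hp i z ((p i).support_toPath_subset_support hz)) (hp l z ((p l).support_toPath_subset_support hz'))
    simpa using this

theorem hammingDist_flipAt_le (j : ι) (x : ι → Bool) : hammingDist x (flipAt j x) ≤ 1 := by
  rw [hammingDist, Finset.card_le_one]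
  intro a ha b hb
  have key : ∀ a, x a ≠ flipAt j x a → a = j := by
    intro a ha
    by_contra h
    exact ha (flipAt_ne h x).symm
  simp only [Finset.mem_filter] at ha hb
  rw [key a ha.2, key b hb.2]

theorem hammingDist_le_length {x y : ι → Bool} (p : (cubeGraph ι).Walk x y) :
    hammingDist x y ≤ p.length := by
  induction p with
  | nil => simp
  | @cons a b c hab p ih =>
    have := hammingDist_triangle a b c
    have : hammingDist a b ≤ 1 := by
      obtain ⟨j, rfl⟩ := hab
      exact hammingDist_flipAt_le j a
    rw [SimpleGraph.Walk.length_cons]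
    omega

theorem exists_walk_length_eq (x y : ι → Bool) :
    ∃ p : (cubeGraph ι).Walk x y, p.length = hammingDist x y := by
  obtain ⟨n, hn⟩ : ∃ n, hammingDist x y = n := ⟨_, rfl⟩
  induction n generalizing x with
  | zero =>
    obtain rfl := hammingDist_eq_zero.1 hn
    exact ⟨.nil, hn.symm⟩
  | succ n ih =>
    obtain ⟨j, hj⟩ : ∃ j, x j ≠ y j := by
      by_contra h
      push Not at h
      rw [funext h, hammingDist_self] at hn
      omega
    have hd : hammingDist (flipAt j x) y = n := by
      have : (Finset.univ.filter fun i => flipAt j x i ≠ y i) =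
          (Finset.univ.filter fun i => x i ≠ y i).erase j := by
        ext i
        simp only [Finset.mem_filter, Finset.mem_univ, true_and, Finset.mem_erase]
        by_cases h : i = j
        · subst h
          rw [flipAt_same]
          cases h : x i <;> cases h' : y i <;> simp_all
        · simp [flipAt_ne h, h]
      rw [hammingDist] at hn ⊢
      rw [this, Finset.card_erase_of_mem (by simp [hj]), hn]
      rfl
    obtain ⟨p, hp⟩ := ih _ hd
    exact ⟨.cons (show (cubeGraph ι).Adj x (flipAt j x) from ⟨j, rfl⟩) p, by rw [SimpleGraph.Walk.length_cons, hp, hd, hn]⟩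

theorem dist_cubeGraph (x y : ι → Bool) : (cubeGraph ι).dist x y = hammingDist x y := by
  obtain ⟨p, hp⟩ := exists_walk_length_eq x y
  obtain ⟨q, hq⟩ := p.reachable.exists_walk_length_eq_dist
  refine le_antisymm (hp ▸ SimpleGraph.dist_le p) ?_
  rw [← hq]
  exact hammingDist_le_length q

theorem dist_cubeGraph_eq_card (x y : ι → Bool) :
    (cubeGraph ι).dist x y = Fintype.card ι ↔ ∀ i, y i = !x i := by
  rw [dist_cubeGraph, hammingDist, ← Finset.card_univ, Finset.card_filter_eq_iff]
  refine ⟨fun h i => ?_, fun h i _ => by rw [h i]; cases x i <;> simp⟩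
  have := h i (Finset.mem_univ i)
  cases h : x i <;> cases h' : y i <;> simp_all

theorem dist_iso_le {V W : Type*} {G : SimpleGraph V} {H : SimpleGraph W} (e : G ≃g H) {x y : V}
    (h : G.Reachable x y) : H.dist (e x) (e y) ≤ G.dist x y := by
  obtain ⟨p, hp⟩ := h.exists_walk_length_eq_dist
  have := SimpleGraph.dist_le (p.map e.toHom)
  rwa [SimpleGraph.Walk.length_map, hp] at this

theorem dist_iso {V W : Type*} {G : SimpleGraph V} {H : SimpleGraph W} (e : G ≃g H) (x y : V) :
    H.dist (e x) (e y) = G.dist x y := by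
  by_cases h : G.Reachable x y
  · refine le_antisymm (dist_iso_le e h) ?_
    have := dist_iso_le e.symm (e.reachable_iff.2 h)
    simpa using this
  · rw [SimpleGraph.dist_eq_zero_of_not_reachable h,
      SimpleGraph.dist_eq_zero_of_not_reachable (fun h' => h (e.reachable_iff.1 h'))]

end CubeGraph

end CubeLink

namespace CubeLink

/-! ### Faces, vertices, edges and facets of polytopes -/

section Polytope

variable {n : ℕ} {P F G : Set (Fin n → ℝ)} {x y z : Fin n → ℝ}

theorem IsPolytope.isCompact (hP : IsPolytope P) : IsCompact P := by
  obtain ⟨S, hS, rfl⟩ := hP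
  exact hS.isCompact_convexHull ℝ

theorem IsPolytope.convex (hP : IsPolytope P) : Convex ℝ P := by
  obtain ⟨S, -, rfl⟩ := hP
  exact convex_convexHull ℝ S

theorem IsPolytope.finite_extremePoints (hP : IsPolytope P) : (P.extremePoints ℝ).Finite := by
  obtain ⟨S, hS, rfl⟩ := hP
  exact hS.subset extremePoints_convexHull_subset

theorem convex_of_mem_faces (hP : IsPolytope P) (hF : F ∈ faces P) : Convex ℝ F :=
  IsExposed.convex hF hP.convex

theorem extremePoints_of_mem_faces (hF : F ∈ faces P) :
    F.extremePoints ℝ = F ∩ P.extremePoints ℝ := (IsExposed.isExtreme hF).extremePoints_eq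

/-- Krein–Milman for the compact convex set `F`; as its extreme points are finite in number, their
hull is already closed. -/
theorem eq_convexHull_of_mem_faces (hP : IsPolytope P) (hF : F ∈ faces P) :
    F = convexHull ℝ (F ∩ P.extremePoints ℝ) := by
  rw [← extremePoints_of_mem_faces hF]
  have hfin : (F.extremePoints ℝ).Finite := by
    rw [extremePoints_of_mem_faces hF]
    exact hP.finite_extremePoints.inter_of_right _
  rw [← (hfin.isCompact_convexHull ℝ).isClosed.closure_eq,
    closure_convexHull_extremePoints (IsExposed.isCompact hF hP.isCompact)
      (convex_of_mem_faces hP hF)]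

/-- The maximisers of a functional form a face. -/
theorem maximisers_mem_faces (l : StrongDual ℝ (Fin n → ℝ)) (P : Set (Fin n → ℝ)) :
    {x | x ∈ P ∧ ∀ y ∈ P, l y ≤ l x} ∈ faces P := fun _ => ⟨l, rfl⟩

/-- An extreme point is strictly separated from the hull of the other generators, and the separating
functional attains its maximum at that point alone. -/
theorem singleton_mem_faces_iff (hP : IsPolytope P) :
    {x} ∈ faces P ↔ x ∈ P.extremePoints ℝ := by
  refine ⟨fun h => isExtreme_singleton.1 (IsExposed.isExtreme h), fun hx => ?_⟩
  obtain ⟨S, hS, hPS⟩ := id hP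
  have hSP : S ⊆ P := hPS ▸ subset_convexHull ℝ S
  have hclosed : IsClosed (convexHull ℝ (S \ {x})) :=
    ((hS.subset Set.sdiff_subset).isCompact_convexHull ℝ).isClosed
  have hxK : x ∉ convexHull ℝ (S \ {x}) := fun h =>
    (hP.convex.mem_extremePoints_iff_mem_sdiff_convexHull_sdiff.1 hx).2
      (convexHull_mono (Set.sdiff_subset_sdiff_left hSP) h)
  obtain ⟨f, u, hu, hux⟩ := geometric_hahn_banach_closed_point (convex_convexHull ℝ _) hclosed hxK
  have hSf : ∀ y ∈ S, y ≠ x → f y < u := fun y hy hyx =>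
    hu y (subset_convexHull ℝ _ ⟨hy, hyx⟩)
  have hxP := extremePoints_subset hx
  have hle : ∀ y ∈ P, f y ≤ f x := by
    intro y hy
    have : P ⊆ {y | f y ≤ f x} := by
      rw [hPS]
      refine convexHull_min (fun y hy => ?_) (convex_halfSpace_le f.isLinear _)
      by_cases hyx : y = x
      · exact (congrArg f hyx).le
      · exact ((hSf y hy hyx).trans hux).le
    exact this hy
  have hF := maximisers_mem_faces f P
  have : {z | z ∈ P ∧ ∀ y ∈ P, f y ≤ f z} = {x} := by
    refine Set.Subset.antisymm ?_ (Set.singleton_subset_iff.2 ⟨hxP, hle⟩)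
    rw [eq_convexHull_of_mem_faces hP hF]
    refine convexHull_min ?_ (convex_singleton x)
    rintro z ⟨⟨-, hz⟩, hzP⟩
    by_contra hzx
    have hzS : z ∈ S := extremePoints_convexHull_subset (hPS ▸ hzP)
    have := hSf z hzS hzx
    have := hz x hxP
    linarith
  rwa [this] at hF

theorem eq_convexHull_vertices (hP : IsPolytope P) (hF : F ∈ faces P) :
    F = convexHull ℝ {x | x ∈ F ∧ {x} ∈ faces P} := by
  have : {x | x ∈ F ∧ {x} ∈ faces P} = F ∩ P.extremePoints ℝ := by
    ext x
    exact and_congr_right fun _ => singleton_mem_faces_iff hP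
  rw [this]
  exact eq_convexHull_of_mem_faces hP hF

theorem exists_vertex_mem (hP : IsPolytope P) (hF : F ∈ faces P) (hne : F.Nonempty) :
    ∃ x ∈ F, {x} ∈ faces P := by
  rw [eq_convexHull_vertices hP hF, convexHull_nonempty_iff] at hne
  exact hne

theorem subset_of_vertices (hP : IsPolytope P) (hF : F ∈ faces P) (hG : G ∈ faces P)
    (h : ∀ x ∈ F, {x} ∈ faces P → x ∈ G) : F ⊆ G := by
  rw [eq_convexHull_vertices hP hF]
  exact convexHull_min (fun x hx => h x hx.1 hx.2) (convex_of_mem_faces hP hG)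

theorem dim_of_mem (hx : x ∈ F) : dim F = Module.finrank ℝ (vectorSpan ℝ F) :=
  if_pos ⟨x, hx⟩

/-- An edge has no vertices besides two given ones. -/
theorem eq_or_eq_of_mem_edge (hP : IsPolytope P) (hF : F ∈ faces P) (hd : dim F = 1) (hxy : x ≠ y)
    (hxF : x ∈ F) (hyF : y ∈ F) (hx : {x} ∈ faces P) (hy : {y} ∈ faces P) (hzF : z ∈ F)
    (hz : {z} ∈ faces P) : z = x ∨ z = y := by
  by_contra hcon
  push Not at hcon
  rw [dim_of_mem hxF] at hd
  have hcol : Collinear ℝ F := collinear_iff_finrank_le_one.2 (by exact_mod_cast hd.le)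
  have hcol' : Collinear ℝ {x, y, z} := hcol.subset (by
    rintro w (rfl | rfl | rfl) <;> assumption)
  -- no vertex lies between two others
  have key : ∀ a b c : Fin n → ℝ, Wbtw ℝ a b c → a ∈ P → c ∈ P → {b} ∈ faces P → b ≠ a → b ≠ c →
      False := by
    intro a b c h ha hc hb hba hbc
    rw [singleton_mem_faces_iff hP, mem_extremePoints] at hb
    have : b ∈ openSegment ℝ a c := mem_openSegment_of_ne_left_right hba.symm hbc.symm
      h.mem_segment
    exact hba (hb.2 a ha c hc this).1.symm
  have hFP : F ⊆ P := IsExposed.subset hF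
  rcases hcol'.wbtw_or_wbtw_or_wbtw with h | h | h
  · exact key x y z h (hFP hxF) (hFP hzF) hy hxy.symm hcon.2.symm
  · exact key y z x h (hFP hyF) (hFP hxF) hz hcon.2 hcon.1
  · exact key z x y h (hFP hzF) (hFP hyF) hx hcon.1.symm hxy

/-- A face with exactly two vertices is an edge. -/
theorem dim_eq_one (hP : IsPolytope P) (hF : F ∈ faces P) (hxy : x ≠ y)
    (hxF : x ∈ F) (hyF : y ∈ F) (hx : {x} ∈ faces P) (hy : {y} ∈ faces P)
    (h : ∀ z ∈ F, {z} ∈ faces P → z = x ∨ z = y) : dim F = 1 := by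
  have : {z | z ∈ F ∧ {z} ∈ faces P} = {x, y} := by
    ext z
    refine ⟨fun hz => h z hz.1 hz.2, ?_⟩
    rintro (rfl | rfl)
    exacts [⟨hxF, hx⟩, ⟨hyF, hy⟩]
  rw [dim_of_mem hxF, eq_convexHull_vertices hP hF, this, ← direction_affineSpan,
    affineSpan_convexHull, direction_affineSpan, vectorSpan_pair,
    finrank_span_singleton (by simpa [sub_eq_zero] using hxy)]
  rfl

/-- A proper face that is not a facet lies in a larger proper face. -/
theorem exists_larger_face (hP : IsPolytope P) (hG : G ∈ faces P) (hne : G.Nonempty) (hGP : G ≠ P)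
    (hd : dim G ≠ dim P - 1) : ∃ G' ∈ faces P, G ⊆ G' ∧ G' ≠ P ∧
      Module.finrank ℝ (vectorSpan ℝ G) < Module.finrank ℝ (vectorSpan ℝ G') := by
  obtain ⟨S, hS, hPS⟩ := hP
  have hSP : S ⊆ P := hPS ▸ subset_convexHull ℝ S
  obtain ⟨l, hl⟩ := hG hne
  have hsub : G ⊆ P := IsExposed.subset hG
  obtain ⟨g₀, hg₀⟩ := hne
  have hg₀P := hsub hg₀
  rw [dim_of_mem hg₀, dim_of_mem hg₀P] at hd
  have hmax : ∀ y ∈ P, l y ≤ l g₀ := by rw [hl] at hg₀; exact hg₀.2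
  have hGl : ∀ x, x ∈ G ↔ x ∈ P ∧ l x = l g₀ := by
    intro x
    rw [hl]
    exact ⟨fun h => ⟨h.1, le_antisymm (hmax x h.1) (h.2 _ hg₀P)⟩,
      fun h => ⟨h.1, fun y hy => h.2 ▸ hmax y hy⟩⟩
  set W := vectorSpan ℝ G with hW
  set V := vectorSpan ℝ P with hV
  have hWV : W ≤ V := vectorSpan_mono ℝ hsub
  have hWl : ∀ w ∈ W, l w = 0 := by
    have : W ≤ LinearMap.ker l.toLinearMap := by
      rw [hW, vectorSpan_eq_span_vsub_set_right ℝ hg₀, Submodule.span_le]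
      rintro _ ⟨x, hx, rfl⟩
      simp [((hGl x).1 hx).2]
    exact fun w hw => this hw
  obtain ⟨p, hp, hpG⟩ := Set.exists_of_ssubset (hsub.ssubset_of_ne hGP)
  have hlp : l p < l g₀ := lt_of_le_of_ne (hmax p hp) fun h => hpG ((hGl p).2 ⟨hp, h⟩)
  have hlu : l (p - g₀) < 0 := by rw [map_sub]; linarith
  have huV : p - g₀ ∈ V := vsub_mem_vectorSpan ℝ hp hg₀P
  have huW : p - g₀ ∉ W := fun h => hlu.ne (hWl _ h)
  -- `W'` adds to the directions of `G` one that leaves `G`; as `G` is not of codimension one, `W'`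
  -- is still not all of `V`.
  set W' := W ⊔ Submodule.span ℝ {p - g₀} with hW'
  have hW'V : W' ≤ V := sup_le hWV ((Submodule.span_singleton_le_iff_mem _ _).2 huV)
  have hfr : Module.finrank ℝ W' ≤ Module.finrank ℝ W + 1 := by
    refine (Submodule.finrank_add_le_finrank_add_finrank _ _).trans ?_
    rw [finrank_span_singleton (fun h => by rw [h] at hlu; simp at hlu)]
  have hWW' : Module.finrank ℝ W < Module.finrank ℝ W' := by
    refine Submodule.finrank_lt_finrank_of_lt (lt_of_le_of_ne le_sup_left fun h => huW ?_)
    rw [h]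
    exact Submodule.mem_sup_right (Submodule.mem_span_singleton_self _)
  have hne' : W' ≠ V := by
    intro h
    rw [← h] at hd
    apply hd
    have : Module.finrank ℝ W' = Module.finrank ℝ W + 1 := le_antisymm hfr hWW'
    rw [this]
    push_cast
    ring
  obtain ⟨u₁, hu₁, hu₁'⟩ := Set.exists_of_ssubset (SetLike.coe_ssubset_coe.2
    (lt_of_le_of_ne hW'V hne'))
  -- The functional `g'` is constant on `G` and at `p` but not on `P`; it supplies the direction in
  -- which the supporting hyperplane is rotated about `G`.
  obtain ⟨g', hg'u, hg'W⟩ := Submodule.exists_le_ker_of_notMem hu₁'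
  set g : StrongDual ℝ (Fin n → ℝ) := LinearMap.toContinuousLinearMap g' with hg
  have hgg' : ∀ w, g w = g' w := fun _ => rfl
  have hgW : ∀ w ∈ W', g w = 0 := fun w hw => hg'W hw
  have hgG : ∀ x ∈ G, g x = g g₀ := by
    intro x hx
    have := hgW (x - g₀) (Submodule.mem_sup_left (vsub_mem_vectorSpan ℝ hx hg₀))
    rwa [map_sub, sub_eq_zero] at this
  -- the points at which the rotating hyperplane may stop
  obtain ⟨s₁, hs₁, hls₁⟩ : ∃ s ∈ S, l s < l g₀ := by
    by_contra hcon
    push Not at hcon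
    have : P ⊆ {y | l g₀ ≤ l y} := by
      rw [hPS]
      exact convexHull_min hcon (convex_halfSpace_ge l.isLinear _)
    exact absurd (this hp) (not_le.2 hlp)
  -- The largest quotient is the least τ for which g + τ l is still maximal on `G`. Equality at `s₀`
  -- brings this point, which is outside `G`, into the new face.
  obtain ⟨s₀, ⟨hs₀, hls₀⟩, hs₀max⟩ := Set.exists_max_image {s | s ∈ S ∧ l s < l g₀}
    (fun s => (g s - g g₀) / (l g₀ - l s)) (hS.subset fun _ h => h.1) ⟨s₁, hs₁, hls₁⟩
  set τ := (g s₀ - g g₀) / (l g₀ - l s₀) with hτ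
  set h : StrongDual ℝ (Fin n → ℝ) := g + τ • l with hh
  have happ : ∀ y, h y = g y + τ * l y := fun y => by simp [hh]
  have hhS : ∀ s ∈ S, h s ≤ h g₀ := by
    intro s hs
    rw [happ, happ]
    rcases (hmax s (hSP hs)).lt_or_eq with hlt | heq
    · have h1 := hs₀max s ⟨hs, hlt⟩
      rw [div_le_iff₀ (by linarith)] at h1
      linarith
    · rw [hgG s ((hGl s).2 ⟨hSP hs, heq⟩), heq]
  have hhP : ∀ y ∈ P, h y ≤ h g₀ := by
    have : P ⊆ {y | h y ≤ h g₀} := by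
      rw [hPS]
      exact convexHull_min hhS (convex_halfSpace_le h.isLinear _)
    exact fun y hy => this hy
  have hh₀ : h s₀ = h g₀ := by
    rw [happ, happ]
    have : τ * (l g₀ - l s₀) = g s₀ - g g₀ := div_mul_cancel₀ _ (by linarith)
    linarith
  have hmemG' : ∀ x ∈ P, h x = h g₀ → x ∈ {x | x ∈ P ∧ ∀ y ∈ P, h y ≤ h x} :=
    fun x hx hxh => ⟨hx, fun y hy => hxh ▸ hhP y hy⟩
  have hGG' : G ⊆ {x | x ∈ P ∧ ∀ y ∈ P, h y ≤ h x} := by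
    intro x hx
    refine hmemG' x (hsub hx) ?_
    rw [happ, happ, hgG x hx, ((hGl x).1 hx).2]
  refine ⟨_, maximisers_mem_faces h P, hGG', fun hEq => ?_, ?_⟩
  · have hconst : ∀ y ∈ P, h y = h g₀ := by
      intro y hy
      refine le_antisymm (hhP y hy) ?_
      rw [← hEq] at hy
      exact hy.2 g₀ hg₀P
    -- `g` does not distinguish `p` from `g₀` while `l` does, so a constant `h` forces τ = 0, and
    -- then `g` would be constant on `P`.
    have hτ0 : τ = 0 := by
      have h1 := hconst p hp
      rw [happ, happ] at h1
      have h2 := hgW (p - g₀) (Submodule.mem_sup_right (Submodule.mem_span_singleton_self _))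
      rw [map_sub] at h2
      have h3 : τ * (l p - l g₀) = 0 := by linarith
      rcases mul_eq_zero.1 h3 with h3 | h3
      · exact h3
      · linarith
    have hgV : V ≤ LinearMap.ker g' := by
      rw [hV, vectorSpan_eq_span_vsub_set_right ℝ hg₀P, Submodule.span_le]
      rintro _ ⟨y, hy, rfl⟩
      have h1 := hconst y hy
      rw [happ, happ, hτ0, hgg', hgg'] at h1
      simp only [zero_mul, add_zero] at h1
      simp [h1]
    exact hg'u (hgV hu₁)
  · refine Submodule.finrank_lt_finrank_of_lt (lt_of_le_of_ne (vectorSpan_mono ℝ hGG') fun hEq => ?_)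
    have h1 : s₀ - g₀ ∈ W := by
      rw [hEq]
      exact vsub_mem_vectorSpan ℝ (hmemG' s₀ (hSP hs₀) hh₀) (hGG' hg₀)
    have h2 := hWl _ h1
    rw [map_sub] at h2
    linarith

/-- Every nonempty proper face lies in a facet. -/
theorem exists_facet (hP : IsPolytope P) (hG : G ∈ faces P) (hne : G.Nonempty) (hGP : G ≠ P) :
    ∃ F, IsFacet P F ∧ G ⊆ F := by
  obtain ⟨k, hk⟩ : ∃ k, n - Module.finrank ℝ (vectorSpan ℝ G) = k := ⟨_, rfl⟩
  induction k using Nat.strong_induction_on generalizing G with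
  | _ k ih =>
    by_cases hd : dim G = dim P - 1
    · exact ⟨G, ⟨hG, hd⟩, subset_rfl⟩
    · obtain ⟨G', hG', hsub, hG'P, hlt⟩ := exists_larger_face hP hG hne hGP hd
      have h1 : Module.finrank ℝ (vectorSpan ℝ G') ≤ n := by
        simpa using Submodule.finrank_le (vectorSpan ℝ G')
      obtain ⟨F, hF, hG'F⟩ := ih _ (by omega) hG' (hne.mono hsub) hG'P rfl
      exact ⟨F, hF, hsub.trans hG'F⟩

theorem IsFacet.ne (hF : IsFacet P F) : F ≠ P := by
  rintro rfl
  have := hF.2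
  omega

end Polytope

end CubeLink

namespace CubeLink

/-! ### Faces of the standard cube -/

section StandardCube

variable {m : ℕ}

/-- The vertex of the standard cube with the given pattern of signs. -/
def signVector (b : Fin m → Bool) : Fin m → ℝ := fun i => if b i then 1 else -1

theorem signVector_injective : Function.Injective (signVector (m := m)) := by
  intro b c h
  funext i
  have := congrFun h i
  simp only [signVector] at this
  cases hb : b i <;> cases hc : c i <;> simp [hb, hc] at this ⊢ <;> norm_num at this

theorem signVector_mul_self (b : Fin m → Bool) (i : Fin m) :
    signVector b i * signVector b i = 1 := by
  unfold signVector
  split_ifs <;> norm_num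

theorem range_signVector :
    Set.range (signVector (m := m)) = {x | ∀ i, x i = 1 ∨ x i = -1} := by
  ext x
  constructor
  · rintro ⟨b, rfl⟩ i
    unfold signVector
    split_ifs <;> simp
  · intro hx
    refine ⟨fun i => decide (x i = 1), ?_⟩
    funext i
    rcases hx i with h | h <;> simp [signVector, h]
    norm_num

theorem stdCube_eq : stdCube m = convexHull ℝ (Set.range (signVector (m := m))) := by
  rw [range_signVector, stdCube]

theorem isPolytope_stdCube : IsPolytope (stdCube m) :=
  ⟨_, Set.finite_range _, stdCube_eq⟩

theorem signVector_mem_stdCube (b : Fin m → Bool) : signVector b ∈ stdCube m := by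
  rw [stdCube_eq]
  exact subset_convexHull ℝ _ ⟨b, rfl⟩

theorem mul_signVector_le_one {y : Fin m → ℝ} (hy : y ∈ stdCube m) (b : Fin m → Bool)
    (i : Fin m) : signVector b i * y i ≤ 1 := by
  have : stdCube m ⊆ {y | signVector b i * y i ≤ 1} := by
    rw [stdCube_eq]
    refine convexHull_min ?_ ?_
    · rintro _ ⟨c, rfl⟩
      simp only [Set.mem_ofPred_eq, signVector]
      split_ifs <;> norm_num
    · exact convex_halfSpace_le (f := fun y : Fin m → ℝ => signVector b i * y i)
        ⟨fun x y => by simp [mul_add], fun c x => by simp; ring⟩ 1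
  exact this hy

/-- Prescribing the signs of some coordinates cuts out a face. -/
theorem subcube_mem_faces (K : Finset (Fin m)) (b : Fin m → Bool) :
    {y | y ∈ stdCube m ∧ ∀ i ∈ K, y i = signVector b i} ∈ faces (stdCube m) := by
  -- A sum of signed coordinates, each at most 1 on the cube: it is maximal exactly when every
  -- summand is 1.
  let l : StrongDual ℝ (Fin m → ℝ) :=
    ∑ i ∈ K, signVector b i • ContinuousLinearMap.proj (R := ℝ) (φ := fun _ : Fin m => ℝ) i
  have hl : ∀ y, l y = ∑ i ∈ K, signVector b i * y i := fun y => by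
    simp [l]
  have hle : ∀ y ∈ stdCube m, l y ≤ l (signVector b) := fun y hy => by
    rw [hl, hl]
    refine Finset.sum_le_sum fun i _ => ?_
    rw [signVector_mul_self]
    exact mul_signVector_le_one hy b i
  convert maximisers_mem_faces l (stdCube m) using 1
  ext y
  refine and_congr_right fun hy => ⟨fun h z hz => (hle z hz).trans_eq ?_, fun h i hi => ?_⟩
  · rw [hl, hl]
    exact Finset.sum_congr rfl fun i hi => by rw [h i hi]
  · have h1 : l y = l (signVector b) := (hle y hy).antisymm (h _ (signVector_mem_stdCube b))
    rw [hl, hl, Finset.sum_eq_sum_iff_of_le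
      (fun i _ => by rw [signVector_mul_self]; exact mul_signVector_le_one hy b i)] at h1
    have h2 := h1 i hi
    have h3 := signVector_mul_self b i
    have h4 : signVector b i ≠ 0 := fun h0 => by simp [h0] at h3
    exact mul_left_cancel₀ h4 h2

theorem singleton_signVector_mem_faces (b : Fin m → Bool) :
    {signVector b} ∈ faces (stdCube m) := by
  convert subcube_mem_faces Finset.univ b using 1
  ext y
  simp only [Set.mem_singleton_iff, Finset.mem_univ, true_implies, Set.mem_ofPred_eq]
  refine ⟨?_, fun h => funext h.2⟩
  rintro rfl
  exact ⟨signVector_mem_stdCube b, fun _ => rfl⟩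

theorem exists_eq_signVector {x : Fin m → ℝ} (hx : {x} ∈ faces (stdCube m)) :
    ∃ b, signVector b = x := by
  have h := (singleton_mem_faces_iff isPolytope_stdCube).1 hx
  rw [stdCube_eq] at h
  exact Set.mem_range.1 (extremePoints_convexHull_subset h)

theorem map_signVector_flipAt (l : StrongDual ℝ (Fin m → ℝ)) (i : Fin m) (b : Fin m → Bool) :
    l (signVector (flipAt i b)) = l (signVector b) - 2 * signVector b i * l (Pi.single i 1) := by
  have : signVector (flipAt i b) = signVector b - (2 * signVector b i) • Pi.single i (1 : ℝ) := by
    funext j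
    rw [Pi.sub_apply, Pi.smul_apply]
    by_cases hj : j = i
    · subst hj
      cases hb : b j <;> simp [signVector, hb] <;> norm_num
    · rw [Pi.single_eq_of_ne hj, smul_zero, sub_zero, signVector, signVector, flipAt_ne hj]
  rw [this, map_sub, map_smul, smul_eq_mul]

/-- A face of the cube contains every vertex lying between two of its vertices. -/
theorem signVector_mem_of_between {F : Set (Fin m → ℝ)} (hF : F ∈ faces (stdCube m))
    {a b c : Fin m → Bool} (hb : signVector b ∈ F) (hc : signVector c ∈ F)
    (h : ∀ i, a i = b i ∨ a i = c i) : signVector a ∈ F := by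
  obtain ⟨l, rfl⟩ := hF ⟨_, hb⟩
  -- Flipping a coordinate of a maximiser cannot increase `l`, which fixes the sign of its
  -- coefficient. Where `b` and `c` differ, the two sign conditions make the coefficient zero.
  have key : ∀ b : Fin m → Bool, (∀ y ∈ stdCube m, l y ≤ l (signVector b)) → ∀ i,
      0 ≤ signVector b i * l (Pi.single i 1) := fun b hb i => by
    have := hb _ (signVector_mem_stdCube (flipAt i b))
    rw [map_signVector_flipAt] at this
    linarith
  have hsum : ∀ y : Fin m → ℝ, l y = ∑ i, y i * l (Pi.single i 1) := fun y => by
    conv_lhs => rw [pi_eq_sum_univ' y]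
    simp
  refine ⟨signVector_mem_stdCube a, fun y hy => (hb.2 y hy).trans_eq ?_⟩
  rw [hsum, hsum]
  refine Finset.sum_congr rfl fun i _ => ?_
  by_cases hab : a i = b i
  · simp [signVector, hab]
  · have hac := (h i).resolve_left hab
    have h1 := key b hb.2 i
    have h2 := key c hc.2 i
    have h0 : l (Pi.single i 1) = 0 := by
      cases hbi : b i <;> cases hci : c i <;> simp [hac, hbi, hci] at hab <;>
        simp [signVector, hbi, hci] at h1 h2 <;> linarith
    simp [h0]

end StandardCube

/-! ### Labelling the vertices of a cube, and its link -/

section Labelling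

variable {n m : ℕ} {P F : Set (Fin n → ℝ)}

/-- The vertices of the polytope `P` are labelled by the vertices of the discrete cube in such a
way that every subcube is the vertex set of a face, and vertex sets of faces are closed under
taking vertices in between. -/
structure IsCubeLabelling (P : Set (Fin n → ℝ)) (β : Vertex (faces P) ≃ (Fin m → Bool)) :
    Prop where
  exists_face : ∀ (K : Finset (Fin m)) (b : Fin m → Bool),
    ∃ F ∈ faces P, ∀ x : Vertex (faces P), x.1 ∈ F ↔ ∀ i ∈ K, β x i = b i
  mem_of_between : ∀ F ∈ faces P, ∀ x y z : Vertex (faces P), x.1 ∈ F → y.1 ∈ F →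
    (∀ i, β z i = β x i ∨ β z i = β y i) → z.1 ∈ F

theorem empty_mem_faces (P : Set (Fin n → ℝ)) : ∅ ∈ faces P := isExposed_empty

/-- An isomorphism of face lattices sends vertices to vertices. -/
theorem exists_map_singleton {m : ℕ} {Q : Set (Fin m → ℝ)} (hQ : IsPolytope Q)
    (φ : faces P ≃o faces Q) (x : Vertex (faces P)) :
    ∃ y : Vertex (faces Q), φ ⟨{x.1}, x.2⟩ = ⟨{y.1}, y.2⟩ := by
  -- Vertices are the minimal nonempty faces, a notion the order determines.
  have hne : (φ ⟨{x.1}, x.2⟩).1.Nonempty := by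
    rw [Set.nonempty_iff_ne_empty]
    intro h
    have h1 : φ ⟨{x.1}, x.2⟩ ≤ φ ⟨∅, empty_mem_faces P⟩ := by
      change (φ ⟨{x.1}, x.2⟩).1 ⊆ _
      rw [h]
      exact Set.empty_subset _
    exact φ.le_iff_le.1 h1 (Set.mem_singleton x.1)
  obtain ⟨y, hyF, hy⟩ := exists_vertex_mem hQ (φ ⟨{x.1}, x.2⟩).2 hne
  refine ⟨⟨y, hy⟩, ?_⟩
  have h1 : φ.symm ⟨{y}, hy⟩ ≤ ⟨{x.1}, x.2⟩ := by
    rw [OrderIso.symm_apply_le]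
    exact Set.singleton_subset_iff.2 hyF
  have h2 : φ.symm ⟨{y}, hy⟩ = ⟨{x.1}, x.2⟩ := by
    rcases Set.subset_singleton_iff_eq.1 (show (φ.symm ⟨{y}, hy⟩).1 ⊆ {x.1} from h1) with h | h
    · have h3 : φ.symm ⟨{y}, hy⟩ ≤ φ.symm ⟨∅, empty_mem_faces Q⟩ := by
        change (φ.symm ⟨{y}, hy⟩).1 ⊆ _
        rw [h]
        exact Set.empty_subset _
      exact absurd (φ.symm.le_iff_le.1 h3 (Set.mem_singleton y)) (Set.notMem_empty y)
    · exact Subtype.ext h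
  rw [← h2, OrderIso.apply_symm_apply]

/-- Incidence of a vertex with a face is an inclusion of faces, so the isomorphism transports both
properties from the standard cube. -/
theorem exists_isCubeLabelling (hP : IsPolytope P) (φ : faces P ≃o faces (stdCube m)) :
    ∃ β : Vertex (faces P) ≃ (Fin m → Bool), IsCubeLabelling P β := by
  have h1 : ∀ x : Vertex (faces P), ∃ b, (φ ⟨{x.1}, x.2⟩).1 = {signVector b} := fun x => by
    obtain ⟨y, hy⟩ := exists_map_singleton isPolytope_stdCube φ x
    obtain ⟨b, hb⟩ := exists_eq_signVector y.2
    exact ⟨b, by rw [hy, hb]⟩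
  choose f hf using h1
  have hmem : ∀ (x : Vertex (faces P)) (F : faces P), x.1 ∈ F.1 ↔ signVector (f x) ∈ (φ F).1 :=
    fun x F => by
    rw [← Set.singleton_subset_iff, ← Set.singleton_subset_iff, ← hf]
    exact (φ.le_iff_le (x := ⟨{x.1}, x.2⟩) (y := F)).symm
  have hbij : Function.Bijective f := by
    refine ⟨fun x y hxy => ?_, fun b => ?_⟩
    · have h2 : φ ⟨{x.1}, x.2⟩ = φ ⟨{y.1}, y.2⟩ := Subtype.ext (by rw [hf, hf, hxy])
      exact Subtype.ext (Set.singleton_injective (congrArg Subtype.val (φ.injective h2)))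
    · obtain ⟨x, hx⟩ := exists_map_singleton hP φ.symm ⟨_, singleton_signVector_mem_faces b⟩
      refine ⟨x, signVector_injective (Set.singleton_injective ?_)⟩
      rw [← hf, ← hx, OrderIso.apply_symm_apply]
  refine ⟨Equiv.ofBijective f hbij, fun K b => ?_, fun F hF x y z hx hy h => ?_⟩
  · refine ⟨_, (φ.symm ⟨_, subcube_mem_faces K b⟩).2, fun x => ?_⟩
    rw [hmem x, OrderIso.apply_symm_apply]
    refine ⟨fun h i hi => ?_, fun h => ⟨signVector_mem_stdCube _, fun i hi => ?_⟩⟩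
    · have h3 := h.2 i hi
      simp only [signVector] at h3
      rw [Equiv.ofBijective_apply]
      cases hb : b i <;> cases hc : f x i <;> simp [hb, hc] at h3 ⊢ <;> norm_num at h3
    · have h3 := h i hi
      rw [Equiv.ofBijective_apply] at h3
      simp [signVector, h3]
  · rw [hmem z ⟨F, hF⟩]
    exact signVector_mem_of_between (φ ⟨F, hF⟩).2 ((hmem x ⟨F, hF⟩).1 hx) ((hmem y ⟨F, hF⟩).1 hy) h

variable {β : Vertex (faces P) ≃ (Fin m → Bool)}

theorem mem_of_mem_vertex (x : Vertex (faces P)) : x.1 ∈ P :=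
  IsExposed.subset x.2 (Set.mem_singleton x.1)

/-- Every label lies between two complementary ones, so the face contains all vertices. -/
theorem IsCubeLabelling.eq_of_antipodal_mem (hβ : IsCubeLabelling P β) (hP : IsPolytope P)
    (hF : F ∈ faces P) {x y : Vertex (faces P)} (hx : x.1 ∈ F) (hy : y.1 ∈ F)
    (hxy : ∀ i, β y i = !β x i) : F = P := by
  refine (IsExposed.subset hF).antisymm
    (subset_of_vertices hP (IsExposed.refl P) hF fun z _ hz =>
      hβ.mem_of_between F hF x y ⟨z, hz⟩ hx hy fun i => ?_)
  rw [hxy]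
  cases β ⟨z, hz⟩ i <;> cases β x i <;> simp

/-- The edges of a cube join the vertices that differ in one coordinate. -/
theorem IsCubeLabelling.exists_eq_flipAt (hβ : IsCubeLabelling P β) (hP : IsPolytope P)
    (hF : F ∈ faces P) (hd : dim F = 1) {x y : Vertex (faces P)} (hxy : x ≠ y) (hx : x.1 ∈ F)
    (hy : y.1 ∈ F) : ∃ j, β y = flipAt j (β x) := by
  obtain ⟨j, hj⟩ := Function.ne_iff.1 (β.injective.ne hxy)
  refine ⟨j, ?_⟩
  -- Changing one coordinate of `x` towards `y` gives a vertex in between, hence on the edge; since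
  -- it is not `x`, it must be `y`.
  have hz : (β.symm (flipAt j (β x))).1 ∈ F := by
    refine hβ.mem_of_between F hF x y _ hx hy fun i => ?_
    rw [Equiv.apply_symm_apply]
    by_cases hi : i = j
    · subst hi
      right
      rw [flipAt_same]
      revert hj
      cases β x i <;> cases β y i <;> simp
    · exact Or.inl (flipAt_ne hi _)
  rcases eq_or_eq_of_mem_edge hP hF hd (Subtype.coe_injective.ne hxy) hx hy x.2 y.2 hz
    (β.symm (flipAt j (β x))).2 with h | h
  · have h1 := (Equiv.symm_apply_eq β).1 (Subtype.ext h)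
    exact absurd h1 (flipAt_ne_self j (β x))
  · exact ((Equiv.symm_apply_eq β).1 (Subtype.ext h)).symm

theorem IsCubeLabelling.exists_edge (hβ : IsCubeLabelling P β) (hP : IsPolytope P)
    {x y : Vertex (faces P)} {j : Fin m} (h : β y = flipAt j (β x)) :
    ∃ F ∈ faces P, dim F = 1 ∧ x.1 ∈ F ∧ y.1 ∈ F ∧
      ∀ z : Vertex (faces P), z.1 ∈ F → z = x ∨ z = y := by
  obtain ⟨F, hF, hmem⟩ := hβ.exists_face (Finset.univ.erase j) (β x)
  have hxF : x.1 ∈ F := (hmem x).2 fun _ _ => rfl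
  have hyF : y.1 ∈ F := (hmem y).2 fun i hi => by
    rw [h, flipAt_ne (Finset.ne_of_mem_erase hi)]
  have hxy : x ≠ y := fun hxy => flipAt_ne_self j (β x) (by rw [← h, hxy])
  have hz : ∀ z : Vertex (faces P), z.1 ∈ F → z = x ∨ z = y := fun z hzF => by
    have h1 := (hmem z).1 hzF
    by_cases hzj : β z j = β x j
    · refine Or.inl (β.injective (funext fun i => ?_))
      by_cases hi : i = j
      · rw [hi, hzj]
      · exact h1 i (Finset.mem_erase.2 ⟨hi, Finset.mem_univ i⟩)
    · refine Or.inr (β.injective (funext fun i => ?_))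
      rw [h]
      by_cases hi : i = j
      · rw [hi, flipAt_same]
        revert hzj
        cases β z j <;> cases β x j <;> simp
      · rw [flipAt_ne hi]
        exact h1 i (Finset.mem_erase.2 ⟨hi, Finset.mem_univ i⟩)
  refine ⟨F, hF, dim_eq_one hP hF (Subtype.coe_injective.ne hxy) hxF hyF x.2 y.2
    fun z hzF hzv => ?_, hxF, hyF, hz⟩
  exact (hz ⟨z, hzv⟩ hzF).imp (congrArg Subtype.val) (congrArg Subtype.val)

theorem IsCubeLabelling.adj_iff (hβ : IsCubeLabelling P β) (hP : IsPolytope P)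
    {x y : Vertex (faces P)} :
    (cubeGraph (Fin m)).Adj (β x) (β y) ↔ (graph (faces P)).Adj x y := by
  constructor
  · rintro ⟨j, hj⟩
    obtain ⟨F, hF, hd, hx, hy, -⟩ := hβ.exists_edge hP hj
    exact ⟨fun hxy => flipAt_ne_self j (β x) (by rw [← hj, hxy]), F, hF, hd, hx, hy⟩
  · rintro ⟨hxy, F, hF, hd, hx, hy⟩
    exact hβ.exists_eq_flipAt hP hF hd hxy hx hy

/-- A face whose vertices agree with `v` in some coordinate lies in a facet containing `v`. -/
theorem IsCubeLabelling.exists_facet (hβ : IsCubeLabelling P β) (hP : IsPolytope P)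
    (hF : F ∈ faces P) {v : Vertex (faces P)} {i : Fin m}
    (h : ∀ z : Vertex (faces P), z.1 ∈ F → β z i = β v i) :
    ∃ G, IsFacet P G ∧ v.1 ∈ G ∧ F ⊆ G := by
  -- The face prescribing coordinate `i` is proper, since it misses the neighbour of `v` in
  -- direction `i`; any facet above it serves.
  obtain ⟨F', hF', hmem⟩ := hβ.exists_face {i} (β v)
  have hv : v.1 ∈ F' := (hmem v).2 fun _ _ => rfl
  have hne : F' ≠ P := by
    intro hEq
    have h1 : (β.symm (flipAt i (β v))).1 ∈ F' := by
      rw [hEq]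
      exact mem_of_mem_vertex _
    have h2 := (hmem _).1 h1 i (Finset.mem_singleton_self i)
    rw [Equiv.apply_symm_apply, flipAt_same] at h2
    revert h2
    cases β v i <;> simp
  obtain ⟨G, hG, hsub⟩ := CubeLink.exists_facet hP hF' ⟨_, hv⟩ hne
  refine ⟨G, hG, hsub hv, (subset_of_vertices hP hF hF' fun z hzF hz => ?_).trans hsub⟩
  refine (hmem ⟨z, hz⟩).2 fun k hk => ?_
  rw [Finset.mem_singleton.1 hk]
  exact h ⟨z, hz⟩ hzF

/-- The link of a vertex contains all vertices but that vertex and the opposite one. -/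
theorem IsCubeLabelling.singleton_mem_link_iff (hβ : IsCubeLabelling P β) (hP : IsPolytope P)
    {v w : Vertex (faces P)} (hw : ∀ i, β w i = !β v i) (x : Vertex (faces P)) :
    {x.1} ∈ link P v.1 ↔ x ≠ v ∧ x ≠ w := by
  constructor
  · rintro ⟨-, hv, G, hG, hvG, hsub⟩
    refine ⟨fun h => hv (by rw [h]; rfl), ?_⟩
    rintro rfl
    exact hG.ne (hβ.eq_of_antipodal_mem hP hG.1 hvG (hsub rfl) hw)
  · rintro ⟨hxv, hxw⟩
    refine ⟨x.2, fun h => hxv (Subtype.ext (Set.mem_singleton_iff.1 h).symm), ?_⟩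
    obtain ⟨i, hi⟩ := Function.ne_iff.1 (β.injective.ne hxw)
    refine hβ.exists_facet hP x.2 (i := i) fun z hz => ?_
    rw [show z = x from Subtype.ext hz]
    rw [hw] at hi
    revert hi
    cases β x i <;> cases β v i <;> simp

/-- An edge of direction `j` that misses `v` and `w` agrees with `v` in some coordinate other than
`j`, since otherwise one of its ends would be `w`. That coordinate places the edge in a facet
through `v`. -/
theorem IsCubeLabelling.adj_link_iff (hβ : IsCubeLabelling P β) (hP : IsPolytope P)
    {v w : Vertex (faces P)} (hw : ∀ i, β w i = !β v i) {x y : Vertex (link P v.1)} :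
    (graph (link P v.1)).Adj x y ↔ (graph (faces P)).Adj ⟨x.1, x.2.1⟩ ⟨y.1, y.2.1⟩ := by
  constructor
  · rintro ⟨hxy, e, he, hd, hx, hy⟩
    exact ⟨fun h => hxy (Subtype.ext (Subtype.mk.inj h)), e, he.1, hd, hx, hy⟩
  · intro h
    obtain ⟨j, hj⟩ := (hβ.adj_iff hP).2 h
    obtain ⟨F, hF, hd, hx, hy, hz⟩ := hβ.exists_edge hP hj
    have hxl := (hβ.singleton_mem_link_iff hP hw ⟨x.1, x.2.1⟩).1 x.2
    have hyl := (hβ.singleton_mem_link_iff hP hw ⟨y.1, y.2.1⟩).1 y.2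
    refine ⟨fun hxy => h.ne (by subst hxy; rfl), F, ⟨hF, fun hv => ?_, ?_⟩, hd, hx, hy⟩
    · exact (hz v hv).elim hxl.1.symm hyl.1.symm
    · obtain ⟨i, hij, hi⟩ : ∃ i, i ≠ j ∧ β ⟨x.1, x.2.1⟩ i = β v i := by
        by_contra! hcon
        have h1 : ∀ i, i ≠ j → β ⟨x.1, x.2.1⟩ i = !β v i := fun i hi => by
          have := hcon i hi
          revert this
          cases β ⟨x.1, x.2.1⟩ i <;> cases β v i <;> simp
        by_cases hxj : β ⟨x.1, x.2.1⟩ j = β v j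
        · refine hyl.2 (β.injective (funext fun i => ?_))
          rw [hj, hw]
          by_cases hi : i = j
          · rw [hi, flipAt_same, hxj]
          · rw [flipAt_ne hi, h1 i hi]
        · refine hxl.2 (β.injective (funext fun i => ?_))
          rw [hw]
          by_cases hi : i = j
          · rw [hi]
            revert hxj
            cases β ⟨x.1, x.2.1⟩ j <;> cases β v j <;> simp
          · exact h1 i hi
      refine hβ.exists_facet hP hF (i := i) fun z hzF => ?_
      rcases hz z hzF with rfl | rfl
      · exact hi
      · rw [hj, flipAt_ne hij, hi]

/-- The graph of a cube is the graph of the discrete cube. -/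
def IsCubeLabelling.graphIso (hβ : IsCubeLabelling P β) (hP : IsPolytope P) :
    graph (faces P) ≃g cubeGraph (Fin m) where
  toEquiv := β
  map_rel_iff' := hβ.adj_iff hP

/-- The graph of the link of a vertex is the graph of the cube without that vertex and the opposite
one. -/
def IsCubeLabelling.linkIso (hβ : IsCubeLabelling P β) (hP : IsPolytope P)
    {v w : Vertex (faces P)} (hw : ∀ i, β w i = !β v i) :
    graph (link P v.1) ≃g (graph (faces P)).induce {u | u ≠ v ∧ u ≠ w} where
  toFun x := ⟨⟨x.1, x.2.1⟩, (hβ.singleton_mem_link_iff hP hw ⟨x.1, x.2.1⟩).1 x.2⟩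
  invFun u := ⟨u.1.1, (hβ.singleton_mem_link_iff hP hw u.1).2 u.2⟩
  left_inv _ := rfl
  right_inv _ := rfl
  map_rel_iff' := (hβ.adj_link_iff hP hw).symm

/-- The isomorphism with the discrete cube, restricted to the complement of two vertices. -/
def IsCubeLabelling.induceIso (hβ : IsCubeLabelling P β) (hP : IsPolytope P)
    (v w : Vertex (faces P)) :
    (graph (faces P)).induce {u | u ≠ v ∧ u ≠ w} ≃g
      (cubeGraph (Fin m)).induce {u | u ≠ β v ∧ u ≠ β w} where
  toEquiv := β.subtypeEquiv fun u => by simp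
  map_rel_iff' := hβ.adj_iff hP

end Labelling

end CubeLink

/-! ### The proposition -/

theorem mainTheorem5 (d : ℕ) (hd : 2 ≤ d) (hd3 : d ≠ 3) (n : ℕ) (P : Set (Fin n → ℝ))
    (hP : CubeLink.IsCube (d + 1) P) (v : CubeLink.Vertex (CubeLink.faces P)) :
    CubeLink.IsLinked (CubeLink.graph (CubeLink.link P v.1)) ((d + 1) / 2) ∧
      ∃ w : CubeLink.Vertex (CubeLink.faces P),
        (∀ u, (CubeLink.graph (CubeLink.faces P)).dist v u = d + 1 ↔ u = w) ∧
        ∃ e : CubeLink.graph (CubeLink.link P v.1) ≃g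
            (CubeLink.graph (CubeLink.faces P)).induce {u | u ≠ v ∧ u ≠ w},
          ∀ x, (e x).1.1 = x.1 := by
  obtain ⟨hPoly, ⟨φ⟩⟩ := hP
  obtain ⟨β, hβ⟩ := CubeLink.exists_isCubeLabelling hPoly φ
  have hw : ∀ i, β (β.symm fun i => !β v i) i = !β v i := fun i => by
    rw [Equiv.apply_symm_apply]
  refine ⟨?_, β.symm fun i => !β v i, fun u => ?_, hβ.linkIso hPoly hw, fun _ => rfl⟩
  · refine CubeLink.IsLinked.of_iso
      ((hβ.linkIso hPoly hw).trans (hβ.induceIso hPoly v _)).symm ?_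
    exact CubeLink.isLinked_cubeGraph_induce (d + 1) (by omega) (by omega) (Fintype.card_fin _) _ _
      hw
  · have h1 := CubeLink.dist_cubeGraph_eq_card (β v) (β u)
    rw [Fintype.card_fin] at h1
    rw [← CubeLink.dist_iso (hβ.graphIso hPoly) v u, Equiv.eq_symm_apply]
    exact h1.trans funext_iff.symm
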